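/- Let $\mathbb{K}$ be a commutative ring, let $A$ be an associative unital $\mathbb{K}$-algebra that is flat as a $\mathbb{K}$-module, let $\mathbb{K}'$ be a commutative $\mathbb{K}$-algebra, and put $A' := \mathbb{K}' \otimes_{\mathbb{K}} A$ (a flat $\mathbb{K}'$-algebra). For a flat algebra $A$ over $\mathbb{K}$, regard $A$-$A$-bimodules relative to $\mathbb{K}$ as left $A \otimes_{\mathbb{K}} A^{\mathrm{op}}$-modules. A two-sided tilting complex over $A$ relative to $\mathbb{K}$ is an object $T$ of $\mathsf{D}^{\mathrm{b}}(\mathsf{Mod}\, A \otimes_{\mathbb{K}} A^{\mathrm{op}})$ for which there is an object $S$ of the same category with $S \otimes^{\mathrm{L}}_A T \cong A$ and $T \otimes^{\mathrm{L}}_A S \cong A$ in $\mathsf{D}(\mathsf{Mod}\, A \otimes_{\mathbb{K}} A^{\mathrm{op}})$. Let $\operatorname{DPic}_{\mathbb{K}}(A)$ be the set of isomorphism classes $[T]$ of two-sided tilting complexes over $A$ relative to $\mathbb{K}$, with the operation $[T] \cdot [S] := [T \otimes^{\mathrm{L}}_A S]$; likewise $\operatorname{DPic}_{\mathbb{K}'}(A')$.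 For $T \in \mathsf{D}^{-}(\mathsf{Mod}\, A \otimes_{\mathbb{K}} A^{\mathrm{op}})$ the object $\mathbb{K}' \otimes^{\mathrm{L}}_{\mathbb{K}} T$ of $\mathsf{D}(\mathsf{Mod}\, A' \otimes_{\mathbb{K}'} A'^{\mathrm{op}})$ is $\mathbb{K}' \otimes_{\mathbb{K}} P$, where $P \cong T$ is a bounded above complex of projective $A \otimes_{\mathbb{K}} A^{\mathrm{op}}$-modules. Then $\operatorname{DPic}_{\mathbb{K}}(A)$ and $\operatorname{DPic}_{\mathbb{K}'}(A')$ are groups under these (well-defined) operations, with the classes of $A$ and of $A'$ as unit elements; and for every two-sided tilting complex $T$ over $A$ relative to $\mathbb{K}$, the complex $\mathbb{K}' \otimes^{\mathrm{L}}_{\mathbb{K}} T$ is (isomorphic to) a two-sided tilting complex over $A'$ relative to $\mathbb{K}'$, and the formula $[T] \mapsto [\mathbb{K}' \otimes^{\mathrm{L}}_{\mathbb{K}} T]$ defines a group homomorphism $$\operatorname{DPic}_{\mathbb{K}}(A) \longrightarrow \operatorname{DPic}_{\mathbb{K}'}(A').$$ -/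

import Mathlib

open CategoryTheory
open MulOpposite (op)
open scoped TensorProduct

universe w w' u v

noncomputable section

/-! ### Bounded above projective resolutions -/

namespace ProjRes

variable {C : Type u} [Category.{v} C] [Abelian C]

/-- The cochain complex in `Cᵒᵖ` attached to a cochain complex in `C`. -/
def cochainOp (M : CochainComplex C ℤ) : CochainComplex Cᵒᵖ ℤ where
  X i := Opposite.op (M.X (-i))
  d i j := (M.d (-j) (-i)).op
  shape i j h := by
    rw [M.shape, Limits.op_zero]
    intro h'
    apply h
    simp only [ComplexShape.up_Rel] at h' ⊢
    lia
  d_comp_d' i j k _ _ := by rw [← op_comp, M.d_comp_d, Limits.op_zero]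

/-- The cochain complex in `C` attached to a cochain complex in `Cᵒᵖ`. -/
def cochainUnop (L : CochainComplex Cᵒᵖ ℤ) : CochainComplex C ℤ where
  X i := (L.X (-i)).unop
  d i j := (L.d (-j) (-i)).unop
  shape i j h := by
    rw [L.shape, Limits.unop_zero]
    intro h'
    apply h
    simp only [ComplexShape.up_Rel] at h' ⊢
    lia
  d_comp_d' i j k _ _ := by rw [← unop_comp, L.d_comp_d, Limits.unop_zero]

/-- `cochainUnop` on morphisms. -/
def cochainUnopMap {L L' : CochainComplex Cᵒᵖ ℤ} (f : L ⟶ L') :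
    cochainUnop L' ⟶ cochainUnop L where
  f i := (f.f (-i)).unop
  comm' i j _ := by
    dsimp [cochainUnop]
    rw [← unop_comp, ← unop_comp, f.comm]

lemma quasiIso_cochainUnopMap {L L' : CochainComplex Cᵒᵖ ℤ} (f : L ⟶ L') [QuasiIso f] :
    QuasiIso (cochainUnopMap f) := by
  refine ⟨fun i => ?_⟩
  rw [quasiIsoAt_iff' _ (i - 1) i (i + 1) (by simp) (by simp)]
  have h := (quasiIso_iff f).1 inferInstance (-i)
  rw [quasiIsoAt_iff' _ (-(i + 1)) (-i) (-(i - 1)) (by grind [CochainComplex.prev])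
    (by grind [CochainComplex.next])] at h
  exact ShortComplex.quasiIso_unopMap
    ((HomologicalComplex.shortComplexFunctor' Cᵒᵖ (ComplexShape.up ℤ)
      (-(i + 1)) (-i) (-(i - 1))).map f)

/-- Taking the opposite complex twice gives back the complex. -/
def cochainUnopOpIso (M : CochainComplex C ℤ) : cochainUnop (cochainOp M) ≅ M :=
  HomologicalComplex.Hom.isoOfComponents (fun n => M.XIsoOfEq (by simp))
    (fun i j _ => by simp [cochainUnop, cochainOp])

/-- A bounded above complex has a quasi-isomorphism from a bounded above complex of
projective objects. -/
theorem exists_quasiIso_projective [EnoughProjectives C] (M : CochainComplex C ℤ) (n : ℤ)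
    [M.IsStrictlyLE n] :
    ∃ (P : CochainComplex C ℤ) (f : P ⟶ M),
      QuasiIso f ∧ P.IsStrictlyLE n ∧ ∀ i, Projective (P.X i) := by
  have : (cochainOp M).IsStrictlyGE (-n) := by
    rw [CochainComplex.isStrictlyGE_iff]
    intro i hi
    exact (M.isZero_of_isStrictlyLE n (-i) (by lia)).op
  obtain ⟨L, f, hf, hL, hn⟩ :=
    CochainComplex.Plus.modelCategoryQuillen.exists_quasiIso_injective (cochainOp M) (-n)
  have := quasiIso_cochainUnopMap f
  refine ⟨cochainUnop L, cochainUnopMap f ≫ (cochainUnopOpIso M).hom, inferInstance, ?_, ?_⟩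
  · rw [CochainComplex.isStrictlyLE_iff]
    intro i hi
    exact (L.isZero_of_isStrictlyGE (-n) (-i) (by lia)).unop
  · intro i
    have := hL (-i)
    dsimp [cochainUnop]
    infer_instance

/-- Every object of `D⁻(C)` is isomorphic to a bounded above complex of projective objects. -/
theorem exists_projective_iso [EnoughProjectives C] [HasDerivedCategory.{w} C]
    (M : DerivedCategory.Minus C) :
    ∃ P : CochainComplex C ℤ, (∃ n, P.IsStrictlyLE n) ∧ (∀ i, Projective (P.X i)) ∧
      Nonempty (DerivedCategory.Q.obj P ≅ M.obj) := by
  obtain ⟨n, hn⟩ := M.property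
  obtain ⟨K, hK, ⟨e⟩⟩ := DerivedCategory.exists_iso_Q_obj_of_isLE M.obj n
  obtain ⟨P, f, hf, hP, hproj⟩ := exists_quasiIso_projective K n
  exact ⟨P, ⟨n, hP⟩, hproj, ⟨asIso (DerivedCategory.Q.map f) ≪≫ e.symm⟩⟩

/-- A chosen bounded above complex of projective objects isomorphic to `M ∈ D⁻(C)`. -/
def res [EnoughProjectives C] [HasDerivedCategory.{w} C] (M : DerivedCategory.Minus C) :
    CochainComplex C ℤ :=
  (exists_projective_iso M).choose

end ProjRes

/-! ### Bimodules, their tensor product and their base change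

An `A`-`B`-bimodule relative to `K` is a left `A ⊗[K] Bᵐᵒᵖ`-module. -/

namespace Bim

section

variable (K : Type u) [CommRing K] {R : Type u} [Ring R] [Algebra K R]

/-- The underlying `K`-module of a module over a `K`-algebra `R`. -/
@[reducible]
def baseModule (M : ModuleCat.{u} R) : Module K M := Module.compHom M (algebraMap K R)

attribute [local instance] baseModule

lemma base_isScalarTower (M : ModuleCat.{u} R) : IsScalarTower K R M where
  smul_assoc k r m := by
    change (k • r) • m = algebraMap K R k • (r • m)
    rw [Algebra.smul_def, mul_smul]

attribute [local instance] base_isScalarTower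

/-- A morphism of `R`-modules, as a `K`-linear map. -/
def baseMap {M N : ModuleCat.{u} R} (f : M ⟶ N) : M →ₗ[K] N := f.hom.restrictScalars K

end

attribute [local instance] baseModule base_isScalarTower

section Tensor

variable (K : Type u) [CommRing K] (A B C : Type u) [Ring A] [Algebra K A] [Ring B] [Algebra K B]
  [Ring C] [Algebra K C]

variable (M M' M'' : ModuleCat.{u} (A ⊗[K] Bᵐᵒᵖ)) (N N' N'' : ModuleCat.{u} (B ⊗[K] Cᵐᵒᵖ))

/-- The tensor product over `K` of an `A`-`B`-bimodule and a `B`-`C`-bimodule; it carries the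
`A`-`C`-bimodule structure `(a ⊗ op c) • (m ⊗ n) = a m ⊗ n c`. -/
def PreTensor : Type u := M ⊗[K] N

instance : AddCommGroup (PreTensor K A B C M N) := inferInstanceAs (AddCommGroup (M ⊗[K] N))

/-- The pure tensor `m ⊗ n`. -/
def PreTensor.tmul {M : ModuleCat.{u} (A ⊗[K] Bᵐᵒᵖ)} {N : ModuleCat.{u} (B ⊗[K] Cᵐᵒᵖ)}
    (m : M) (n : N) : PreTensor K A B C M N :=
  (m ⊗ₜ[K] n : M ⊗[K] N)

lemma PreTensor.induction {M : ModuleCat.{u} (A ⊗[K] Bᵐᵒᵖ)} {N : ModuleCat.{u} (B ⊗[K] Cᵐᵒᵖ)}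
    {p : PreTensor K A B C M N → Prop} (zero : p 0)
    (tmul : ∀ (m : M) (n : N), p (PreTensor.tmul K A B C m n))
    (add : ∀ x y, p x → p y → p (x + y)) (x : PreTensor K A B C M N) : p x :=
  TensorProduct.induction_on (motive := p) x zero tmul add

/-- The action of `A ⊗ Cᵐᵒᵖ` on `M ⊗[K] N`. -/
def preTensorAction : A ⊗[K] Cᵐᵒᵖ →ₐ[K] Module.End K (M ⊗[K] N) :=
  (Module.endTensorEndAlgHom (R := K) (S := K) (A := K) (M := M) (N := N)).comp
    (Algebra.TensorProduct.map
      ((Algebra.lsmul K K M).comp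
        (Algebra.TensorProduct.includeLeft : A →ₐ[K] A ⊗[K] Bᵐᵒᵖ))
      ((Algebra.lsmul K K N).comp
        (Algebra.TensorProduct.includeRight : Cᵐᵒᵖ →ₐ[K] B ⊗[K] Cᵐᵒᵖ)))

instance : Module (A ⊗[K] Cᵐᵒᵖ) (PreTensor K A B C M N) :=
  Module.compHom (M ⊗[K] N) (preTensorAction K A B C M N).toRingHom

lemma preTensor_smul_tmul (a : A) (c : C) (m : M) (n : N) :
    (a ⊗ₜ[K] op c : A ⊗[K] Cᵐᵒᵖ) • PreTensor.tmul K A B C m n =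
      PreTensor.tmul K A B C ((a ⊗ₜ[K] (1 : Bᵐᵒᵖ) : A ⊗[K] Bᵐᵒᵖ) • m)
        (((1 : B) ⊗ₜ[K] op c : B ⊗[K] Cᵐᵒᵖ) • n) :=
  rfl

/-- The relations `m b ⊗ n = m ⊗ b n` defining `M ⊗_B N`. -/
def tensorRel : Submodule (A ⊗[K] Cᵐᵒᵖ) (PreTensor K A B C M N) :=
  Submodule.span _ {x | ∃ (m : M) (b : B) (n : N),
    x = PreTensor.tmul K A B C (((1 : A) ⊗ₜ[K] op b : A ⊗[K] Bᵐᵒᵖ) • m) n -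
      PreTensor.tmul K A B C m ((b ⊗ₜ[K] (1 : Cᵐᵒᵖ) : B ⊗[K] Cᵐᵒᵖ) • n)}

/-- The `A`-`C`-bimodule `M ⊗_B N`. -/
def tensorObj : ModuleCat.{u} (A ⊗[K] Cᵐᵒᵖ) :=
  ModuleCat.of _ (PreTensor K A B C M N ⧸ tensorRel K A B C M N)

variable {M M' M'' N N' N''}

/-- `f ⊗ g` on `M ⊗[K] N`. -/
def preTensorMap (f : M ⟶ M') (g : N ⟶ N') :
    PreTensor K A B C M N →ₗ[A ⊗[K] Cᵐᵒᵖ] PreTensor K A B C M' N' where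
  toFun := TensorProduct.map (baseMap K f) (baseMap K g)
  map_add' := map_add _
  map_smul' r x := by
    change TensorProduct.map (baseMap K f) (baseMap K g) (preTensorAction K A B C M N r x) =
      preTensorAction K A B C M' N' r (TensorProduct.map (baseMap K f) (baseMap K g) x)
    have h : (TensorProduct.map (baseMap K f) (baseMap K g)).compRight K
          (M := M ⊗[K] N) ∘ₗ (preTensorAction K A B C M N).toLinearMap =
        LinearMap.lcomp K _ (TensorProduct.map (baseMap K f) (baseMap K g)) ∘ₗ
          (preTensorAction K A B C M' N').toLinearMap := by
      ext a c m n
      exact congrArg₂ (fun (x : M') (y : N') => (x ⊗ₜ[K] y : M' ⊗[K] N'))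
        (f.hom.map_smul _ _) (g.hom.map_smul _ _)
    exact LinearMap.congr_fun (LinearMap.congr_fun h r) x

@[simp]
lemma preTensorMap_tmul (f : M ⟶ M') (g : N ⟶ N') (m : M) (n : N) :
    preTensorMap K A B C f g (PreTensor.tmul K A B C m n) =
      PreTensor.tmul K A B C (f.hom m) (g.hom n) :=
  rfl

lemma tensorRel_le (f : M ⟶ M') (g : N ⟶ N') :
    tensorRel K A B C M N ≤ (tensorRel K A B C M' N').comap (preTensorMap K A B C f g) := by
  refine Submodule.span_le.2 ?_
  rintro _ ⟨m, b, n, rfl⟩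
  refine Submodule.subset_span ⟨f.hom m, b, g.hom n, ?_⟩
  simp

/-- `f ⊗_B g`. -/
def tensorMap (f : M ⟶ M') (g : N ⟶ N') : tensorObj K A B C M N ⟶ tensorObj K A B C M' N' :=
  ModuleCat.ofHom (Submodule.mapQ _ _ (preTensorMap K A B C f g) (tensorRel_le K A B C f g))

variable {K A B C} in
@[ext]
lemma tensor_hom_ext {X : ModuleCat.{u} (A ⊗[K] Cᵐᵒᵖ)} {f g : tensorObj K A B C M N ⟶ X}
    (h : ∀ (m : M) (n : N),
      f.hom (Submodule.Quotient.mk (p := tensorRel K A B C M N) (PreTensor.tmul K A B C m n)) =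
      g.hom (Submodule.Quotient.mk (p := tensorRel K A B C M N) (PreTensor.tmul K A B C m n))) :
    f = g := by
  refine ModuleCat.hom_ext (LinearMap.ext fun x => ?_)
  obtain ⟨x, rfl⟩ := Submodule.Quotient.mk_surjective _ x
  refine PreTensor.induction K A B C (p := fun x => f.hom (Submodule.Quotient.mk x) =
    g.hom (Submodule.Quotient.mk x)) ?_ h (fun x y hx hy => ?_) x
  · exact (map_zero f.hom).trans (map_zero g.hom).symm
  · exact (map_add f.hom (Submodule.Quotient.mk x) (Submodule.Quotient.mk y)).trans
      ((congrArg₂ _ hx hy).trans (map_add g.hom _ _).symm)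

@[simp]
lemma tensorMap_mk (f : M ⟶ M') (g : N ⟶ N') (m : M) (n : N) :
    (tensorMap K A B C f g).hom
        (Submodule.Quotient.mk (p := tensorRel K A B C M N) (PreTensor.tmul K A B C m n)) =
      Submodule.Quotient.mk (p := tensorRel K A B C M' N')
        (PreTensor.tmul K A B C (f.hom m) (g.hom n)) :=
  rfl

/-- The bifunctor `- ⊗_B -` from `A`-`B`-bimodules and `B`-`C`-bimodules to
`A`-`C`-bimodules, all relative to `K`. -/
def tensorFunctor : ModuleCat.{u} (A ⊗[K] Bᵐᵒᵖ) ⥤ ModuleCat.{u} (B ⊗[K] Cᵐᵒᵖ) ⥤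
    ModuleCat.{u} (A ⊗[K] Cᵐᵒᵖ) where
  obj M :=
    { obj N := tensorObj K A B C M N
      map g := tensorMap K A B C (𝟙 M) g
      map_id _ := by ext; rfl
      map_comp _ _ := by ext; rfl }
  map f :=
    { app N := tensorMap K A B C f (𝟙 N)
      naturality _ _ _ := by ext; rfl }
  map_id _ := by ext; rfl
  map_comp _ _ := by ext; rfl

instance : (tensorFunctor K A B C).PreservesZeroMorphisms where
  map_zero M M' := by
    refine NatTrans.ext (funext fun N => tensor_hom_ext fun m n => ?_)
    exact congrArg (Submodule.Quotient.mk (p := tensorRel K A B C M' N))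
      (TensorProduct.zero_tmul (R := K) M' n)

instance (M : ModuleCat.{u} (A ⊗[K] Bᵐᵒᵖ)) :
    ((tensorFunctor K A B C).obj M).PreservesZeroMorphisms where
  map_zero N N' := by
    refine tensor_hom_ext fun m n => ?_
    exact congrArg (Submodule.Quotient.mk (p := tensorRel K A B C M N'))
      (TensorProduct.tmul_zero (R := K) N' m)

/-- The total tensor product `P ⊗_B Q` of two complexes of bimodules: the complex with
`(P ⊗_B Q)ⁿ = ⨁_{i + j = n} Pⁱ ⊗_B Qʲ`. -/
def tensorComplex (P : CochainComplex (ModuleCat.{u} (A ⊗[K] Bᵐᵒᵖ)) ℤ)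
    (Q : CochainComplex (ModuleCat.{u} (B ⊗[K] Cᵐᵒᵖ)) ℤ) :
    CochainComplex (ModuleCat.{u} (A ⊗[K] Cᵐᵒᵖ)) ℤ :=
  HomologicalComplex.mapBifunctor P Q (tensorFunctor K A B C) (ComplexShape.up ℤ)

end Tensor

section BaseChange

variable (K : Type u) [CommRing K] (A B : Type u) [Ring A] [Algebra K A] [Ring B] [Algebra K B]
  (K' : Type u) [CommRing K'] [Algebra K K']

/-- The canonical homomorphism `A' ⊗_{K'} B'ᵒᵖ → K' ⊗_K (A ⊗_K Bᵒᵖ)`, where `A' = K' ⊗_K A` and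
`B' = K' ⊗_K B`; it sends `(k ⊗ a) ⊗ op (l ⊗ b)` to `(k l) ⊗ (a ⊗ op b)`. -/
def envBaseChange :
    (K' ⊗[K] A) ⊗[K'] (K' ⊗[K] B)ᵐᵒᵖ →ₐ[K'] K' ⊗[K] (A ⊗[K] Bᵐᵒᵖ) :=
  Algebra.TensorProduct.lift
    (Algebra.TensorProduct.map (AlgHom.id K' K') Algebra.TensorProduct.includeLeft)
    ((Algebra.TensorProduct.map (AlgEquiv.toOpposite K' K').symm.toAlgHom
      (Algebra.TensorProduct.includeRight : Bᵐᵒᵖ →ₐ[K] A ⊗[K] Bᵐᵒᵖ)).comp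
        (Algebra.TensorProduct.opAlgEquiv K K' K' B).symm.toAlgHom)
    (fun x y => by
      obtain ⟨y, rfl⟩ := (Algebra.TensorProduct.opAlgEquiv K K' K' B).surjective y
      induction x using TensorProduct.induction_on with
      | zero =>
        rw [map_zero]
        exact (zero_mul (_ : K' ⊗[K] (A ⊗[K] Bᵐᵒᵖ))).trans (mul_zero _).symm
      | add x x' hx hx' => rw [map_add]; exact hx.add_left hx'
      | tmul k a =>
        induction y using TensorProduct.induction_on with
        | zero =>
          rw [map_zero, map_zero]
          exact (mul_zero (_ : K' ⊗[K] (A ⊗[K] Bᵐᵒᵖ))).trans (zero_mul _).symm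
        | add y y' hy hy' => rw [map_add, map_add]; exact hy.add_right hy'
        | tmul l b =>
          simp [commute_iff_eq, mul_comm])

lemma envBaseChange_tmul (k l : K') (a : A) (b : B) :
    envBaseChange K A B K' ((k ⊗ₜ[K] a) ⊗ₜ[K'] op (l ⊗ₜ[K] b)) =
      (k * l) ⊗ₜ[K] (a ⊗ₜ[K] op b) := by
  simp [envBaseChange]

variable (M M' : ModuleCat.{u} (A ⊗[K] Bᵐᵒᵖ))

/-- The `K'`-module `K' ⊗_K M` for an `A`-`B`-bimodule `M`; it is an `A'`-`B'`-bimodule relative to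
`K'`, where `A' = K' ⊗_K A` and `B' = K' ⊗_K B`. -/
def BaseChange : Type u := K' ⊗[K] M

instance : AddCommGroup (BaseChange K A B K' M) := inferInstanceAs (AddCommGroup (K' ⊗[K] M))

/-- The action of `A' ⊗_{K'} B'ᵒᵖ` on `K' ⊗_K M`. -/
def baseChangeAction :
    (K' ⊗[K] A) ⊗[K'] (K' ⊗[K] B)ᵐᵒᵖ →ₐ[K'] Module.End K' (K' ⊗[K] M) :=
  ((Module.endTensorEndAlgHom (R := K) (S := K') (A := K') (M := K') (N := M)).comp
    (Algebra.TensorProduct.map (Algebra.lsmul K' K' K') (Algebra.lsmul K K M))).comp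
      (envBaseChange K A B K')

instance : Module ((K' ⊗[K] A) ⊗[K'] (K' ⊗[K] B)ᵐᵒᵖ) (BaseChange K A B K' M) :=
  Module.compHom (K' ⊗[K] M) (baseChangeAction K A B K' M).toRingHom

variable {M} in
/-- The pure tensor `k ⊗ m`. -/
def BaseChange.tmul (k : K') (m : M) : BaseChange K A B K' M := (k ⊗ₜ[K] m : K' ⊗[K] M)

lemma baseChange_smul_tmul (k l j : K') (a : A) (b : B) (m : M) :
    ((k ⊗ₜ[K] a) ⊗ₜ[K'] op (l ⊗ₜ[K] b) : (K' ⊗[K] A) ⊗[K'] (K' ⊗[K] B)ᵐᵒᵖ) •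
        BaseChange.tmul K A B K' j m =
      BaseChange.tmul K A B K' (k * l * j) ((a ⊗ₜ[K] op b : A ⊗[K] Bᵐᵒᵖ) • m) := by
  change (Module.endTensorEndAlgHom (R := K) (S := K') (A := K') (M := K') (N := M)
    (Algebra.TensorProduct.map (Algebra.lsmul K' K' K') (Algebra.lsmul K K M)
      (envBaseChange K A B K' _))) (j ⊗ₜ[K] m) = _
  rw [envBaseChange_tmul]
  rfl

variable {M M'} in
/-- `K' ⊗_K f` for a morphism `f` of bimodules. -/
def baseChangeMap (f : M ⟶ M') : BaseChange K A B K' M →ₗ[(K' ⊗[K] A) ⊗[K'] (K' ⊗[K] B)ᵐᵒᵖ]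
    BaseChange K A B K' M' where
  toFun := (baseMap K f).baseChange K'
  map_add' := map_add _
  map_smul' r x := by
    have h (s : K' ⊗[K] (A ⊗[K] Bᵐᵒᵖ)) (x : K' ⊗[K] M) :
        (baseMap K f).baseChange K'
          (Module.endTensorEndAlgHom (R := K) (S := K') (A := K') (M := K') (N := M)
            (Algebra.TensorProduct.map (Algebra.lsmul K' K' K') (Algebra.lsmul K K M) s) x) =
          Module.endTensorEndAlgHom (R := K) (S := K') (A := K') (M := K') (N := M')
            (Algebra.TensorProduct.map (Algebra.lsmul K' K' K') (Algebra.lsmul K K M') s)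
              ((baseMap K f).baseChange K' x) := by
      induction s using TensorProduct.induction_on with
      | zero => simp
      | add s t hs ht => simp only [map_add, LinearMap.add_apply, hs, ht]
      | tmul k s =>
        induction x using TensorProduct.induction_on with
        | zero => simp
        | add x y hx hy => simp only [map_add, hx, hy]
        | tmul j m =>
          exact congrArg (fun y : M' => ((k * j) ⊗ₜ[K] y : K' ⊗[K] M')) (f.hom.map_smul s m)
    exact h (envBaseChange K A B K' r) x

lemma BaseChange.hom_ext {X : Type*} [AddCommGroup X]
    {f g : BaseChange K A B K' M →+ X}
    (h : ∀ k m, f (BaseChange.tmul K A B K' k m) = g (BaseChange.tmul K A B K' k m)) : f = g :=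
  AddMonoidHom.ext fun x => TensorProduct.induction_on (R := K) (M := K') (N := M)
    (motive := fun x => f x = g x) x ((map_zero f).trans (map_zero g).symm) h
    fun x y hx hy => (map_add f x y).trans ((congrArg₂ _ hx hy).trans (map_add g x y).symm)

/-- The functor `K' ⊗_K -` from `A`-`B`-bimodules relative to `K` to `A'`-`B'`-bimodules relative
to `K'`. -/
def baseChangeFunctor : ModuleCat.{u} (A ⊗[K] Bᵐᵒᵖ) ⥤
    ModuleCat.{u} ((K' ⊗[K] A) ⊗[K'] (K' ⊗[K] B)ᵐᵒᵖ) where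
  obj M := ModuleCat.of _ (BaseChange K A B K' M)
  map f := ModuleCat.ofHom (baseChangeMap K A B K' f)
  map_id M := ModuleCat.hom_ext (LinearMap.toAddMonoidHom_injective
    (BaseChange.hom_ext K A B K' M fun _ _ => rfl))
  map_comp {M _ _} _ _ := ModuleCat.hom_ext (LinearMap.toAddMonoidHom_injective
    (BaseChange.hom_ext K A B K' M fun _ _ => rfl))

instance : (baseChangeFunctor K A B K').PreservesZeroMorphisms where
  map_zero M M' := ModuleCat.hom_ext (LinearMap.toAddMonoidHom_injective
    (BaseChange.hom_ext K A B K' M fun k _ => TensorProduct.tmul_zero (R := K) M' k))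

end BaseChange

end Bim

/-! ### Derived tensor product, derived base change, the derived Picard group -/

namespace DPicard

variable (K : Type u) [CommRing K] (A B C : Type u) [Ring A] [Algebra K A] [Ring B] [Algebra K B]
  [Ring C] [Algebra K C]

/-- The category of `A`-`B`-bimodules relative to `K`. -/
abbrev BimCat := ModuleCat.{u} (A ⊗[K] Bᵐᵒᵖ)

section

variable {A B C} [HasDerivedCategory.{w} (BimCat K A B)] [HasDerivedCategory.{w} (BimCat K B C)]
  [HasDerivedCategory.{w} (BimCat K A C)]

/-- The derived tensor product `M ⊗ᴸ_B N := P ⊗_B N`, where `P ≅ M` is a bounded above complex of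
projective `A ⊗[K] Bᵐᵒᵖ`-modules (and `N` is represented by some complex); the algebra `A` is
supposed to be flat over `K`. -/
def derivedTensor (M : DerivedCategory.Minus (BimCat K A B))
    (N : DerivedCategory.Minus (BimCat K B C)) : DerivedCategory (BimCat K A C) :=
  DerivedCategory.Q.obj
    (Bim.tensorComplex K A B C (ProjRes.res M) (DerivedCategory.Q.objPreimage N.obj))

end

section

variable {A B} (K' : Type u) [CommRing K'] [Algebra K K']
  [HasDerivedCategory.{w} (BimCat K A B)]
  [HasDerivedCategory.{w'} (BimCat K' (K' ⊗[K] A) (K' ⊗[K] B))]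

/-- The derived base change `K' ⊗ᴸ_K M := K' ⊗_K P`, where `P ≅ M` is a bounded above complex of
projective `A ⊗[K] Bᵐᵒᵖ`-modules; the algebras `A` and `B` are supposed to be flat over `K`, so that
`P` is a complex of flat `K`-modules. -/
def derivedBaseChange (M : DerivedCategory.Minus (BimCat K A B)) :
    DerivedCategory (BimCat K' (K' ⊗[K] A) (K' ⊗[K] B)) :=
  DerivedCategory.Q.obj
    (((Bim.baseChangeFunctor K A B K').mapHomologicalComplex (ComplexShape.up ℤ)).obj
      (ProjRes.res M))

end

variable [HasDerivedCategory.{w} (BimCat K A A)]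

/-- `A` as an `A`-`A`-bimodule: `(a ⊗ op b) • x = a x b`. -/
def diagonalBimodule : BimCat K A A :=
  letI : Module (A ⊗[K] Aᵐᵒᵖ) A := TensorProduct.Algebra.module
  ModuleCat.of _ A

/-- `A` as an object of the derived category of `A`-`A`-bimodules. -/
def diagonal : DerivedCategory (BimCat K A A) :=
  (DerivedCategory.singleFunctor (BimCat K A A) 0).obj (diagonalBimodule K A)

variable {K A} in
/-- A bounded object of the derived category, as a bounded above object. -/
def toMinus (T : DerivedCategory.Bounded (BimCat K A A)) : DerivedCategory.Minus (BimCat K A A) :=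
  ⟨T.obj, T.property.2⟩

variable {K A} in
/-- `T` is a two-sided tilting complex over `A` relative to `K`. -/
def IsTilting (T : DerivedCategory.Bounded (BimCat K A A)) : Prop :=
  ∃ S : DerivedCategory.Bounded (BimCat K A A),
    Nonempty (derivedTensor K (toMinus S) (toMinus T) ≅ diagonal K A) ∧
    Nonempty (derivedTensor K (toMinus T) (toMinus S) ≅ diagonal K A)

/-- The two-sided tilting complexes over `A` relative to `K`. -/
def TiltingComplex := {T : DerivedCategory.Bounded (BimCat K A A) // IsTilting T}

variable {K A} in
/-- A tilting complex as an object of `D⁻`. -/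
def TiltingComplex.minus (T : TiltingComplex K A) : DerivedCategory.Minus (BimCat K A A) :=
  toMinus T.1

variable {K A} in
/-- A tilting complex as an object of the derived category. -/
def TiltingComplex.obj (T : TiltingComplex K A) : DerivedCategory (BimCat K A A) := T.1.obj

/-- Isomorphism of tilting complexes. -/
instance isoSetoid : Setoid (TiltingComplex K A) where
  r T S := Nonempty (T.1 ≅ S.1)
  iseqv :=
    { refl _ := ⟨Iso.refl _⟩
      symm := fun ⟨e⟩ => ⟨e.symm⟩
      trans := fun ⟨e⟩ ⟨f⟩ => ⟨e ≪≫ f⟩ }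

/-- The underlying set of the derived Picard group of `A` relative to `K`: isomorphism classes of
two-sided tilting complexes. -/
def DPic := Quotient (isoSetoid K A)

variable {K A} in
/-- The class of a tilting complex in the derived Picard group. -/
def DPic.mk (T : TiltingComplex K A) : DPic K A := Quotient.mk _ T

variable {K A} in
/-- A group structure on the set `DPic K A` is the one of the derived Picard group if its operation
is `- ⊗ᴸ_A -` and its unit element is the class of `A`. -/
def IsDPicGroup (G : Group (DPic K A)) : Prop :=
  (∀ S T U : TiltingComplex K A, G.mul (DPic.mk S) (DPic.mk T) = DPic.mk U ↔
      Nonempty (derivedTensor K S.minus T.minus ≅ U.obj)) ∧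
    ∀ T : TiltingComplex K A, DPic.mk T = G.one ↔ Nonempty (T.obj ≅ diagonal K A)

end DPicard

end

/-! The isomorphism classes of objects of D⁻ of the category of A-A-bimodules form a monoid
`MinusClass` under the derived tensor product, with unit the class of A. Derived base change is a
homomorphism between two such monoids, and the derived Picard group is the group of units. The
theorem follows by passing to units; in particular, that tilting complexes go to tilting complexes
needs no separate argument.

For the monoid structure, the tensor product of bimodules is monoidal and commutes with coproducts,
so complexes of bimodules are monoidal too. What remains is independence of the resolution. Since A
is flat over K, a projective bimodule P is flat over K. The epimorphism P ⊗_K A → P of bimodules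
splits, so P ⊗_A - is a natural retract of the exact functor P ⊗_K -. Removing columns of the total
complex one at a time extends this to bounded above complexes of projectives
(`quasiIso_whiskerLeft`, `quasiIso_whiskerRight`).

For the identification with units, a tilting complex is required to have a bounded inverse, while a
unit only has an inverse in D⁻. The gap is closed by `exists_isGE_of_tensor_iso`. If S lives in
degrees ≤ m and is inverse to T, let f be the map to T from its truncation in degrees ≤ -m-1. Then S
⊗ f goes from degrees ≤ -1 to an object isomorphic to A, so it is zero in the derived category.
Tensoring with T shows that f itself is zero there, and hence T has no cohomology in degrees below
-m.

Base change commutes with the tensor product already on complexes (`bcTensorComplexIso`) and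
preserves projectives. The terms of a tensor product of projective resolutions, like A itself, need
not be projective bimodules, but they are flat over K. By `quasiIso_baseChange`, bounded above
complexes with K-flat terms suffice to compute the derived base change. -/

noncomputable section

/-! ### Bimodules through their two commuting actions; the universal property of M ⊗_B N -/

namespace Bim

attribute [local instance] baseModule base_isScalarTower

section Actions

variable {K : Type u} [CommRing K] {A B : Type u} [Ring A] [Algebra K A] [Ring B] [Algebra K B]
  {M N : ModuleCat.{u} (A ⊗[K] Bᵐᵒᵖ)}

/-- The left action of `A` on an `A`-`B`-bimodule. -/
def lact (a : A) : M →+ M := DistribSMul.toAddMonoidHom M (a ⊗ₜ[K] (1 : Bᵐᵒᵖ) : A ⊗[K] Bᵐᵒᵖ)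

/-- The right action of `B` on an `A`-`B`-bimodule. -/
def ract (b : B) : M →+ M := DistribSMul.toAddMonoidHom M ((1 : A) ⊗ₜ[K] op b : A ⊗[K] Bᵐᵒᵖ)

lemma lact_eq (a : A) (m : M) : lact a m = (a ⊗ₜ[K] (1 : Bᵐᵒᵖ) : A ⊗[K] Bᵐᵒᵖ) • m := rfl

lemma ract_eq (b : B) (m : M) : ract b m = ((1 : A) ⊗ₜ[K] op b : A ⊗[K] Bᵐᵒᵖ) • m := rfl

lemma tmul_smul_eq (a : A) (b : B) (m : M) :
    (a ⊗ₜ[K] op b : A ⊗[K] Bᵐᵒᵖ) • m = lact a (ract b m) := by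
  rw [lact_eq, ract_eq, smul_smul, Algebra.TensorProduct.tmul_mul_tmul, mul_one, one_mul]

lemma ract_lact (a : A) (b : B) (m : M) : ract b (lact a m) = lact a (ract b m) := by
  rw [← tmul_smul_eq, lact_eq, ract_eq, smul_smul, Algebra.TensorProduct.tmul_mul_tmul, mul_one,
    one_mul]

lemma lact_mul (a a' : A) (m : M) : lact (a * a') m = lact a (lact a' m) := by
  rw [lact_eq, lact_eq, lact_eq, smul_smul, Algebra.TensorProduct.tmul_mul_tmul, mul_one]

lemma ract_mul (b b' : B) (m : M) : ract (b * b') m = ract b' (ract b m) := by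
  rw [ract_eq, ract_eq, ract_eq, smul_smul, Algebra.TensorProduct.tmul_mul_tmul, mul_one,
    MulOpposite.op_mul]

lemma lact_one (m : M) : lact (1 : A) m = m := one_smul (A ⊗[K] Bᵐᵒᵖ) m

lemma ract_one (m : M) : ract (1 : B) m = m := one_smul (A ⊗[K] Bᵐᵒᵖ) m

lemma lact_add (a a' : A) (m : M) : lact (a + a') m = lact a m + lact a' m := by
  rw [lact_eq, TensorProduct.add_tmul, add_smul]; rfl

lemma ract_add (b b' : B) (m : M) : ract (b + b') m = ract b m + ract b' m := by
  rw [ract_eq, MulOpposite.op_add, TensorProduct.tmul_add, add_smul]; rfl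

lemma base_smul_eq_lact (k : K) (m : M) : k • m = lact (algebraMap K A k) m := rfl

/-- Scalars of K pass through the tensor sign of A ⊗ Bᵐᵒᵖ, so the base action can be read on either
side. This is why a B-balanced map is automatically K-balanced. -/
lemma base_smul_eq_ract (k : K) (m : M) : k • m = ract (algebraMap K B k) m := by
  rw [base_smul_eq_lact, lact_eq, ract_eq]
  congr 1
  change _ = (1 : A) ⊗ₜ[K] algebraMap K Bᵐᵒᵖ k
  rw [Algebra.algebraMap_eq_smul_one, Algebra.algebraMap_eq_smul_one, TensorProduct.smul_tmul]

@[simp]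
lemma hom_lact (f : M ⟶ N) (a : A) (m : M) : f.hom (lact a m) = lact a (f.hom m) :=
  f.hom.map_smul _ m

@[simp]
lemma hom_ract (f : M ⟶ N) (b : B) (m : M) : f.hom (ract b m) = ract b (f.hom m) :=
  f.hom.map_smul _ m

/-- An additive map that commutes with both actions is linear. -/
def homLinear (f : M →+ N) (hl : ∀ a m, f (lact a m) = lact a (f m))
    (hr : ∀ b m, f (ract b m) = ract b (f m)) : M →ₗ[A ⊗[K] Bᵐᵒᵖ] N where
  toFun := f
  map_add' := map_add f
  map_smul' r m := by
    change f (r • m) = r • f m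
    induction r using TensorProduct.induction_on with
    | zero =>
      exact (congrArg f (zero_smul (A ⊗[K] Bᵐᵒᵖ) m)).trans
        ((map_zero f).trans (zero_smul (A ⊗[K] Bᵐᵒᵖ) (f m)).symm)
    | add x y hx hy => rw [add_smul, add_smul, map_add, hx, hy]
    | tmul a b =>
      obtain ⟨b, rfl⟩ := MulOpposite.op_surjective b
      rw [tmul_smul_eq, tmul_smul_eq, hl, hr]

/-- A morphism of bimodules from an additive map that commutes with both actions. -/
def homMk (f : M →+ N) (hl : ∀ a m, f (lact a m) = lact a (f m))
    (hr : ∀ b m, f (ract b m) = ract b (f m)) : M ⟶ N :=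
  ModuleCat.ofHom (homLinear f hl hr)

end Actions

section Lift

variable {K : Type u} [CommRing K] {A B C : Type u} [Ring A] [Algebra K A] [Ring B] [Algebra K B]
  [Ring C] [Algebra K C]

variable {M M' : ModuleCat.{u} (A ⊗[K] Bᵐᵒᵖ)} {N N' : ModuleCat.{u} (B ⊗[K] Cᵐᵒᵖ)}

/-- The class of `m ⊗ n` in `M ⊗_B N`. -/
def mk (m : M) (n : N) : tensorObj K A B C M N :=
  Submodule.Quotient.mk (p := tensorRel K A B C M N) (PreTensor.tmul K A B C m n)

lemma mk_add (m : M) (n n' : N) : mk m (n + n') = mk m n + mk m n' :=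
  congrArg (Submodule.Quotient.mk (p := tensorRel K A B C M N))
    (TensorProduct.tmul_add (R := K) m n n')

lemma add_mk (m m' : M) (n : N) : mk (m + m') n = mk m n + mk m' n :=
  congrArg (Submodule.Quotient.mk (p := tensorRel K A B C M N))
    (TensorProduct.add_tmul (R := K) m m' n)

variable (M N) in
/-- `mk` as a biadditive map. -/
def mkHom : M →+ N →+ tensorObj K A B C M N :=
  AddMonoidHom.mk' (fun m => AddMonoidHom.mk' (mk m) (mk_add m))
    fun m m' => AddMonoidHom.ext fun n => add_mk m m' n

lemma mkHom_apply (m : M) (n : N) : mkHom M N m n = mk m n := rfl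

@[simp]
lemma mk_zero (m : M) : mk m (0 : N) = 0 := map_zero (mkHom M N m)

@[simp]
lemma zero_mk (n : N) : mk (0 : M) n = 0 := DFunLike.congr_fun (map_zero (mkHom M N)) n

lemma ract_mk_eq (m : M) (b : B) (n : N) : mk (ract b m) n = mk m (lact b n) :=
  (Submodule.Quotient.eq _).2 (Submodule.subset_span ⟨m, b, n, rfl⟩)

@[simp]
lemma lact_mk (a : A) (m : M) (n : N) : lact a (mk m n) = mk (lact a m) n := by
  refine (congrArg (Submodule.Quotient.mk (p := tensorRel K A B C M N))
    (preTensor_smul_tmul K A B C M N a 1 m n)).trans ?_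
  exact congrArg (mk _) (one_smul (B ⊗[K] Cᵐᵒᵖ) n)

@[simp]
lemma ract_mk (c : C) (m : M) (n : N) : ract c (mk m n) = mk m (ract c n) := by
  refine (congrArg (Submodule.Quotient.mk (p := tensorRel K A B C M N))
    (preTensor_smul_tmul K A B C M N 1 c m n)).trans ?_
  exact congrArg (mk · _) (one_smul (A ⊗[K] Bᵐᵒᵖ) m)

lemma tensor_induction {p : tensorObj K A B C M N → Prop} (zero : p 0)
    (mk : ∀ (m : M) (n : N), p (mk m n)) (add : ∀ x y, p x → p y → p (x + y))
    (x : tensorObj K A B C M N) : p x := by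
  obtain ⟨x, rfl⟩ := Submodule.Quotient.mk_surjective _ x
  exact PreTensor.induction K A B C (p := fun x => p (Submodule.Quotient.mk x)) zero mk
    (fun x y => add _ _) x

lemma tensor_addHom_ext {X : Type*} [AddCommGroup X] {f g : tensorObj K A B C M N →+ X}
    (h : ∀ (m : M) (n : N), f (mk m n) = g (mk m n)) : f = g := by
  ext x
  induction x using tensor_induction with
  | zero => simp
  | mk m n => exact h m n
  | add x y hx hy => rw [map_add, map_add, hx, hy]

section

variable {X : Type*} [AddCommGroup X] (φ : M →+ N →+ X)
  (h : ∀ (m : M) (b : B) (n : N), φ (ract b m) n = φ m (lact b n))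

/-- Auxiliary definition for `liftAdd`. -/
def preLift : PreTensor K A B C M N →+ X :=
  TensorProduct.liftAddHom (R := K) φ fun k m n => by
    rw [base_smul_eq_ract, base_smul_eq_lact, h]

lemma preLift_tmul (m : M) (n : N) : preLift φ h (PreTensor.tmul K A B C m n) = φ m n := rfl

/-- The additive map on `M ⊗_B N` induced by a `B`-balanced biadditive map. -/
def liftAdd : tensorObj K A B C M N →+ X :=
  QuotientAddGroup.lift (tensorRel K A B C M N).toAddSubgroup (preLift φ h) fun x hx => by
    -- The relations are a span over A ⊗ Cᵐᵒᵖ, but `preLift` is only additive. The claim is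
    -- strengthened to all multiples of x so that it survives the scalar step of the span induction.
    suffices ∀ r : A ⊗[K] Cᵐᵒᵖ, preLift φ h (r • x) = 0 by simpa using this 1
    refine Submodule.span_induction (p := fun x _ => ∀ r : A ⊗[K] Cᵐᵒᵖ, preLift φ h (r • x) = 0)
      ?_ ?_ ?_ ?_ hx
    · rintro _ ⟨m, b, n, rfl⟩ r
      induction r using TensorProduct.induction_on with
      | zero =>
        exact (congrArg _ (zero_smul (A ⊗[K] Cᵐᵒᵖ) (_ : PreTensor K A B C M N))).trans (map_zero _)
      | add r s hr hs => rw [add_smul, map_add, hr, hs, add_zero]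
      | tmul a c =>
        obtain ⟨c, rfl⟩ := MulOpposite.op_surjective c
        rw [smul_sub, preTensor_smul_tmul, preTensor_smul_tmul, map_sub, preLift_tmul,
          preLift_tmul]
        change φ (lact a (ract b m)) (ract c n) - φ (lact a m) (ract c (lact b n)) = 0
        -- A multiple of a relation is again a relation, because the outer actions commute with
        -- those of B.
        rw [← ract_lact, h, ract_lact, sub_self]
    · intro r; rw [smul_zero, map_zero]
    · intro x y _ _ hx hy r; rw [smul_add, map_add, hx, hy, add_zero]
    · intro s x _ hx r; rw [smul_smul]; exact hx _

@[simp]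
lemma liftAdd_mk (m : M) (n : N) : liftAdd φ h (mk m n) = φ m n := rfl

end

/-- The morphism of bimodules out of `M ⊗_B N` induced by a balanced biadditive map that commutes
with the outer actions. -/
def lift {X : ModuleCat.{u} (A ⊗[K] Cᵐᵒᵖ)} (φ : M →+ N →+ X)
    (h : ∀ (m : M) (b : B) (n : N), φ (ract b m) n = φ m (lact b n))
    (hl : ∀ (a : A) (m : M) (n : N), φ (lact a m) n = lact a (φ m n))
    (hr : ∀ (c : C) (m : M) (n : N), φ m (ract c n) = ract c (φ m n)) :
    tensorObj K A B C M N ⟶ X :=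
  homMk (liftAdd φ h)
    (fun a x => by
      induction x using tensor_induction with
      | zero => simp
      | mk m n => simp [hl]
      | add x y hx hy => simp only [map_add, hx, hy])
    (fun c x => by
      induction x using tensor_induction with
      | zero => simp
      | mk m n => simp [hr]
      | add x y hx hy => simp only [map_add, hx, hy])

@[simp]
lemma tensorMap_mk' (f : M ⟶ M') (g : N ⟶ N') (m : M) (n : N) :
    (tensorMap K A B C f g).hom (mk m n) = mk (f.hom m) (g.hom n) := rfl

lemma hom_ext_mk {X : ModuleCat.{u} (A ⊗[K] Cᵐᵒᵖ)} {f g : tensorObj K A B C M N ⟶ X}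
    (h : ∀ (m : M) (n : N), f.hom (mk m n) = g.hom (mk m n)) : f = g :=
  tensor_hom_ext h

end Lift

end Bim

/-! ### Associativity, units and the monoidal category of bimodules -/

namespace Bim

attribute [local instance] baseModule base_isScalarTower

section Associator

variable {K : Type u} [CommRing K] {A B C D : Type u} [Ring A] [Algebra K A] [Ring B] [Algebra K B]
  [Ring C] [Algebra K C] [Ring D] [Algebra K D]

variable (M : ModuleCat.{u} (A ⊗[K] Bᵐᵒᵖ)) (N : ModuleCat.{u} (B ⊗[K] Cᵐᵒᵖ))
  (L : ModuleCat.{u} (C ⊗[K] Dᵐᵒᵖ))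

/-- `l ↦ m ⊗ (n ⊗ l)`, additive in `m` and `n`. -/
def assocPre : M →+ N →+ L →+ tensorObj K A B D M (tensorObj K B C D N L) :=
  AddMonoidHom.mk' (fun m => (AddMonoidHom.compHom (mkHom M (tensorObj K B C D N L) m)).comp
    (mkHom N L)) fun m m' => by
      ext n l; exact add_mk m m' (mk n l)

/-- `(m ⊗ n) ↦ (l ↦ m ⊗ (n ⊗ l))`. -/
def assocPre' : tensorObj K A B C M N →+ L →+ tensorObj K A B D M (tensorObj K B C D N L) :=
  liftAdd (assocPre M N L) fun m b n => by
    ext l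
    change mk (ract b m) (mk n l) = mk m (mk (lact b n) l)
    rw [ract_mk_eq, lact_mk]

lemma assocPre'_mk (m : M) (n : N) (l : L) : assocPre' M N L (mk m n) l = mk m (mk n l) := rfl

/-- `(m ⊗ n) ⊗ l ↦ m ⊗ (n ⊗ l)`. -/
def assocHom : tensorObj K A C D (tensorObj K A B C M N) L ⟶
    tensorObj K A B D M (tensorObj K B C D N L) :=
  lift (assocPre' M N L)
    (fun x c l => by
      induction x using tensor_induction with
      | zero => simp
      | add x y hx hy => simp only [map_add, AddMonoidHom.add_apply, hx, hy]
      | mk m n => rw [ract_mk, assocPre'_mk, assocPre'_mk, ract_mk_eq])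
    (fun a x l => by
      induction x using tensor_induction with
      | zero => simp
      | add x y hx hy => simp only [map_add, AddMonoidHom.add_apply, hx, hy]
      | mk m n => rw [lact_mk, assocPre'_mk, assocPre'_mk, lact_mk])
    (fun d x l => by
      induction x using tensor_induction with
      | zero => simp
      | add x y hx hy => simp only [map_add, AddMonoidHom.add_apply, hx, hy]
      | mk m n => rw [assocPre'_mk, assocPre'_mk, ract_mk, ract_mk])

/-- `m ⊗ (n ⊗ l) ↦ (m ⊗ n) ⊗ l`. -/
def assocInv : tensorObj K A B D M (tensorObj K B C D N L) ⟶
    tensorObj K A C D (tensorObj K A B C M N) L :=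
  lift
    (AddMonoidHom.mk' (fun m => liftAdd
        ((mkHom (tensorObj K A B C M N) L).comp (mkHom M N m)) fun n c l => by
          change mk (mk m (ract c n)) l = mk (mk m n) (lact c l)
          rw [← ract_mk, ract_mk_eq]) fun m m' => tensor_addHom_ext fun n l => by
          change mk (mk (m + m') n) l = mk (mk m n) l + mk (mk m' n) l
          rw [add_mk, add_mk])
    (fun m b x => by
      induction x using tensor_induction with
      | zero => simp
      | add x y hx hy => simp only [map_add, hx, hy]
      | mk n l =>
        rw [lact_mk]
        change mk (mk (ract b m) n) l = mk (mk m (lact b n)) l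
        rw [ract_mk_eq])
    (fun a m x => by
      induction x using tensor_induction with
      | zero => simp
      | add x y hx hy => simp only [map_add, hx, hy]
      | mk n l =>
        change mk (mk (lact a m) n) l = lact a (mk (mk m n) l)
        rw [lact_mk, lact_mk])
    (fun d m x => by
      induction x using tensor_induction with
      | zero => simp
      | add x y hx hy => simp only [map_add, hx, hy]
      | mk n l =>
        rw [ract_mk]
        change mk (mk m n) (ract d l) = ract d (mk (mk m n) l)
        rw [ract_mk])

variable {M N L}

/-- Two morphisms out of `(M ⊗ N) ⊗ L` agree if they agree on pure tensors. -/
lemma hom_ext_mk₃ {X : ModuleCat.{u} (A ⊗[K] Dᵐᵒᵖ)}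
    {f g : tensorObj K A C D (tensorObj K A B C M N) L ⟶ X}
    (h : ∀ (m : M) (n : N) (l : L), f.hom (mk (mk m n) l) = g.hom (mk (mk m n) l)) : f = g := by
  refine hom_ext_mk fun x l => ?_
  induction x using tensor_induction with
  | zero => simp
  | add x y hx hy => rw [add_mk, map_add, map_add, hx, hy]
  | mk m n => exact h m n l

lemma hom_ext_mk₃' {X : ModuleCat.{u} (A ⊗[K] Dᵐᵒᵖ)}
    {f g : tensorObj K A B D M (tensorObj K B C D N L) ⟶ X}
    (h : ∀ (m : M) (n : N) (l : L), f.hom (mk m (mk n l)) = g.hom (mk m (mk n l))) : f = g := by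
  refine hom_ext_mk fun m x => ?_
  induction x using tensor_induction with
  | zero => simp
  | add x y hx hy => rw [mk_add, map_add, map_add, hx, hy]
  | mk n l => exact h m n l

variable (M N L) in
/-- The associativity isomorphism of the tensor product of bimodules. -/
def assocIso : tensorObj K A C D (tensorObj K A B C M N) L ≅
    tensorObj K A B D M (tensorObj K B C D N L) where
  hom := assocHom M N L
  inv := assocInv M N L
  hom_inv_id := hom_ext_mk₃ fun _ _ _ => rfl
  inv_hom_id := hom_ext_mk₃' fun _ _ _ => rfl

end Associator

section Unit

variable {K : Type u} [CommRing K] {A B : Type u} [Ring A] [Algebra K A] [Ring B] [Algebra K B]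

open DPicard

/-- An element of `A` as an element of the diagonal bimodule. -/
def toDiag : A ≃+ diagonalBimodule K A := AddEquiv.refl A

@[simp]
lemma lact_toDiag (a x : A) : lact a (toDiag (K := K) x) = toDiag (a * x) := by
  let : Module (A ⊗[K] Aᵐᵒᵖ) A := TensorProduct.Algebra.module
  exact (TensorProduct.Algebra.smul_def (R := K) (A := A) (B := Aᵐᵒᵖ) a 1 x).trans
    (congrArg (a * ·) (one_smul _ x))

@[simp]
lemma ract_toDiag (b x : A) : ract b (toDiag (K := K) x) = toDiag (x * b) := by
  let : Module (A ⊗[K] Aᵐᵒᵖ) A := TensorProduct.Algebra.module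
  exact (TensorProduct.Algebra.smul_def (R := K) (A := A) (B := Aᵐᵒᵖ) 1 (op b) x).trans
    (one_mul _)

/-- Puts elements of the diagonal bimodule in the form `toDiag a`, to which the rewriting rules for
the two actions apply. -/
lemma diag_cases {p : diagonalBimodule K A → Prop} (h : ∀ a, p (toDiag a))
    (x : diagonalBimodule K A) : p x :=
  h x

section

variable (M : ModuleCat.{u} (A ⊗[K] Bᵐᵒᵖ))

/-- The left action of `A` on an `A`-`B`-bimodule, as a map out of `A`. -/
def lactHom : diagonalBimodule K A →+ M →+ M :=
  (AddMonoidHom.mk' (fun a : A => (lact a : M →+ M)) fun a a' =>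
    AddMonoidHom.ext (lact_add a a')).comp toDiag.symm.toAddMonoidHom

@[simp]
lemma lactHom_toDiag (a : A) (m : M) : lactHom M (toDiag a) m = lact a m := rfl

/-- `A ⊗_A M ≅ M`. -/
def leftUnitIso : tensorObj K A A B (diagonalBimodule K A) M ≅ M where
  hom := lift (lactHom M)
    (fun a b m => by
      induction a using diag_cases with
      | h a => rw [ract_toDiag, lactHom_toDiag, lact_mul, lactHom_toDiag])
    (fun a a' m => by
      induction a' using diag_cases with
      | h a' => rw [lact_toDiag, lactHom_toDiag, lact_mul, lactHom_toDiag])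
    (fun b a m => by
      induction a using diag_cases with
      | h a => rw [lactHom_toDiag, lactHom_toDiag, ract_lact])
  inv := homMk (mkHom (diagonalBimodule K A) M (toDiag 1))
    (fun a m => by
      rw [mkHom_apply, mkHom_apply, lact_mk, ← ract_mk_eq, ract_toDiag, lact_toDiag, one_mul,
        mul_one])
    (fun b m => by rw [mkHom_apply, mkHom_apply, ract_mk])
  hom_inv_id := hom_ext_mk fun a m => by
    induction a using diag_cases with
    | h a =>
      change mk (toDiag 1) (lact a m) = mk (toDiag a) m
      rw [← ract_mk_eq, ract_toDiag, one_mul]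
  inv_hom_id := by
    ext m
    exact lact_one m

@[simp]
lemma leftUnitIso_hom_mk (a : A) (m : M) :
    (leftUnitIso M).hom.hom (mk (toDiag a) m) = lact a m := rfl

end

section

variable (M : ModuleCat.{u} (B ⊗[K] Aᵐᵒᵖ))

/-- The right action of `A` on a `B`-`A`-bimodule, as a map out of `A`. -/
def ractHom : M →+ diagonalBimodule K A →+ M :=
  ((AddMonoidHom.mk' (fun a : A => (ract a : M →+ M)) fun a a' =>
    AddMonoidHom.ext (ract_add a a')).comp toDiag.symm.toAddMonoidHom).flip

@[simp]
lemma ractHom_toDiag (a : A) (m : M) : ractHom M m (toDiag a) = ract a m := rfl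

/-- `M ⊗_A A ≅ M`. -/
def rightUnitIso : tensorObj K B A A M (diagonalBimodule K A) ≅ M where
  hom := lift (ractHom M)
    (fun m b a => by
      induction a using diag_cases with
      | h a => rw [lact_toDiag, ractHom_toDiag, ractHom_toDiag, ract_mul])
    (fun b m a => by
      induction a using diag_cases with
      | h a => rw [ractHom_toDiag, ractHom_toDiag, ract_lact])
    (fun a' m a => by
      induction a using diag_cases with
      | h a => rw [ract_toDiag, ractHom_toDiag, ract_mul, ractHom_toDiag])
  inv := homMk ((mkHom M (diagonalBimodule K A)).flip (toDiag 1))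
    (fun a m => by
      change mk (lact a m) (toDiag 1) = lact a (mk m (toDiag 1))
      rw [lact_mk])
    (fun b m => by
      change mk (ract b m) (toDiag 1) = ract b (mk m (toDiag 1))
      rw [ract_mk, ract_mk_eq, ract_toDiag, lact_toDiag, one_mul, mul_one])
  hom_inv_id := hom_ext_mk fun m a => by
    induction a using diag_cases with
    | h a =>
      change mk (ract a m) (toDiag 1) = mk m (toDiag a)
      rw [ract_mk_eq, lact_toDiag, mul_one]
  inv_hom_id := by
    ext m
    exact ract_one m

@[simp]
lemma rightUnitIso_hom_mk (a : A) (m : M) :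
    (rightUnitIso M).hom.hom (mk m (toDiag a)) = ract a m := rfl

end

end Unit

section Monoidal

variable (K : Type u) [CommRing K] (A : Type u) [Ring A] [Algebra K A]

open DPicard

/-- The monoidal category of `A`-`A`-bimodules relative to `K`. -/
@[reducible]
def monoidal : MonoidalCategory (BimCat K A A) where
  tensorObj M N := tensorObj K A A A M N
  whiskerLeft M _ _ g := tensorMap K A A A (𝟙 M) g
  whiskerRight f N := tensorMap K A A A f (𝟙 N)
  tensorHom f g := tensorMap K A A A f g
  tensorUnit := diagonalBimodule K A
  associator M N L := assocIso M N L
  leftUnitor M := leftUnitIso M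
  rightUnitor M := rightUnitIso M
  tensorHom_def f g := hom_ext_mk fun _ _ => rfl
  id_tensorHom_id M N := hom_ext_mk fun _ _ => rfl
  tensorHom_comp_tensorHom _ _ _ _ := hom_ext_mk fun _ _ => rfl
  whiskerLeft_id M N := hom_ext_mk fun _ _ => rfl
  id_whiskerRight M N := hom_ext_mk fun _ _ => rfl
  associator_naturality f g h := hom_ext_mk₃ fun _ _ _ => rfl
  leftUnitor_naturality f := hom_ext_mk fun a m => by
    induction a using diag_cases with
    | h a => exact (hom_lact f a m).symm
  rightUnitor_naturality f := hom_ext_mk fun m a => by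
    induction a using diag_cases with
    | h a => exact (hom_ract f a m).symm
  pentagon M N L P := hom_ext_mk fun x p => by
    induction x using tensor_induction with
    | zero => rw [zero_mk, map_zero, map_zero]
    | add x y hx hy => rw [add_mk, map_add, map_add, hx, hy]
    | mk x l =>
      induction x using tensor_induction with
      | zero => rw [zero_mk, zero_mk, map_zero, map_zero]
      | add x y hx hy => rw [add_mk, add_mk, map_add, map_add, hx, hy]
      | mk m n => rfl
  triangle M N := hom_ext_mk₃ fun m a n => by
    induction a using diag_cases with
    | h a => exact (ract_mk_eq m a n).symm

end Monoidal

end Bim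

/-! ### Coproducts of modules and their preservation by tensor products -/

namespace ModuleCat

open Limits

section Coproducts

variable {R : Type u} [Ring R] {J : Type} (Y : J → ModuleCat.{u} R)

lemma coprodIsoDirectSum_hom_component [DecidableEq J] (j : J) :
    (coprodIsoDirectSum Y).hom ≫ ofHom (DirectSum.component R J (fun i => Y i) j) =
      Sigma.π Y j := by
  classical
  refine Sigma.hom_ext _ _ fun i => ?_
  rw [← Category.assoc, ι_coprodIsoDirectSum_hom]
  by_cases h : i = j
  · subst h
    rw [Sigma.ι_π_eq_id]
    ext x
    exact DirectSum.component.lof_self (M := fun i => Y i) R i x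
  · rw [Sigma.ι_π_of_ne Y h]
    ext x
    exact (DirectSum.component.of (M := fun i => Y i) R j i x).trans (dif_neg h)

variable [DecidableEq J] in
lemma coproduct_eq_zero (z : (∐ Y : ModuleCat.{u} R)) (h : ∀ j, (Sigma.π Y j).hom z = 0) :
    z = 0 := by
  apply (coprodIsoDirectSum Y).toLinearEquiv.injective
  rw [map_zero]
  refine DFinsupp.ext fun j => ?_
  refine Eq.trans ?_ (h j)
  rw [← coprodIsoDirectSum_hom_component]
  rfl

variable [DecidableEq J] in
lemma coproduct_finite_support (z : (∐ Y : ModuleCat.{u} R)) :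
    {j | (Sigma.π Y j).hom z ≠ 0}.Finite := by
  classical
  refine Set.Finite.subset
    (DFinsupp.finite_support ((coprodIsoDirectSum Y).hom.hom z : DirectSum J fun i => Y i))
    fun j hj h => hj ?_
  rw [← coprodIsoDirectSum_hom_component]
  exact h

lemma coproduct_mem_iSup_range (z : (∐ Y : ModuleCat.{u} R)) :
    z ∈ ⨆ j, LinearMap.range (Sigma.ι Y j).hom := by
  classical
  obtain ⟨x, rfl⟩ := (coprodIsoDirectSum Y).toLinearEquiv.symm.surjective z
  induction x using DirectSum.induction_on with
  | zero => rw [map_zero]; exact zero_mem _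
  | add x y hx hy => rw [map_add]; exact add_mem hx hy
  | of j x =>
    refine Submodule.mem_iSup_of_mem j ⟨x, ?_⟩
    exact (congrArg (fun f => f.hom x) (lof_coprodIsoDirectSum_inv Y j)).symm

/-- A functor between categories of modules preserves a coproduct as soon as its value at the
coproduct is generated by the images of the summands. -/
lemma preservesColimit_of_span {S : Type u} [Ring S] (F : ModuleCat.{u} R ⥤ ModuleCat.{u} S)
    [F.PreservesZeroMorphisms]
    (h : ∀ p : AddSubgroup (F.obj (∐ Y)), (∀ j y, (F.map (Sigma.ι Y j)).hom y ∈ p) → ∀ x, x ∈ p) :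
    PreservesColimit (Discrete.functor Y) F := by
  classical
  suffices IsIso (sigmaComparison F Y) from PreservesCoproduct.of_iso_comparison F Y
  rw [ConcreteCategory.isIso_iff_bijective]
  constructor
  -- Injectivity is automatic: F preserves zero morphisms, so the images under F of the projections
  -- recover every coordinate of z from its image.
  · refine (injective_iff_map_eq_zero (sigmaComparison F Y).hom).2 fun z hz => ?_
    refine coproduct_eq_zero (fun j => F.obj (Y j)) z fun j => ?_
    have : Sigma.π (fun j => F.obj (Y j)) j = sigmaComparison F Y ≫ F.map (Sigma.π Y j) := by
      refine Sigma.hom_ext _ _ fun i => ?_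
      rw [ι_comp_sigmaComparison_assoc, ← F.map_comp]
      by_cases h : i = j
      · subst h
        rw [Sigma.ι_π_eq_id, Sigma.ι_π_eq_id, F.map_id]
      · rw [Sigma.ι_π_of_ne _ h, Sigma.ι_π_of_ne _ h, F.map_zero]
    rw [this]
    exact (congrArg (F.map (Sigma.π Y j)).hom hz).trans (map_zero _)
  -- Surjectivity is the generation hypothesis, applied to the range of the comparison map.
  · intro x
    refine h (AddMonoidHom.range (sigmaComparison F Y).hom.toAddMonoidHom) (fun j y => ?_) x
    refine ⟨(Sigma.ι (fun j => F.obj (Y j)) j).hom y, ?_⟩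
    exact congrArg (fun f => f.hom y) (ι_comp_sigmaComparison F Y j)

lemma preservesColimitsOfShape_discrete {S : Type u} [Ring S]
    (F : ModuleCat.{u} R ⥤ ModuleCat.{u} S) [F.PreservesZeroMorphisms]
    (h : ∀ (Y : J → ModuleCat.{u} R) (p : AddSubgroup (F.obj (∐ Y))),
      (∀ j y, (F.map (Sigma.ι Y j)).hom y ∈ p) → ∀ x, x ∈ p) :
    PreservesColimitsOfShape (Discrete J) F where
  preservesColimit {Z} := by
    have : PreservesColimit (Discrete.functor (Z.obj ∘ Discrete.mk)) F :=
      preservesColimit_of_span (fun j => Z.obj ⟨j⟩) F (h _)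
    exact preservesColimit_of_iso_diagram F Discrete.natIsoFunctor.symm

end Coproducts

end ModuleCat

namespace Bim

attribute [local instance] baseModule base_isScalarTower

open Limits

section

variable (K : Type u) [CommRing K] (A B C : Type u) [Ring A] [Algebra K A] [Ring B] [Algebra K B]
  [Ring C] [Algebra K C]

instance : (tensorFunctor K A B C).Additive where
  map_add {_ _ _ _} := NatTrans.ext <| funext fun _ => hom_ext_mk fun _ _ => add_mk _ _ _

instance (M : ModuleCat.{u} (A ⊗[K] Bᵐᵒᵖ)) : ((tensorFunctor K A B C).obj M).Additive where
  map_add {_ _ _ _} := hom_ext_mk fun _ _ => mk_add _ _ _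

instance (N : ModuleCat.{u} (B ⊗[K] Cᵐᵒᵖ)) :
    ((tensorFunctor K A B C).flip.obj N).Additive where
  map_add {_ _ _ _} := hom_ext_mk fun _ _ => add_mk _ _ _

/-- Every element of a coproduct is a finite sum of elements of the summands, so the tensors with
one entry in a summand generate. Preservation of coproducts in both variables is what makes the
tensor product of complexes associative. -/
instance (M : ModuleCat.{u} (A ⊗[K] Bᵐᵒᵖ)) (J : Type) :
    PreservesColimitsOfShape (Discrete J) ((tensorFunctor K A B C).obj M) := by
  refine ModuleCat.preservesColimitsOfShape_discrete _ fun Y p hp x => ?_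
  induction x using tensor_induction with
  | zero => exact zero_mem p
  | add x y hx hy => exact add_mem hx hy
  | mk m n =>
    refine Submodule.iSup_induction _ (motive := fun n => mk m n ∈ p)
      (ModuleCat.coproduct_mem_iSup_range Y n) ?_ ?_ ?_
    · rintro j _ ⟨y, rfl⟩
      exact hp j (mk m y)
    · rw [mk_zero]; exact zero_mem p
    · intro y z hy hz; rw [mk_add]; exact add_mem hy hz

instance (N : ModuleCat.{u} (B ⊗[K] Cᵐᵒᵖ)) (J : Type) :
    PreservesColimitsOfShape (Discrete J) ((tensorFunctor K A B C).flip.obj N) := by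
  refine ModuleCat.preservesColimitsOfShape_discrete _ fun Y p hp x => ?_
  induction x using tensor_induction with
  | zero => exact zero_mem p
  | add x y hx hy => exact add_mem hx hy
  | mk m n =>
    refine Submodule.iSup_induction _ (motive := fun m => mk m n ∈ p)
      (ModuleCat.coproduct_mem_iSup_range Y m) ?_ ?_ ?_
    · rintro j _ ⟨y, rfl⟩
      exact hp j (mk y n)
    · rw [zero_mk]; exact zero_mem p
    · intro y z hy hz; rw [add_mk]; exact add_mem hy hz

end

section

variable (K : Type u) [CommRing K] (A : Type u) [Ring A] [Algebra K A]

attribute [local instance] monoidal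

open DPicard MonoidalCategory

instance : (curriedTensor (BimCat K A A)).Additive :=
  inferInstanceAs (tensorFunctor K A A A).Additive

instance (M : BimCat K A A) : ((curriedTensor (BimCat K A A)).obj M).Additive :=
  inferInstanceAs ((tensorFunctor K A A A).obj M).Additive

instance (M : BimCat K A A) (J : Type) :
    PreservesColimitsOfShape (Discrete J) ((curriedTensor (BimCat K A A)).obj M) :=
  inferInstanceAs (PreservesColimitsOfShape (Discrete J) ((tensorFunctor K A A A).obj M))

instance (M : BimCat K A A) (J : Type) :
    PreservesColimitsOfShape (Discrete J) ((curriedTensor (BimCat K A A)).flip.obj M) :=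
  inferInstanceAs (PreservesColimitsOfShape (Discrete J) ((tensorFunctor K A A A).flip.obj M))

/-- The monoidal category of complexes of bimodules. -/
@[reducible]
def complexMonoidal : MonoidalCategory (CochainComplex (BimCat K A A) ℤ) := by
  exact HomologicalComplex.monoidalCategory (BimCat K A A) (ComplexShape.up ℤ)

attribute [local instance] complexMonoidal

end

end Bim

/-! ### Quasi-isomorphisms of complexes of modules in terms of elements -/

section QuasiIso

variable {R : Type u} [Ring R]

/-- The two clauses are injectivity and surjectivity on ker / im, read on representatives. -/
lemma CategoryTheory.ShortComplex.moduleCat_quasiIso_iff {S T : ShortComplex (ModuleCat.{v} R)}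
    (φ : S ⟶ T) :
    ShortComplex.QuasiIso φ ↔
      (∀ x : S.X₂, S.g.hom x = 0 → (∃ y, T.f.hom y = φ.τ₂.hom x) → ∃ x', S.f.hom x' = x) ∧
      ∀ y : T.X₂, T.g.hom y = 0 → ∃ x y', S.g.hom x = 0 ∧ y = φ.τ₂.hom x + T.f.hom y' := by
  let h := S.moduleCatLeftHomologyData
  let h' := T.moduleCatLeftHomologyData
  let γ : ShortComplex.LeftHomologyMapData φ h h' := default
  have hK (x : LinearMap.ker S.g.hom) :
      h'.i.hom (γ.φK.hom x) = φ.τ₂.hom x :=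
    congrArg (fun f => f.hom x) γ.commi
  have hH (x : LinearMap.ker S.g.hom) :
      γ.φH.hom (Submodule.Quotient.mk (p := LinearMap.range S.moduleCatToCycles) x) =
        Submodule.Quotient.mk (p := LinearMap.range T.moduleCatToCycles)
          (γ.φK.hom x : LinearMap.ker T.g.hom) :=
    congrArg (fun f => f.hom x) γ.commπ
  rw [γ.quasiIso_iff, ConcreteCategory.isIso_iff_bijective]
  refine and_congr ?_ ?_
  · refine (injective_iff_map_eq_zero γ.φH.hom).trans ⟨fun H x hx ⟨y, hy⟩ => ?_, fun H x hx => ?_⟩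
    · have := H (Submodule.Quotient.mk (p := LinearMap.range S.moduleCatToCycles) ⟨x, hx⟩) (by
        rw [hH]
        refine (Submodule.Quotient.mk_eq_zero _).2 ⟨y, Subtype.ext ?_⟩
        exact hy.trans (hK ⟨x, hx⟩).symm)
      obtain ⟨x', hx'⟩ := (Submodule.Quotient.mk_eq_zero _).1 this
      exact ⟨x', congrArg Subtype.val hx'⟩
    · obtain ⟨x, rfl⟩ := Submodule.Quotient.mk_surjective _ x
      rw [hH] at hx
      obtain ⟨y, hy⟩ := (Submodule.Quotient.mk_eq_zero _).1 hx
      obtain ⟨x', hx'⟩ := H x.1 x.2 ⟨y, (congrArg Subtype.val hy).trans (hK x)⟩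
      exact (Submodule.Quotient.mk_eq_zero _).2 ⟨x', Subtype.ext hx'⟩
  · refine ⟨fun H y hy => ?_, fun H y => ?_⟩
    · obtain ⟨x, hx⟩ := H (Submodule.Quotient.mk (p := LinearMap.range T.moduleCatToCycles) ⟨y, hy⟩)
      obtain ⟨x, rfl⟩ := Submodule.Quotient.mk_surjective _ x
      obtain ⟨y', hy'⟩ := (Submodule.Quotient.eq _).1 (hx.symm.trans (hH x))
      refine ⟨x.1, y', x.2, ?_⟩
      have : T.f.hom y' = y - φ.τ₂.hom x := by
        rw [← hK x]; exact congrArg Subtype.val hy'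
      rw [this, add_sub_cancel]
    · obtain ⟨y, rfl⟩ := Submodule.Quotient.mk_surjective _ y
      obtain ⟨x, y', hx, e⟩ := H y.1 y.2
      refine ⟨Submodule.Quotient.mk (p := LinearMap.range S.moduleCatToCycles) ⟨x, hx⟩, ?_⟩
      refine (hH ⟨x, hx⟩).trans (Eq.symm ((Submodule.Quotient.eq _).2 ⟨y', Subtype.ext ?_⟩))
      change T.f.hom y' = y.1 - h'.i.hom (γ.φK.hom ⟨x, hx⟩)
      rw [hK ⟨x, hx⟩, e, add_sub_cancel_left]

/-- The mapping cone of `f` is exact, in terms of elements. -/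
def CochainComplex.ConeExact {X Y : CochainComplex (ModuleCat.{v} R) ℤ} (f : X ⟶ Y) : Prop :=
  ∀ (m n p q : ℤ), m + 1 = n → n + 1 = p → p + 1 = q → ∀ (x : X.X p) (y : Y.X n),
    (X.d p q).hom x = 0 → (f.f p).hom x = (Y.d n p).hom y →
      ∃ (x' : X.X n) (y' : Y.X m), x = (X.d n p).hom x' ∧ y = (f.f n).hom x' + (Y.d m n).hom y'

/-- Cone exactness combines injectivity on cohomology in degree p with surjectivity in degree n = p
- 1. This single condition on pairs is the one that later inductions correct step by step. -/
lemma CochainComplex.coneExact_iff_quasiIso {X Y : CochainComplex (ModuleCat.{v} R) ℤ}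
    (f : X ⟶ Y) : CochainComplex.ConeExact f ↔ QuasiIso f := by
  have key (i j k : ℤ) (hij : i + 1 = j) (hjk : j + 1 = k) : QuasiIsoAt f j ↔
      (∀ x : X.X j, (X.d j k).hom x = 0 → (∃ y, (Y.d i j).hom y = (f.f j).hom x) →
        ∃ x', (X.d i j).hom x' = x) ∧
      ∀ y : Y.X j, (Y.d j k).hom y = 0 →
        ∃ x y', (X.d j k).hom x = 0 ∧ y = (f.f j).hom x + (Y.d i j).hom y' := by
    rw [quasiIsoAt_iff' f i j k (by simp; lia) (by simp; lia)]
    exact ShortComplex.moduleCat_quasiIso_iff _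
  constructor
  · intro H
    refine ⟨fun j => (key (j - 1) j (j + 1) (by lia) rfl).2 ⟨fun x hx ⟨y, hy⟩ => ?_,
      fun y hy => ?_⟩⟩
    · obtain ⟨x', y', h, -⟩ := H (j - 1 - 1) (j - 1) j (j + 1) (by lia) (by lia) rfl x y hx hy.symm
      exact ⟨x', h.symm⟩
    -- A cocycle y of Y is the cone cocycle (0, y).
    · obtain ⟨x', y', h, h'⟩ := H (j - 1) j (j + 1) (j + 1 + 1) (by lia) rfl rfl 0 y
        (by simp) (by simp [hy])
      exact ⟨x', y', h.symm, h'⟩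
  · intro H m n p q hm hn hp x y hx hy
    obtain ⟨x', rfl⟩ := ((key n p q hn hp).1 inferInstance).1 x hx ⟨y, hy.symm⟩
    have comm : (f.f p).hom ((X.d n p).hom x') = (Y.d n p).hom ((f.f n).hom x') :=
      congrArg (fun g => g.hom x') (f.comm n p).symm
    -- Once x = d x', the difference y - f x' is a cocycle, and surjectivity on cohomology applies
    -- to it.
    obtain ⟨x'', y', h, h'⟩ := ((key m n p hm hn).1 inferInstance).2 (y - (f.f n).hom x') (by
      rw [map_sub, ← hy, comm, sub_self])
    refine ⟨x' + x'', y', by rw [map_add, h, add_zero], ?_⟩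
    rw [map_add, add_assoc, ← h', add_sub_cancel]

end QuasiIso

/-! ### Total complexes, column by column -/

namespace HomologicalComplex

open Limits ComplexShape

section

variable {C₁ C₂ : Type*} [Category* C₁] [Category* C₂] [HasZeroMorphisms C₁] [HasZeroMorphisms C₂]
  {S : Type u} [Ring S] (F : C₁ ⥤ C₂ ⥤ ModuleCat.{u} S) [F.PreservesZeroMorphisms]
  [∀ X, (F.obj X).PreservesZeroMorphisms]
  (P : CochainComplex C₁ ℤ) {X Y : CochainComplex C₂ ℤ}

/-- The projection of the total complex to a summand. -/
def mapBifunctorProj (X : CochainComplex C₂ ℤ) (i j n : ℤ) (h : i + j = n) :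
    (mapBifunctor P X F (up ℤ)).X n ⟶ (F.obj (P.X i)).obj (X.X j) := by
  classical
  exact Sigma.π (fun q : (π (up ℤ) (up ℤ) (up ℤ)) ⁻¹' {n} =>
    (F.obj (P.X q.1.1)).obj (X.X q.1.2)) ⟨(i, j), h⟩

lemma ι_mapBifunctorProj (X : CochainComplex C₂ ℤ) (i j n : ℤ) (h : i + j = n) :
    ιMapBifunctor P X F (up ℤ) i j n h ≫ mapBifunctorProj F P X i j n h = 𝟙 _ := by
  classical
  exact Sigma.ι_π_eq_id (fun q : (π (up ℤ) (up ℤ) (up ℤ)) ⁻¹' {n} =>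
    (F.obj (P.X q.1.1)).obj (X.X q.1.2)) ⟨(i, j), h⟩

lemma ι_mapBifunctorProj_of_ne (X : CochainComplex C₂ ℤ) (i j i' j' n : ℤ) (h : i + j = n)
    (h' : i' + j' = n) (hi : i ≠ i') :
    ιMapBifunctor P X F (up ℤ) i j n h ≫ mapBifunctorProj F P X i' j' n h' = 0 := by
  classical
  exact Sigma.ι_π_of_ne (fun q : (π (up ℤ) (up ℤ) (up ℤ)) ⁻¹' {n} =>
    (F.obj (P.X q.1.1)).obj (X.X q.1.2)) (fun e => hi (congrArg (fun q => q.1.1) e))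

lemma mapBifunctor_eq_zero {X : CochainComplex C₂ ℤ} {n : ℤ}
    (z : (mapBifunctor P X F (up ℤ)).X n)
    (h : ∀ i j (hij : i + j = n), (mapBifunctorProj F P X i j n hij).hom z = 0) : z = 0 := by
  classical
  exact ModuleCat.coproduct_eq_zero (fun q : (π (up ℤ) (up ℤ) (up ℤ)) ⁻¹' {n} =>
    (F.obj (P.X q.1.1)).obj (X.X q.1.2)) z fun q => h q.1.1 q.1.2 q.2

/-- Elements of a coproduct have finite support. Together with an upper bound on P this leaves
finitely many columns to treat. -/
lemma mapBifunctor_exists_lowerBound {X : CochainComplex C₂ ℤ} {n : ℤ}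
    (z : (mapBifunctor P X F (up ℤ)).X n) :
    ∃ a : ℤ, ∀ i j (hij : i + j = n), i < a → (mapBifunctorProj F P X i j n hij).hom z = 0 := by
  classical
  have hf := ModuleCat.coproduct_finite_support (fun q : (π (up ℤ) (up ℤ) (up ℤ)) ⁻¹' {n} =>
    (F.obj (P.X q.1.1)).obj (X.X q.1.2)) z
  obtain ⟨a, ha⟩ := (hf.image fun q => q.1.1).bddBelow
  refine ⟨a, fun i j hij hi => ?_⟩
  by_contra h
  exact absurd (ha ⟨⟨(i, j), hij⟩, h, rfl⟩) (not_le.2 hi)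

/-- Only two summands map to position (i, j') under the total differential: its neighbour in the
previous column, and the one below it in the same column, with sign (-1)^i. -/
lemma d_mapBifunctorProj (X : CochainComplex C₂ ℤ) {i' i j j' n n' : ℤ} (hi : i' + 1 = i)
    (hj : j + 1 = j') (hn : n + 1 = n') (h : i + j' = n') :
    (mapBifunctor P X F (up ℤ)).d n n' ≫ mapBifunctorProj F P X i j' n' h =
      mapBifunctorProj F P X i' j' n (by lia) ≫ (F.map (P.d i' i)).app (X.X j') +
        i.negOnePow • (mapBifunctorProj F P X i j n (by lia) ≫ (F.obj (P.X i)).map (X.d j j')) := by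
  refine mapBifunctor.hom_ext fun i₁ i₂ h' => ?_
  have h'' : i₁ + i₂ = n := h'
  rw [mapBifunctor.d_eq, Preadditive.add_comp, Preadditive.comp_add, Preadditive.comp_add,
    mapBifunctor.ι_D₁_assoc, mapBifunctor.ι_D₂_assoc,
    mapBifunctor.d₁_eq _ _ _ _ (show (up ℤ).Rel i₁ (i₁ + 1) from rfl) _ _ (by
      change i₁ + 1 + i₂ = n'; lia),
    mapBifunctor.d₂_eq _ _ _ _ _ (show (up ℤ).Rel i₂ (i₂ + 1) from rfl) _ (by
      change i₁ + (i₂ + 1) = n'; lia)]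
  simp only [Linear.units_smul_comp, Linear.comp_units_smul, Category.assoc]
  congr 1
  · by_cases hi₁ : i₁ = i'
    · obtain rfl : i₂ = j' := by lia
      subst hi₁ hi
      rw [ι_mapBifunctorProj, Category.comp_id, ← Category.assoc, ι_mapBifunctorProj,
        Category.id_comp]
      exact one_smul _ _
    · rw [ι_mapBifunctorProj_of_ne _ _ _ _ _ _ _ _ _ _ (by lia), ← Category.assoc (ιMapBifunctor _ _ _ _ _ _ _ _),
        ι_mapBifunctorProj_of_ne _ _ _ _ _ _ _ _ _ _ hi₁, comp_zero, zero_comp, smul_zero]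
  · by_cases hi₁ : i₁ = i
    · obtain rfl : i₂ = j := by lia
      subst hi₁ hj
      rw [ι_mapBifunctorProj, Category.comp_id, ← Category.assoc, ι_mapBifunctorProj,
        Category.id_comp]
      rfl
    · rw [ι_mapBifunctorProj_of_ne _ _ _ _ _ _ _ _ _ _ hi₁, ← Category.assoc (ιMapBifunctor _ _ _ _ _ _ _ _),
        ι_mapBifunctorProj_of_ne _ _ _ _ _ _ _ _ _ _ hi₁, comp_zero, zero_comp, smul_zero,
        smul_zero]

lemma mapBifunctorMap_proj (f : X ⟶ Y) (i j n : ℤ) (h : i + j = n) :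
    (mapBifunctorMap (𝟙 P) f F (up ℤ)).f n ≫ mapBifunctorProj F P Y i j n h =
      mapBifunctorProj F P X i j n h ≫ (F.obj (P.X i)).map (f.f j) := by
  refine mapBifunctor.hom_ext fun i₁ i₂ h' => ?_
  have h'' : i₁ + i₂ = n := h'
  rw [ι_mapBifunctorMap_assoc, HomologicalComplex.id_f, F.map_id, NatTrans.id_app,
    Category.id_comp]
  by_cases hi₁ : i₁ = i
  · obtain rfl : i₂ = j := by lia
    subst hi₁
    rw [ι_mapBifunctorProj, Category.comp_id, ← Category.assoc, ι_mapBifunctorProj,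
      Category.id_comp]
  · rw [ι_mapBifunctorProj_of_ne _ _ _ _ _ _ _ _ _ _ hi₁, ← Category.assoc (ιMapBifunctor _ _ _ _ _ _ _ _),
      ι_mapBifunctorProj_of_ne _ _ _ _ _ _ _ _ _ _ hi₁, comp_zero, zero_comp]

end

end HomologicalComplex

namespace HomologicalComplex

open Limits ComplexShape

section

variable {C₁ C₂ : Type*} [Category* C₁] [Category* C₂] [HasZeroMorphisms C₁] [HasZeroMorphisms C₂]
  {S : Type u} [Ring S] (F : C₁ ⥤ C₂ ⥤ ModuleCat.{u} S) [F.PreservesZeroMorphisms]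
  [∀ X, (F.obj X).PreservesZeroMorphisms]
  (P : CochainComplex C₁ ℤ) {X Y : CochainComplex C₂ ℤ}

/-- The differential never decreases the column index. For an element supported in columns ≥ i, its
component in column i is therefore the differential of that column up to sign. -/
lemma mapBifunctorProj_d_of_lower {X : CochainComplex C₂ ℤ} {i j j' n n' : ℤ}
    (hj : j + 1 = j') (hn : n + 1 = n') (h : i + j' = n') (z : (mapBifunctor P X F (up ℤ)).X n)
    (hz : ∀ i' j' (h : i' + j' = n), i' < i → (mapBifunctorProj F P X i' j' n h).hom z = 0) :
    (mapBifunctorProj F P X i j' n' h).hom (((mapBifunctor P X F (up ℤ)).d n n').hom z) =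
      i.negOnePow • ((F.obj (P.X i)).map (X.d j j')).hom
        ((mapBifunctorProj F P X i j n (by lia)).hom z) := by
  have := congrArg (fun f => f.hom z) (d_mapBifunctorProj F P X (i' := i - 1) (by lia) hj hn h)
  refine this.trans ?_
  change ((F.map (P.d (i - 1) i)).app (X.X j')).hom
    ((mapBifunctorProj F P X (i - 1) j' n (by lia)).hom z) + _ = _
  rw [hz _ _ _ (by lia), map_zero, zero_add]
  rfl

lemma proj_map (f : X ⟶ Y) (i j l : ℤ) (h : i + j = l) (z : (mapBifunctor P X F (up ℤ)).X l) :
    (mapBifunctorProj F P Y i j l h).hom (((mapBifunctorMap (𝟙 P) f F (up ℤ)).f l).hom z) =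
      ((F.obj (P.X i)).map (f.f j)).hom ((mapBifunctorProj F P X i j l h).hom z) :=
  congrArg (fun g => g.hom z) (mapBifunctorMap_proj F P f i j l h)

/-- The inclusion of a summand, on elements. -/
def mapBifunctorIncl (X : CochainComplex C₂ ℤ) (i j l : ℤ) (h : i + j = l)
    (z : (F.obj (P.X i)).obj (X.X j)) : (mapBifunctor P X F (up ℤ)).X l :=
  (ιMapBifunctor P X F (up ℤ) i j l h).hom z

lemma proj_incl (X : CochainComplex C₂ ℤ) (i j l : ℤ) (h : i + j = l)
    (z : (F.obj (P.X i)).obj (X.X j)) :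
    (mapBifunctorProj F P X i j l h).hom (mapBifunctorIncl F P X i j l h z) = z :=
  congrArg (fun g => g.hom z) (ι_mapBifunctorProj F P X i j l h)

lemma proj_incl_of_ne (X : CochainComplex C₂ ℤ) (i j i' j' l : ℤ) (h : i + j = l)
    (h' : i' + j' = l) (hi : i ≠ i') (z : (F.obj (P.X i)).obj (X.X j)) :
    (mapBifunctorProj F P X i' j' l h').hom (mapBifunctorIncl F P X i j l h z) = 0 :=
  congrArg (fun g => g.hom z) (ι_mapBifunctorProj_of_ne F P X i j i' j' l h h' hi)

lemma proj_d_incl (X : CochainComplex C₂ ℤ) {i j j' n n' : ℤ} (hj : j + 1 = j') (hn : n + 1 = n')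
    (h : i + j = n) (z : (F.obj (P.X i)).obj (X.X j)) :
    (mapBifunctorProj F P X i j' n' (by lia)).hom (((mapBifunctor P X F (up ℤ)).d n n').hom
      (mapBifunctorIncl F P X i j n h z)) =
        i.negOnePow • ((F.obj (P.X i)).map (X.d j j')).hom z := by
  rw [mapBifunctorProj_d_of_lower F P hj hn (by lia) _
    (fun i' j' h' hi' => proj_incl_of_ne F P X _ _ _ _ _ _ _ (by lia) _), proj_incl]

lemma proj_d_incl_of_lt (X : CochainComplex C₂ ℤ) {i j i' j' n n' : ℤ} (hn : n + 1 = n')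
    (h : i + j = n) (h' : i' + j' = n') (hi : i' < i) (z : (F.obj (P.X i)).obj (X.X j)) :
    (mapBifunctorProj F P X i' j' n' h').hom (((mapBifunctor P X F (up ℤ)).d n n').hom
      (mapBifunctorIncl F P X i j n h z)) = 0 := by
  rw [mapBifunctorProj_d_of_lower F P (show j' - 1 + 1 = j' by lia) hn h' _
    (fun i' j' h' hi' => proj_incl_of_ne F P X _ _ _ _ _ _ _ (by lia) _),
    proj_incl_of_ne F P X _ _ _ _ _ _ _ (by lia), map_zero, smul_zero]

/-- The step of the induction on the first index in `coneExact_mapBifunctorMap`. -/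
lemma mapBifunctor_cone_step (f : X ⟶ Y) {a m n p q : ℤ} (hm : m + 1 = n) (hn : n + 1 = p)
    (hp : p + 1 = q)
    (H : CochainComplex.ConeExact (((F.obj (P.X a)).mapHomologicalComplex (up ℤ)).map f))
    (x : (mapBifunctor P X F (up ℤ)).X p) (y : (mapBifunctor P Y F (up ℤ)).X n)
    (hx : ((mapBifunctor P X F (up ℤ)).d p q).hom x = 0)
    (hxy : ((mapBifunctorMap (𝟙 P) f F (up ℤ)).f p).hom x =
      ((mapBifunctor P Y F (up ℤ)).d n p).hom y)
    (hx' : ∀ i j (h : i + j = p), i < a → (mapBifunctorProj F P X i j p h).hom x = 0)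
    (hy' : ∀ i j (h : i + j = n), i < a → (mapBifunctorProj F P Y i j n h).hom y = 0) :
    ∃ (x' : (mapBifunctor P X F (up ℤ)).X n) (y' : (mapBifunctor P Y F (up ℤ)).X m),
      (∀ i j (h : i + j = p), i < a + 1 → (mapBifunctorProj F P X i j p h).hom
        (x - ((mapBifunctor P X F (up ℤ)).d n p).hom x') = 0) ∧
      (∀ i j (h : i + j = n), i < a + 1 → (mapBifunctorProj F P Y i j n h).hom
        (y - ((mapBifunctorMap (𝟙 P) f F (up ℤ)).f n).hom x' -
          ((mapBifunctor P Y F (up ℤ)).d m n).hom y') = 0) := by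
  obtain ⟨m', hm'⟩ : ∃ m', a + m' = m := ⟨m - a, by lia⟩
  obtain ⟨n', hn'⟩ : ∃ n', a + n' = n := ⟨n - a, by lia⟩
  obtain ⟨p', hp'⟩ : ∃ p', a + p' = p := ⟨p - a, by lia⟩
  obtain ⟨q', hq'⟩ : ∃ q', a + q' = q := ⟨q - a, by lia⟩
  have H' (x : (F.obj (P.X a)).obj (X.X p')) (y : (F.obj (P.X a)).obj (Y.X n'))
      (hx : ((F.obj (P.X a)).map (X.d p' q')).hom x = 0)
      (hxy : ((F.obj (P.X a)).map (f.f p')).hom x = ((F.obj (P.X a)).map (Y.d n' p')).hom y) :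
      ∃ (x' : (F.obj (P.X a)).obj (X.X n')) (y' : (F.obj (P.X a)).obj (Y.X m')),
        x = ((F.obj (P.X a)).map (X.d n' p')).hom x' ∧
        y = ((F.obj (P.X a)).map (f.f n')).hom x' + ((F.obj (P.X a)).map (Y.d m' n')).hom y' :=
    H m' n' p' q' (by lia) (by lia) (by lia) x y hx hxy
  clear H
  have h₁ := mapBifunctorProj_d_of_lower F P (i := a) (j := p') (j' := q')
    (by lia) hp (by lia) x hx'
  have h₂ := mapBifunctorProj_d_of_lower F P (i := a) (j := n') (j' := p')
    (by lia) hn (by lia) y hy'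
  rw [hx, map_zero] at h₁
  rw [← hxy, proj_map] at h₂
  generalize hε : a.negOnePow = ε at h₁ h₂
  have hεε {M : Type u} [AddCommGroup M] (z : M) : ε • ε • z = z := by
    rw [smul_smul, Int.units_mul_self, one_smul]
  have hmap {M N : ModuleCat.{u} S} (g : M ⟶ N) (z : M) : g.hom (ε • z) = ε • g.hom z := by
    rw [Units.smul_def, Units.smul_def, map_zsmul]
  -- The total differential restricted to column a is ε = (-1)^a times the column differential. The
  -- cocycle of the column's cone is thus the component of x paired with ε times that of y; the same
  -- sign reappears in the witness ε • x', and the two cancel as ε² = 1.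
  obtain ⟨x', y', e₁, e₂⟩ := H' ((mapBifunctorProj F P X a p' p (by lia)).hom x)
    (ε • (mapBifunctorProj F P Y a n' n (by lia)).hom y)
    (by rw [← hεε (((F.obj (P.X a)).map (X.d p' q')).hom _), ← h₁, smul_zero])
    (by rw [hmap]; exact h₂)
  refine ⟨mapBifunctorIncl F P X a n' n (by lia) (ε • x'),
    mapBifunctorIncl F P Y a m' m (by lia) y',
    fun i j h hi => ?_, fun i j h hi => ?_⟩
  · rw [map_sub]
    obtain hi | rfl := lt_or_eq_of_le (Int.lt_add_one_iff.1 hi)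
    · rw [hx' _ _ _ hi, proj_d_incl_of_lt F P X hn _ _ hi, sub_zero]
    · obtain rfl : j = p' := by lia
      rw [proj_d_incl F P X (by lia) hn, hε, hmap, hεε, e₁, sub_self]
  · rw [map_sub, map_sub, proj_map]
    obtain hi | rfl := lt_or_eq_of_le (Int.lt_add_one_iff.1 hi)
    · rw [hy' _ _ _ hi, proj_d_incl_of_lt F P Y hm _ _ hi,
        proj_incl_of_ne F P X _ _ _ _ _ _ _ (by lia), map_zero, sub_zero, sub_zero]
    · obtain rfl : j = n' := by lia
      rw [proj_d_incl F P Y (by lia) hm, hε, proj_incl, hmap, sub_sub, ← smul_add, ← e₂, hεε,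
        sub_self]

/-- A cone cocycle (x, y) is supported in finitely many columns. Exactness of the lowest column
allows it to be changed by a coboundary so as to vanish there; after finitely many steps its support
lies beyond N, where P is zero. -/
lemma coneExact_mapBifunctorMap (f : X ⟶ Y) (N : ℤ)
    (hP : ∀ i, N < i → IsZero (P.X i))
    (H : ∀ i, CochainComplex.ConeExact (((F.obj (P.X i)).mapHomologicalComplex (up ℤ)).map f)) :
    CochainComplex.ConeExact (mapBifunctorMap (𝟙 P) f F (up ℤ)) := by
  intro m n p q hm hn hp x y hx hxy
  -- Here k counts the columns left: those from N + 1 - k to N.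
  suffices ∀ (k : ℕ) (x : (mapBifunctor P X F (up ℤ)).X p) (y : (mapBifunctor P Y F (up ℤ)).X n)
      (_ : ((mapBifunctor P X F (up ℤ)).d p q).hom x = 0)
      (_ : ((mapBifunctorMap (𝟙 P) f F (up ℤ)).f p).hom x =
        ((mapBifunctor P Y F (up ℤ)).d n p).hom y)
      (_ : ∀ i j (h : i + j = p), i < N + 1 - k → (mapBifunctorProj F P X i j p h).hom x = 0)
      (_ : ∀ i j (h : i + j = n), i < N + 1 - k → (mapBifunctorProj F P Y i j n h).hom y = 0),
      ∃ (x' : (mapBifunctor P X F (up ℤ)).X n) (y' : (mapBifunctor P Y F (up ℤ)).X m),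
        x = ((mapBifunctor P X F (up ℤ)).d n p).hom x' ∧
        y = ((mapBifunctorMap (𝟙 P) f F (up ℤ)).f n).hom x' +
          ((mapBifunctor P Y F (up ℤ)).d m n).hom y' by
    obtain ⟨a, ha⟩ := mapBifunctor_exists_lowerBound F P x
    obtain ⟨b, hb⟩ := mapBifunctor_exists_lowerBound F P y
    -- The sum is at least N + 1 - a and N + 1 - b, so both lower bounds on the support are covered.
    exact this ((N + 1 - a).toNat + (N + 1 - b).toNat) x y hx hxy
      (fun i j h hi => ha i j h (by lia)) (fun i j h hi => hb i j h (by lia))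
  clear hx hxy x y
  intro k
  have hzero (Z : CochainComplex C₂ ℤ) (i j : ℤ) (hi : N < i) (z : (F.obj (P.X i)).obj (Z.X j)) :
      z = 0 := by
    have h : IsZero ((F.obj (P.X i)).obj (Z.X j)) :=
      Functor.map_isZero ((evaluation _ _).obj (Z.X j)) (Functor.map_isZero F (hP i hi))
    have := ModuleCat.subsingleton_of_isZero h
    exact Subsingleton.elim z 0
  induction k with
  | zero =>
    intro x y _ _ hx hy
    refine ⟨0, 0, ?_, ?_⟩
    · rw [map_zero]
      refine mapBifunctor_eq_zero F P x fun i j h => ?_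
      by_cases hi : i < N + 1
      · exact hx i j h (by simpa using hi)
      · exact hzero _ _ _ (by lia) _
    · rw [map_zero, map_zero, add_zero]
      refine mapBifunctor_eq_zero F P y fun i j h => ?_
      by_cases hi : i < N + 1
      · exact hy i j h (by simpa using hi)
      · exact hzero _ _ _ (by lia) _
  | succ k ih =>
    intro x y hx hxy hx' hy'
    obtain ⟨x₁, y₁, h₁, h₂⟩ := mapBifunctor_cone_step F P f hm hn hp (H _) x y hx hxy hx' hy'
    have hdd (Z : CochainComplex C₂ ℤ) (i j k : ℤ) (z : (mapBifunctor P Z F (up ℤ)).X i) :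
        ((mapBifunctor P Z F (up ℤ)).d j k).hom (((mapBifunctor P Z F (up ℤ)).d i j).hom z) = 0 :=
      congrArg (fun g => g.hom z) ((mapBifunctor P Z F (up ℤ)).d_comp_d i j k)
    have hcomm (z : (mapBifunctor P X F (up ℤ)).X n) :
        ((mapBifunctorMap (𝟙 P) f F (up ℤ)).f p).hom
          (((mapBifunctor P X F (up ℤ)).d n p).hom z) = ((mapBifunctor P Y F (up ℤ)).d n p).hom
          (((mapBifunctorMap (𝟙 P) f F (up ℤ)).f n).hom z) :=
      congrArg (fun g => g.hom z) ((mapBifunctorMap (𝟙 P) f F (up ℤ)).comm n p).symm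
    -- The corrected pair is still a cone cocycle, since d² = 0 and f commutes with d, and it has
    -- one column fewer.
    obtain ⟨x₂, y₂, e₁, e₂⟩ := ih _ _ (by rw [map_sub, hx, hdd, sub_zero])
      (by rw [map_sub, map_sub, map_sub, hdd, sub_zero, hxy, hcomm])
      (fun i j h hi => h₁ i j h (by push_cast; lia)) (fun i j h hi => h₂ i j h (by push_cast; lia))
    refine ⟨x₁ + x₂, y₁ + y₂, ?_, ?_⟩
    · rw [map_add, ← e₁, add_sub_cancel]
    · rw [map_add, map_add, add_add_add_comm, ← e₂]
      abel

/-- If `P` is bounded above and all functors `F(Pⁱ, -)` preserve the quasi-isomorphism `f`, then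
so does the total complex of `F(P, -)`. -/
lemma quasiIso_mapBifunctorMap_right (f : X ⟶ Y) (N : ℤ) (hP : ∀ i, N < i → IsZero (P.X i))
    (H : ∀ i, QuasiIso (((F.obj (P.X i)).mapHomologicalComplex (up ℤ)).map f)) :
    QuasiIso (mapBifunctorMap (𝟙 P) f F (up ℤ)) := by
  rw [← CochainComplex.coneExact_iff_quasiIso]
  exact coneExact_mapBifunctorMap F P f N hP
    fun i => (CochainComplex.coneExact_iff_quasiIso _).2 (H i)

end

section

variable {C₁ C₂ : Type*} [Category* C₁] [Category* C₂] [HasZeroMorphisms C₁] [HasZeroMorphisms C₂]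
  {S : Type u} [Ring S] (F : C₁ ⥤ C₂ ⥤ ModuleCat.{u} S) [F.PreservesZeroMorphisms]
  [∀ X, (F.obj X).PreservesZeroMorphisms] [∀ X, (F.flip.obj X).PreservesZeroMorphisms]
  {X Y : CochainComplex C₁ ℤ} (P : CochainComplex C₂ ℤ)

/-- Reduces to the other variable by the symmetry of total complexes under exchange of the two
factors. -/
lemma quasiIso_mapBifunctorMap_left (f : X ⟶ Y) (N : ℤ) (hP : ∀ i, N < i → IsZero (P.X i))
    (H : ∀ i, QuasiIso (((F.flip.obj (P.X i)).mapHomologicalComplex (up ℤ)).map f)) :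
    QuasiIso (mapBifunctorMap f (𝟙 P) F (up ℤ)) := by
  have h := quasiIso_mapBifunctorMap_right F.flip P f N hP H
  have e := mapBifunctorFlipIso_hom_naturality f (𝟙 P) F (up ℤ)
  rw [← Iso.inv_comp_eq] at e
  rw [← e]
  infer_instance

end

end HomologicalComplex

/-! ### Projective bimodules: flatness over K and exactness of the tensor product -/

namespace ModuleCat

lemma preservesHomology_of_exact {R S : Type u} [Ring R] [Ring S]
    (F : ModuleCat.{u} R ⥤ ModuleCat.{u} S) [F.Additive]
    (h : ∀ {X Y Z : ModuleCat.{u} R} (f : X ⟶ Y) (g : Y ⟶ Z), Function.Exact f.hom g.hom →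
      ∀ y, (F.map g).hom y = 0 → ∃ x, (F.map f).hom x = y) : F.PreservesHomology :=
  Functor.preservesHomology_of_map_exact F fun S hS => by
    rw [ShortComplex.moduleCat_exact_iff]
    exact h S.f S.g ((ShortComplex.ShortExact.moduleCat_exact_iff_function_exact S).1 hS)

end ModuleCat

namespace Bim

attribute [local instance] baseModule base_isScalarTower

/-- A projective R-module is a retract of a free one, which over K is a direct sum of copies of the
flat module R. -/
lemma flat_of_projective {K : Type u} [CommRing K] {R : Type u} [Ring R] [Algebra K R]
    [Module.Flat K R] (P : ModuleCat.{u} R) [Projective P] : Module.Flat K P := by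
  have : Module.Projective R P := (IsProjective.iff_projective P).2 inferInstance
  obtain ⟨s, hs⟩ := Module.projective_def'.1 this
  have : Module.Flat K (P →₀ R) := by
    classical exact Module.Flat.of_linearEquiv (finsuppLEquivDirectSum K R P)
  exact Module.Flat.of_retract (s.restrictScalars K)
    ((Finsupp.linearCombination R (id : P → P)).restrictScalars K)
    (LinearMap.ext fun x => LinearMap.congr_fun hs x)

section

variable {K : Type u} [CommRing K] {R : Type u} [Ring R] [Algebra K R]

lemma flat_of_iso {M N : ModuleCat.{u} R} (e : M ≅ N) [Module.Flat K M] : Module.Flat K N :=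
  Module.Flat.of_linearEquiv (e.symm.toLinearEquiv.restrictScalars K)

open Limits in
lemma flat_coproduct {J : Type} (Y : J → ModuleCat.{u} R) [∀ j, Module.Flat K (Y j)] :
    Module.Flat K (∐ Y : ModuleCat.{u} R) := by
  classical
  let e : (∐ Y : ModuleCat.{u} R) ≃ₗ[R] DirectSum J fun j => Y j :=
    (ModuleCat.coprodIsoDirectSum Y).toLinearEquiv
  have : IsScalarTower K R (DirectSum J fun j => Y j) := ⟨fun k r x => by
    ext j; exact smul_assoc k r (x j)⟩
  exact Module.Flat.of_linearEquiv (e.restrictScalars K)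

end

section

variable {K : Type u} [CommRing K] {A B C : Type u} [Ring A] [Algebra K A] [Ring B] [Algebra K B]
  [Ring C] [Algebra K C]

/-- The bimodule `M ⊗_K N`. -/
def preObj (M : ModuleCat.{u} (A ⊗[K] Bᵐᵒᵖ)) (N : ModuleCat.{u} (B ⊗[K] Cᵐᵒᵖ)) :
    ModuleCat.{u} (A ⊗[K] Cᵐᵒᵖ) :=
  ModuleCat.of _ (PreTensor K A B C M N)

variable {M M' : ModuleCat.{u} (A ⊗[K] Bᵐᵒᵖ)} {N N' : ModuleCat.{u} (B ⊗[K] Cᵐᵒᵖ)}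

/-- A pure tensor of `M ⊗_K N`. -/
def pre (m : M) (n : N) : preObj M N := PreTensor.tmul K A B C m n

lemma lact_pre (a : A) (m : M) (n : N) : lact a (pre m n) = pre (lact a m) n :=
  (preTensor_smul_tmul K A B C M N a 1 m n).trans
    (congrArg (pre (lact a m)) (one_smul (B ⊗[K] Cᵐᵒᵖ) n))

lemma ract_pre (c : C) (m : M) (n : N) : ract c (pre m n) = pre m (ract c n) :=
  (preTensor_smul_tmul K A B C M N 1 c m n).trans
    (congrArg (pre · (ract c n)) (one_smul (A ⊗[K] Bᵐᵒᵖ) m))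

lemma pre_induction {p : preObj M N → Prop} (zero : p 0)
    (pre : ∀ (m : M) (n : N), p (pre m n))
    (add : ∀ x y, p x → p y → p (x + y)) (x : preObj M N) : p x :=
  PreTensor.induction K A B C zero pre add x

variable (M N) in
/-- The quotient map `M ⊗_K N → M ⊗_B N`. -/
def quot : preObj M N ⟶ tensorObj K A B C M N := ModuleCat.ofHom (Submodule.mkQ _)

lemma quot_pre (m : M) (n : N) : (quot M N).hom (pre m n) = mk m n := rfl

instance : Epi (quot M N) :=
  (ModuleCat.epi_iff_surjective _).2 (Submodule.mkQ_surjective _)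

variable (M N) in
/-- The quotient map `M ⊗_K N → M ⊗_B N`, as a `K`-linear map. -/
def quotLinear : M ⊗[K] N →ₗ[K] tensorObj K A B C M N where
  toFun x := (quot M N).hom x
  map_add' := map_add (quot M N).hom
  map_smul' k x := by
    induction x using TensorProduct.induction_on with
    | zero =>
      rw [smul_zero]
      exact (map_zero (quot M N).hom).trans (smul_zero _).symm
    | add x y hx hy =>
      rw [smul_add]
      refine (map_add (quot M N).hom (k • x) (k • y)).trans ((congrArg₂ _ hx hy).trans ?_)
      exact ((congrArg _ (map_add (quot M N).hom x y)).trans (smul_add k _ _)).symm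
    | tmul m n =>
      change mk (k • m) n = k • mk m n
      rw [base_smul_eq_lact, base_smul_eq_lact, lact_mk]

lemma quotLinear_tmul (m : M) (n : N) : quotLinear M N (m ⊗ₜ n) = mk m n := rfl

lemma quotLinear_natural (f : M ⟶ M') (g : N ⟶ N') (x : M ⊗[K] N) :
    quotLinear M' N' (TensorProduct.map (baseMap K f) (baseMap K g) x) =
      (tensorMap K A B C f g).hom (quotLinear M N x) := by
  induction x using TensorProduct.induction_on with
  | zero => simp
  | add x y hx hy => simp only [map_add, hx, hy]
  | tmul m n => rfl

open DPicard

/-! ### The case of a projective left factor -/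

section Left

/-- `p ⊗ b ↦ p ⊗ b n`. -/
def actOn (M : ModuleCat.{u} (A ⊗[K] Bᵐᵒᵖ)) (n : N) :
    preObj M (diagonalBimodule K B) →+ M ⊗[K] N :=
  TensorProduct.liftAddHom (R := K)
    (AddMonoidHom.mk' (fun m => (AddMonoidHom.mk' (fun x : N => (m ⊗ₜ[K] x : M ⊗[K] N))
      (TensorProduct.tmul_add m)).comp ((lactHom N).flip n)) fun m m' => by
        ext b; exact TensorProduct.add_tmul m m' _)
    fun k m b => by
      induction b using diag_cases with
      | h b =>
        change (k • m) ⊗ₜ[K] (lact b n) = m ⊗ₜ[K] (lactHom N (lact (algebraMap K B k) (toDiag b)) n)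
        rw [lact_toDiag, lactHom_toDiag, lact_mul, ← base_smul_eq_lact, TensorProduct.smul_tmul]

@[simp]
lemma actOn_pre (m : M) (b : B) (n : N) : actOn M n (pre m (toDiag b)) = m ⊗ₜ[K] (lact b n) := rfl

lemma actOn_add (n n' : N) (x : preObj M (diagonalBimodule K B)) :
    actOn M (n + n') x = actOn M n x + actOn M n' x := by
  induction x using pre_induction with
  | zero => simp
  | add x y hx hy => simp only [map_add, hx, hy]; abel
  | pre m b =>
    induction b using diag_cases with
    | h b => rw [actOn_pre, actOn_pre, actOn_pre, map_add, TensorProduct.tmul_add]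

/-- Ensures that (m, n) ↦ s(m) n is B-balanced and so descends to M ⊗_B N. -/
lemma actOn_ract (n : N) (b : B) (x : preObj M (diagonalBimodule K B)) :
    actOn M n (ract b x) = actOn M (lact b n) x := by
  induction x using pre_induction with
  | zero => simp
  | add x y hx hy => simp only [map_add, hx, hy]
  | pre m b' =>
    induction b' using diag_cases with
    | h b' => rw [ract_pre, ract_toDiag, actOn_pre, actOn_pre, lact_mul]

lemma actOn_base (n : N) (k : K) (x : preObj M (diagonalBimodule K B)) :
    actOn M n (k • x) = k • actOn M n x := by
  rw [base_smul_eq_lact]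
  induction x using pre_induction with
  | zero => simp
  | add x y hx hy => simp only [map_add, hx, hy, smul_add]
  | pre m b =>
    induction b using diag_cases with
    | h b =>
      rw [lact_pre, actOn_pre, actOn_pre, ← base_smul_eq_lact]
      rfl

/-- Turns a splitting s of the multiplication M ⊗_K B → M into a splitting of M ⊗_K N → M ⊗_B N. -/
lemma quotLinear_actOn (n : N) (x : preObj M (diagonalBimodule K B)) :
    quotLinear M N (actOn M n x) =
      mk ((rightUnitIso M).hom.hom ((quot M (diagonalBimodule K B)).hom x)) n := by
  induction x using pre_induction with
  | zero => simp
  | add x y hx hy => simp only [map_add, hx, hy, add_mk]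
  | pre m b =>
    induction b using diag_cases with
    | h b => rw [actOn_pre, quotLinear_tmul, quot_pre, rightUnitIso_hom_mk, ract_mk_eq]

lemma map_actOn (g : N ⟶ N') (n : N) (x : preObj M (diagonalBimodule K B)) :
    (baseMap K g).lTensor M (actOn M n x) = actOn M (g.hom n) x := by
  induction x using pre_induction with
  | zero => simp
  | add x y hx hy => simp only [map_add, hx, hy]
  | pre m b =>
    induction b using diag_cases with
    | h b => exact congrArg (fun y : N' => (m ⊗ₜ[K] y : M ⊗[K] N')) (hom_lact g b n)

variable (s : M ⟶ preObj M (diagonalBimodule K B))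

/-- `m ↦ n ↦ s(m) n`. -/
def sectionLeftPre (N : ModuleCat.{u} (B ⊗[K] Cᵐᵒᵖ)) : M →+ N →+ M ⊗[K] N :=
  AddMonoidHom.mk' (fun m => AddMonoidHom.mk' (fun n => actOn M n (s.hom m))
    fun n n' => actOn_add n n' _) fun m m' => by
      ext n
      exact (congrArg (actOn M n) (map_add s.hom m m')).trans (map_add (actOn M n) _ _)

lemma sectionLeftPre_apply (m : M) (n : N) : sectionLeftPre s N m n = actOn M n (s.hom m) := rfl

/-- Auxiliary definition for `sectionLeft`. -/
def sectionLeftAdd (N : ModuleCat.{u} (B ⊗[K] Cᵐᵒᵖ)) : tensorObj K A B C M N →+ M ⊗[K] N :=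
  liftAdd (sectionLeftPre s N) fun m b n => by
    rw [sectionLeftPre_apply, sectionLeftPre_apply, hom_ract, actOn_ract]

lemma sectionLeftAdd_mk (m : M) (n : N) :
    sectionLeftAdd s N (mk m n) = actOn M n (s.hom m) := rfl

variable (N) in
/-- The map `M ⊗_B N → M ⊗_K N` attached to a map `M → M ⊗_K B`. -/
def sectionLeft : tensorObj K A B C M N →ₗ[K] M ⊗[K] N where
  toFun := sectionLeftAdd s N
  map_add' := map_add _
  map_smul' k x := by
    induction x using tensor_induction with
    | zero => rw [smul_zero, map_zero, smul_zero]
    | add x y hx hy => rw [smul_add, map_add, hx, hy, map_add, smul_add]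
    | mk m n =>
      rw [base_smul_eq_lact, lact_mk, sectionLeftAdd_mk, sectionLeftAdd_mk, RingHom.id_apply,
        hom_lact, ← base_smul_eq_lact, actOn_base]

lemma sectionLeft_mk (m : M) (n : N) : sectionLeft N s (mk m n) = actOn M n (s.hom m) := rfl

lemma quotLinear_sectionLeft
    (hs : s ≫ quot M (diagonalBimodule K B) ≫ (rightUnitIso M).hom = 𝟙 M)
    (x : tensorObj K A B C M N) : quotLinear M N (sectionLeft N s x) = x := by
  induction x using tensor_induction with
  | zero => simp
  | add x y hx hy => simp only [map_add, hx, hy]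
  | mk m n =>
    rw [sectionLeft_mk, quotLinear_actOn]
    exact congrArg (fun f => mk (f.hom m) n) hs

lemma sectionLeft_natural (g : N ⟶ N') (x : tensorObj K A B C M N) :
    sectionLeft N' s ((tensorMap K A B C (𝟙 M) g).hom x) =
      (baseMap K g).lTensor M (sectionLeft N s x) := by
  induction x using tensor_induction with
  | zero => simp
  | add x y hx hy => simp only [map_add, hx, hy]
  | mk m n =>
    rw [tensorMap_mk', sectionLeft_mk, sectionLeft_mk, map_actOn]
    rfl

/-- The multiplication M ⊗_K B → M is an epimorphism of bimodules, so it splits when M is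
projective. -/
lemma exists_sectionLeft (M : ModuleCat.{u} (A ⊗[K] Bᵐᵒᵖ)) [Projective M] :
    ∃ s : M ⟶ preObj M (diagonalBimodule K B),
      s ≫ quot M (diagonalBimodule K B) ≫ (rightUnitIso M).hom = 𝟙 M :=
  ⟨Projective.factorThru (𝟙 M) (quot M (diagonalBimodule K B) ≫ (rightUnitIso M).hom),
    Projective.factorThru_comp _ _⟩

/-- Through the section s, the functor M ⊗_B - is a natural retract of M ⊗_K -, which is exact
because M is flat over K. Exactness passes to retracts: push an element into M ⊗_K Y, lift it there,
and project the lift back. -/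
lemma preservesHomology_tensor_obj [Module.Flat K A] [Module.Flat K B]
    (M : ModuleCat.{u} (A ⊗[K] Bᵐᵒᵖ)) [Projective M] :
    ((tensorFunctor K A B C).obj M).PreservesHomology := by
  have : Module.Flat K Bᵐᵒᵖ := Module.Flat.of_linearEquiv (MulOpposite.opLinearEquiv K).symm
  have : Module.Flat K M := flat_of_projective M
  obtain ⟨s, hs⟩ := exists_sectionLeft M
  refine ModuleCat.preservesHomology_of_exact _ fun {X Y Z} f g hfg (y : tensorObj K A B C M Y) hy => ?_
  have h : (baseMap K g).lTensor M (sectionLeft Y s y) = 0 := by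
    rw [← sectionLeft_natural]
    exact (congrArg (sectionLeft Z s) hy).trans (map_zero _)
  obtain ⟨x, hx⟩ := (Module.Flat.lTensor_exact M (f := baseMap K f) (g := baseMap K g) hfg _).1 h
  refine ⟨quotLinear M X x, ?_⟩
  refine (quotLinear_natural (𝟙 M) f x).symm.trans ?_
  refine (congrArg (quotLinear M Y) hx).trans (quotLinear_sectionLeft s hs y)

/-- The tensor product of a projective bimodule and a bimodule which is flat over `K` is flat
over `K`. -/
lemma flat_tensorObj [Module.Flat K A] [Module.Flat K B]
    (M : ModuleCat.{u} (A ⊗[K] Bᵐᵒᵖ)) [Projective M] (N : ModuleCat.{u} (B ⊗[K] Cᵐᵒᵖ))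
    [Module.Flat K N] : Module.Flat K (tensorObj K A B C M N) := by
  have : Module.Flat K Bᵐᵒᵖ := Module.Flat.of_linearEquiv (MulOpposite.opLinearEquiv K).symm
  have : Module.Flat K M := flat_of_projective M
  obtain ⟨s, hs⟩ := exists_sectionLeft M
  exact Module.Flat.of_retract (sectionLeft N s) (quotLinear M N)
    (LinearMap.ext (quotLinear_sectionLeft s hs))

end Left

/-! ### The case of a projective right factor -/

section Right

/-- `b ⊗ n ↦ m b ⊗ n`. -/
def actOn' (N : ModuleCat.{u} (B ⊗[K] Cᵐᵒᵖ)) (m : M) :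
    preObj (diagonalBimodule K B) N →+ M ⊗[K] N :=
  TensorProduct.liftAddHom (R := K)
    ((AddMonoidHom.mk' (fun x : M => AddMonoidHom.mk' (fun n : N => (x ⊗ₜ[K] n : M ⊗[K] N))
      (TensorProduct.tmul_add x)) fun x x' => by
        ext n; exact TensorProduct.add_tmul x x' n).comp (ractHom M m))
    fun k b n => by
      induction b using diag_cases with
      | h b =>
        change (ractHom M m (lact (algebraMap K B k) (toDiag b))) ⊗ₜ[K] n = (ract b m) ⊗ₜ[K] (k • n)
        rw [lact_toDiag, Algebra.commutes, ractHom_toDiag, ract_mul, ← base_smul_eq_ract,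
          TensorProduct.smul_tmul]

@[simp]
lemma actOn'_pre (m : M) (b : B) (n : N) : actOn' N m (pre (toDiag b) n) = (ract b m) ⊗ₜ[K] n := rfl

lemma actOn'_add (m m' : M) (x : preObj (diagonalBimodule K B) N) :
    actOn' N (m + m') x = actOn' N m x + actOn' N m' x := by
  induction x using pre_induction with
  | zero => simp
  | add x y hx hy => simp only [map_add, hx, hy]; abel
  | pre b n =>
    induction b using diag_cases with
    | h b => rw [actOn'_pre, actOn'_pre, actOn'_pre, map_add, TensorProduct.add_tmul]

lemma actOn'_lact (m : M) (b : B) (x : preObj (diagonalBimodule K B) N) :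
    actOn' N m (lact b x) = actOn' N (ract b m) x := by
  induction x using pre_induction with
  | zero => simp
  | add x y hx hy => simp only [map_add, hx, hy]
  | pre b' n =>
    induction b' using diag_cases with
    | h b' => rw [lact_pre, lact_toDiag, actOn'_pre, actOn'_pre, ract_mul]

lemma quotLinear_actOn' (m : M) (x : preObj (diagonalBimodule K B) N) :
    quotLinear M N (actOn' N m x) =
      mk m ((leftUnitIso N).hom.hom ((quot (diagonalBimodule K B) N).hom x)) := by
  induction x using pre_induction with
  | zero => simp
  | add x y hx hy => simp only [map_add, hx, hy, mk_add]
  | pre b n =>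
    induction b using diag_cases with
    | h b => rw [actOn'_pre, quotLinear_tmul, quot_pre, leftUnitIso_hom_mk, ract_mk_eq]

lemma map_actOn' (g : M ⟶ M') (m : M) (x : preObj (diagonalBimodule K B) N) :
    (baseMap K g).rTensor N (actOn' N m x) = actOn' N (g.hom m) x := by
  induction x using pre_induction with
  | zero => simp
  | add x y hx hy => simp only [map_add, hx, hy]
  | pre b n =>
    induction b using diag_cases with
    | h b => exact congrArg (fun y : M' => (y ⊗ₜ[K] n : M' ⊗[K] N)) (hom_ract g b m)

variable (s : N ⟶ preObj (diagonalBimodule K B) N)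

variable (M) in
/-- The map `M ⊗_B N → M ⊗_K N` attached to a map `N → B ⊗_K N`. -/
def sectionRight : tensorObj K A B C M N →+ M ⊗[K] N :=
  liftAdd
    (AddMonoidHom.mk' (fun m => (actOn' N m).comp s.hom.toAddMonoidHom) fun m m' => by
        ext n
        exact actOn'_add m m' (s.hom n))
    fun m b n => by
      change actOn' N (ract b m) (s.hom n) = actOn' N m (s.hom (lact b n))
      rw [hom_lact, actOn'_lact]

lemma sectionRight_mk (m : M) (n : N) : sectionRight M s (mk m n) = actOn' N m (s.hom n) := rfl

lemma quotLinear_sectionRight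
    (hs : s ≫ quot (diagonalBimodule K B) N ≫ (leftUnitIso N).hom = 𝟙 N)
    (x : tensorObj K A B C M N) : quotLinear M N (sectionRight M s x) = x := by
  induction x using tensor_induction with
  | zero => simp
  | add x y hx hy => simp only [map_add, hx, hy]
  | mk m n =>
    rw [sectionRight_mk, quotLinear_actOn']
    exact congrArg (fun f => mk m (f.hom n)) hs

lemma sectionRight_natural (g : M ⟶ M') (x : tensorObj K A B C M N) :
    sectionRight M' s ((tensorMap K A B C g (𝟙 N)).hom x) =
      (baseMap K g).rTensor N (sectionRight M s x) := by
  induction x using tensor_induction with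
  | zero => simp
  | add x y hx hy => simp only [map_add, hx, hy]
  | mk m n =>
    rw [tensorMap_mk', sectionRight_mk, sectionRight_mk, map_actOn']
    rfl

/-- The mirror image, with a splitting of B ⊗_K N → N. -/
lemma preservesHomology_tensor_flip_obj [Module.Flat K B] [Module.Flat K C]
    (N : ModuleCat.{u} (B ⊗[K] Cᵐᵒᵖ)) [Projective N] :
    ((tensorFunctor K A B C).flip.obj N).PreservesHomology := by
  have : Module.Flat K Cᵐᵒᵖ := Module.Flat.of_linearEquiv (MulOpposite.opLinearEquiv K).symm
  have : Module.Flat K N := flat_of_projective N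
  obtain ⟨s, hs⟩ : ∃ s : N ⟶ preObj (diagonalBimodule K B) N,
      s ≫ quot (diagonalBimodule K B) N ≫ (leftUnitIso N).hom = 𝟙 N :=
    ⟨Projective.factorThru (𝟙 N) (quot (diagonalBimodule K B) N ≫ (leftUnitIso N).hom),
      Projective.factorThru_comp _ _⟩
  refine ModuleCat.preservesHomology_of_exact _ fun {X Y Z} f g hfg (y : tensorObj K A B C Y N) hy => ?_
  have h : (baseMap K g).rTensor N (sectionRight Y s y) = 0 := by
    rw [← sectionRight_natural]
    exact (congrArg (sectionRight Z s) hy).trans (map_zero _)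
  obtain ⟨x, hx⟩ := (Module.Flat.rTensor_exact N (f := baseMap K f) (g := baseMap K g) hfg _).1 h
  refine ⟨quotLinear X N x, ?_⟩
  refine (quotLinear_natural f (𝟙 N) x).symm.trans ?_
  refine (congrArg (quotLinear Y N) hx).trans (quotLinear_sectionRight s hs y)

end Right

end

end Bim

/-! ### Bounded above complexes and roofs of quasi-isomorphisms -/

namespace CochainComplex

open Limits

lemma isStrictlyLE_mapBifunctor {C₁ C₂ : Type*} [Category* C₁] [Category* C₂]
    [HasZeroMorphisms C₁] [HasZeroMorphisms C₂] [HasZeroObject C₁] [HasZeroObject C₂]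
    {S : Type u} [Ring S] (F : C₁ ⥤ C₂ ⥤ ModuleCat.{u} S) [F.PreservesZeroMorphisms]
    [∀ X, (F.obj X).PreservesZeroMorphisms] (P : CochainComplex C₁ ℤ) (X : CochainComplex C₂ ℤ)
    (m n : ℤ) [P.IsStrictlyLE m] [X.IsStrictlyLE n] :
    IsStrictlyLE (HomologicalComplex.mapBifunctor P X F (ComplexShape.up ℤ)) (m + n) := by
  rw [isStrictlyLE_iff]
  intro i hi
  refine (IsZero.iff_id_eq_zero _).2 (HomologicalComplex.mapBifunctor.hom_ext fun p q h => ?_)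
  have h' : p + q = i := h
  have hz : IsZero ((F.obj (P.X p)).obj (X.X q)) := by
    by_cases hp : m < p
    · exact Functor.map_isZero ((evaluation _ _).obj (X.X q))
        (Functor.map_isZero F (P.isZero_of_isStrictlyLE m p hp))
    · exact Functor.map_isZero (F.obj (P.X p)) (X.isZero_of_isStrictlyLE n q (by lia))
  exact hz.eq_of_src _ _

end CochainComplex

namespace DerivedCategory

variable {C : Type u} [Category.{v} C] [Abelian C] [HasDerivedCategory.{w} C]

/-- Isomorphic complexes in the derived category are related by a roof of quasi-isomorphisms. -/
lemma exists_roof {M N : CochainComplex C ℤ} (h : Nonempty (Q.obj M ≅ Q.obj N)) :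
    ∃ (Z : CochainComplex C ℤ) (s : Z ⟶ M) (t : Z ⟶ N), QuasiIso s ∧ QuasiIso t := by
  obtain ⟨e⟩ := h
  obtain ⟨Z, s, hs, t, ht⟩ := right_fac e.hom
  refine ⟨Z, s, t, (isIso_Q_map_iff_quasiIso _ s).1 hs, (isIso_Q_map_iff_quasiIso _ t).1 ?_⟩
  rw [(IsIso.inv_comp_eq (Q.map s)).1 ht.symm]
  infer_instance

/-- Isomorphic complexes in the derived category, one of which is bounded above, are related by a
roof of quasi-isomorphisms whose top is a bounded above complex of projective objects. -/
lemma exists_projective_roof [EnoughProjectives C] {M N : CochainComplex C ℤ} (n : ℤ)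
    [M.IsStrictlyLE n] (h : Nonempty (Q.obj M ≅ Q.obj N)) :
    ∃ (R : CochainComplex C ℤ) (s : R ⟶ M) (t : R ⟶ N), R.IsStrictlyLE n ∧
      (∀ i, Projective (R.X i)) ∧ QuasiIso s ∧ QuasiIso t := by
  obtain ⟨e⟩ := h
  obtain ⟨Z, hZ, s, hs, t, ht⟩ := right_fac_of_isStrictlyLE e.hom n
  have hs' := (isIso_Q_map_iff_quasiIso _ s).1 hs
  have ht' : QuasiIso t := (isIso_Q_map_iff_quasiIso _ t).1 (by
    rw [(IsIso.inv_comp_eq (Q.map s)).1 ht.symm]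
    infer_instance)
  obtain ⟨R, f, hf, hR, hR'⟩ := ProjRes.exists_quasiIso_projective Z n
  exact ⟨R, f ≫ s, f ≫ t, hR, hR', inferInstance, inferInstance⟩

end DerivedCategory

namespace ProjRes

variable {C : Type u} [Category.{v} C] [Abelian C]

/-- `P` is a bounded above complex of projective objects. -/
structure IsBoundedProjective (P : CochainComplex C ℤ) : Prop where
  exists_isStrictlyLE : ∃ n, P.IsStrictlyLE n
  projective : ∀ i, Projective (P.X i)

variable [EnoughProjectives C] [HasDerivedCategory.{w} C]

lemma isBoundedProjective_res (M : DerivedCategory.Minus C) : IsBoundedProjective (res M) :=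
  ⟨(exists_projective_iso M).choose_spec.1, (exists_projective_iso M).choose_spec.2.1⟩

lemma nonempty_iso_res (M : DerivedCategory.Minus C) :
    Nonempty (DerivedCategory.Q.obj (res M) ≅ M.obj) :=
  (exists_projective_iso M).choose_spec.2.2

end ProjRes

/-! ### Independence of the derived tensor product from the resolutions -/

namespace DPicard

open MonoidalCategory ProjRes DerivedCategory

variable {K : Type u} [CommRing K] {A : Type u} [Ring A] [Algebra K A]

attribute [local instance] Bim.monoidal Bim.complexMonoidal

lemma isStrictlyLE_tensor (P X : CochainComplex (BimCat K A A) ℤ) (m n : ℤ) [P.IsStrictlyLE m]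
    [X.IsStrictlyLE n] : (P ⊗ X).IsStrictlyLE (m + n) :=
  CochainComplex.isStrictlyLE_mapBifunctor (curriedTensor (BimCat K A A)) P X m n

section

variable [Module.Flat K A]

/-- Each column is a tensor product with one projective bimodule, an exact functor; boundedness
above lets the columns be assembled. -/
lemma quasiIso_whiskerLeft {P : CochainComplex (BimCat K A A) ℤ} (hP : IsBoundedProjective P)
    {X Y : CochainComplex (BimCat K A A) ℤ} (f : X ⟶ Y) [QuasiIso f] : QuasiIso (P ◁ f) := by
  obtain ⟨n, hn⟩ := hP.exists_isStrictlyLE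
  refine HomologicalComplex.quasiIso_mapBifunctorMap_right (curriedTensor (BimCat K A A)) P f n
    (fun i hi => P.isZero_of_isStrictlyLE n i hi) fun i => ?_
  have := hP.projective i
  have : ((curriedTensor (BimCat K A A)).obj (P.X i)).PreservesHomology :=
    Bim.preservesHomology_tensor_obj (C := A) (P.X i)
  infer_instance

lemma quasiIso_whiskerRight {P : CochainComplex (BimCat K A A) ℤ} (hP : IsBoundedProjective P)
    {X Y : CochainComplex (BimCat K A A) ℤ} (f : X ⟶ Y) [QuasiIso f] : QuasiIso (f ▷ P) := by
  obtain ⟨n, hn⟩ := hP.exists_isStrictlyLE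
  have (M : BimCat K A A) : ((curriedTensor (BimCat K A A)).flip.obj M).Additive :=
    inferInstanceAs ((Bim.tensorFunctor K A A A).flip.obj M).Additive
  refine HomologicalComplex.quasiIso_mapBifunctorMap_left (curriedTensor (BimCat K A A)) P f n
    (fun i hi => P.isZero_of_isStrictlyLE n i hi) fun i => ?_
  have := hP.projective i
  have : ((curriedTensor (BimCat K A A)).flip.obj (P.X i)).PreservesHomology :=
    Bim.preservesHomology_tensor_flip_obj (A := A) (P.X i)
  infer_instance

variable [HasDerivedCategory.{w} (BimCat K A A)]

lemma tensor_congr_right {P : CochainComplex (BimCat K A A) ℤ} (hP : IsBoundedProjective P)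
    {X Y : CochainComplex (BimCat K A A) ℤ} (h : Nonempty (Q.obj X ≅ Q.obj Y)) :
    Nonempty (Q.obj (P ⊗ X) ≅ Q.obj (P ⊗ Y)) := by
  obtain ⟨Z, s, t, hs, ht⟩ := exists_roof h
  have := quasiIso_whiskerLeft hP s
  have := quasiIso_whiskerLeft hP t
  exact ⟨(asIso (Q.map (P ◁ s))).symm ≪≫ asIso (Q.map (P ◁ t))⟩

lemma tensor_congr_left {P : CochainComplex (BimCat K A A) ℤ} (hP : IsBoundedProjective P)
    {X Y : CochainComplex (BimCat K A A) ℤ} (h : Nonempty (Q.obj X ≅ Q.obj Y)) :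
    Nonempty (Q.obj (X ⊗ P) ≅ Q.obj (Y ⊗ P)) := by
  obtain ⟨Z, s, t, hs, ht⟩ := exists_roof h
  have := quasiIso_whiskerRight hP s
  have := quasiIso_whiskerRight hP t
  exact ⟨(asIso (Q.map (s ▷ P))).symm ≪≫ asIso (Q.map (t ▷ P))⟩

/-- The derived tensor product can be computed with any bounded above complexes of projective
bimodules. -/
lemma derivedTensor_iso (M N : Minus (BimCat K A A)) {P X : CochainComplex (BimCat K A A) ℤ}
    (hP : Nonempty (Q.obj P ≅ M.obj)) (hX : IsBoundedProjective X)
    (hN : Nonempty (Q.obj X ≅ N.obj)) :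
    Nonempty (derivedTensor K M N ≅ Q.obj (P ⊗ X)) := by
  obtain ⟨e⟩ := hP
  obtain ⟨f⟩ := hN
  obtain ⟨g⟩ := nonempty_iso_res M
  -- The right factor is replaced while the left one is the projective resolution of M. Then the
  -- left factor is replaced by P against the projective X, so P itself may be any complex.
  obtain ⟨i⟩ := tensor_congr_right (isBoundedProjective_res M)
    ⟨Q.objObjPreimageIso N.obj ≪≫ f.symm⟩
  obtain ⟨j⟩ := tensor_congr_left hX ⟨g ≪≫ e.symm⟩
  exact ⟨i ≪≫ j⟩

end

end DPicard

/-! ### Inverses for the derived tensor product are bounded -/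

namespace DPicard

open MonoidalCategory ProjRes DerivedCategory

attribute [local instance] Bim.monoidal Bim.complexMonoidal

section Bounded

variable {K : Type u} [CommRing K] {A : Type u} [Ring A] [Algebra K A] [Module.Flat K A]
  [HasDerivedCategory.{w} (BimCat K A A)]

/-- Tensoring with P inverts quasi-isomorphisms, so it factors through the derived category, where f
and 0 have become equal. -/
lemma Q_map_whiskerLeft_eq_zero {P : CochainComplex (BimCat K A A) ℤ}
    (hP : IsBoundedProjective P) {X Y : CochainComplex (BimCat K A A) ℤ} (f : X ⟶ Y)
    (hf : Q.map f = 0) : Q.map (P ◁ f) = 0 := by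
  let W := HomologicalComplex.quasiIso (BimCat K A A) (ComplexShape.up ℤ)
  have hF : W.IsInvertedBy (tensorLeft P ⋙ Q) := fun X Y g (hg : QuasiIso g) => by
    have := quasiIso_whiskerLeft hP g
    exact inferInstanceAs (IsIso (Q.map (P ◁ g)))
  have h0 : P ◁ (0 : X ⟶ Y) = 0 := by
    ext n : 1
    refine HomologicalComplex.mapBifunctor.hom_ext fun i j h => ?_
    have : P.X i ◁ (0 : X.X j ⟶ Y.X j) = 0 :=
      ((curriedTensor (BimCat K A A)).obj (P.X i)).map_zero _ _
    refine (HomologicalComplex.ι_mapBifunctorMap (𝟙 P) (0 : X ⟶ Y) (curriedTensor (BimCat K A A))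
      (ComplexShape.up ℤ) i j n h).trans ?_
    simp [this]
  have e := Localization.fac (tensorLeft P ⋙ Q) hF Q
  have h1 := NatIso.naturality_1 e f
  have h2 := NatIso.naturality_1 e (0 : X ⟶ Y)
  have h3 : (tensorLeft P ⋙ Q).map f = (tensorLeft P ⋙ Q).map 0 := by
    rw [← h1, ← h2, Functor.comp_map, Functor.comp_map, hf, Functor.map_zero Q]
  refine h3.trans ?_
  exact (congrArg Q.map h0).trans (Functor.map_zero Q _ _)

/-- A complex with an inverse for the derived tensor product is bounded below. -/
lemma exists_isGE_of_tensor_iso {S T : CochainComplex (BimCat K A A) ℤ}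
    (hS : IsBoundedProjective S) (hT : IsBoundedProjective T)
    (h : Nonempty (Q.obj (S ⊗ T) ≅ Q.obj (𝟙_ (CochainComplex (BimCat K A A) ℤ))))
    (h' : Nonempty (Q.obj (T ⊗ S) ≅ Q.obj (𝟙_ (CochainComplex (BimCat K A A) ℤ)))) :
    ∃ n, T.IsGE n := by
  obtain ⟨m, hm⟩ := hS.exists_isStrictlyLE
  obtain ⟨n, hn⟩ := hT.exists_isStrictlyLE
  -- The bound -m - 1 is the largest for which S ⊗ Y sits in negative degrees. The map f is an
  -- isomorphism on cohomology in degrees ≤ -m - 1.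
  obtain ⟨Y, g, hg, hY, hY'⟩ := exists_quasiIso_projective (T.truncLE (-m - 1)) (-m - 1)
  have hYP : IsBoundedProjective Y := ⟨⟨_, hY⟩, hY'⟩
  let f := g ≫ T.ιTruncLE (-m - 1)
  have h1 : Q.map (S ◁ f) = 0 := by
    have := isStrictlyLE_tensor S Y m (-m - 1)
    have h0 : (𝟙_ (CochainComplex (BimCat K A A) ℤ)).IsGE 0 :=
      inferInstanceAs (CochainComplex.IsGE
        ((CochainComplex.singleFunctor (BimCat K A A) 0).obj (𝟙_ (BimCat K A A))) 0)
    have : (Q.obj (S ⊗ T)).IsGE 0 := TStructure.t.isGE_of_iso h.some.symm 0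
    -- The source is in degrees ≤ -1 and the target, isomorphic to A, in degrees ≥ 0.
    exact TStructure.t.zero (Q.map (S ◁ f)) (m + (-m - 1)) 0 (by lia)
  have h2 := Q_map_whiskerLeft_eq_zero hT _ h1
  have h3 : Q.map ((T ⊗ S) ◁ f) = 0 := by
    have := congrArg Q.map (associator_naturality_right T S f)
    rw [Q.map_comp, Q.map_comp, h2, Limits.comp_zero] at this
    exact Limits.zero_of_comp_mono _ this
  have hTS := isStrictlyLE_tensor T S n m
  -- The isomorphism T ⊗ S ≅ A exists only in the derived category. The vanishing of - ⊗ f is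
  -- carried along the roof, from T ⊗ S to R and from R to the unit, by the exchange law; s and t
  -- stay quasi-isomorphisms after tensoring with T and Y, which are bounded above and projective.
  obtain ⟨R, s, t, -, -, hs, ht⟩ := exists_projective_roof (n + m) h'
  have := quasiIso_whiskerRight hT s
  have := quasiIso_whiskerRight hT t
  have := quasiIso_whiskerRight hYP s
  have := quasiIso_whiskerRight hYP t
  have h4 : Q.map (R ◁ f) = 0 := by
    have := congrArg Q.map (whisker_exchange s f)
    rw [Q.map_comp, Q.map_comp, h3, Limits.comp_zero] at this
    exact Limits.zero_of_comp_mono _ this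
  have h5 : Q.map (𝟙_ _ ◁ f) = 0 := by
    have := congrArg Q.map (whisker_exchange t f)
    rw [Q.map_comp, Q.map_comp, h4, Limits.zero_comp] at this
    exact Limits.zero_of_epi_comp _ this.symm
  have h6 : Q.map f = 0 := by
    have := congrArg Q.map (leftUnitor_naturality f)
    rw [Q.map_comp, Q.map_comp, h5, Limits.zero_comp] at this
    exact Limits.zero_of_epi_comp _ this.symm
  -- For i < -m the map induced by f on Hⁱ is both an isomorphism and zero.
  refine ⟨-m, (CochainComplex.isGE_iff _ _).2 fun i hi => ?_⟩
  rw [HomologicalComplex.exactAt_iff_isZero_homology]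
  have := T.quasiIsoAt_ιTruncLE (-m - 1) i (by lia)
  have hfi : QuasiIsoAt f i := inferInstance
  rw [quasiIsoAt_iff_isIso_homologyMap] at hfi
  refine Limits.IsZero.of_epi_eq_zero (HomologicalComplex.homologyMap f i) ?_
  have := NatIso.naturality_1 (homologyFunctorFactors (BimCat K A A) i) f
  rw [← HomologicalComplex.homologyFunctor_map, ← this, Functor.comp_map, h6, Functor.map_zero,
    Limits.zero_comp, Limits.comp_zero]
  rfl

end Bounded

/-! ### The monoid of isomorphism classes in D⁻; its units are the derived Picard group -/

section Monoid

variable (K : Type u) [CommRing K] (A : Type u) [Ring A] [Algebra K A]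
  [HasDerivedCategory.{w} (BimCat K A A)]

/-- The isomorphism classes of bounded above complexes of bimodules in the derived category. -/
def MinusClass := Quotient (isIsomorphicSetoid (Minus (BimCat K A A)))

variable {K A}

/-- The isomorphism class of an object of `D⁻`. -/
def MinusClass.mk (M : Minus (BimCat K A A)) : MinusClass K A :=
  Quotient.mk (isIsomorphicSetoid _) M

lemma MinusClass.ind {p : MinusClass K A → Prop} (h : ∀ M, p (mk M)) (x : MinusClass K A) : p x :=
  Quotient.ind h x

lemma MinusClass.exists_rep (x : MinusClass K A) : ∃ M, mk M = x := Quotient.exists_rep x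

lemma MinusClass.mk_eq_mk_iff {M N : Minus (BimCat K A A)} :
    mk M = mk N ↔ Nonempty (M.obj ≅ N.obj) :=
  Quotient.eq.trans ⟨fun ⟨e⟩ => ⟨Minus.ι.mapIso e⟩,
    fun ⟨e⟩ => ⟨TStructure.t.minus.fullyFaithfulι.preimageIso e⟩⟩

/-- The derived tensor product of objects of `D⁻` belongs to `D⁻`. -/
def minusTensor [Module.Flat K A] (M N : Minus (BimCat K A A)) : Minus (BimCat K A A) :=
  ⟨derivedTensor K M N, by
    obtain ⟨m, hm⟩ := (isBoundedProjective_res M).exists_isStrictlyLE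
    obtain ⟨n, hn⟩ := (isBoundedProjective_res N).exists_isStrictlyLE
    obtain ⟨e⟩ := derivedTensor_iso M N (nonempty_iso_res M) (isBoundedProjective_res N)
      (nonempty_iso_res N)
    have := isStrictlyLE_tensor (res M) (res N) m n
    exact ⟨m + n, TStructure.t.isLE_of_iso e.symm (m + n)⟩⟩

variable (K A) in
/-- The diagonal bimodule as an object of `D⁻`. -/
def minusUnit : Minus (BimCat K A A) :=
  ⟨diagonal K A, 0, inferInstanceAs
    (((singleFunctor (BimCat K A A) 0).obj (diagonalBimodule K A)).IsLE 0)⟩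

variable (K A) in
/-- The diagonal bimodule in the derived category comes from the unit of the monoidal category of
complexes. -/
def diagonalIso : Q.obj (𝟙_ (CochainComplex (BimCat K A A) ℤ)) ≅ diagonal K A := Iso.refl _

instance : One (MinusClass K A) := ⟨.mk (minusUnit K A)⟩

lemma MinusClass.mk_eq_one_iff (M : Minus (BimCat K A A)) : mk M = 1 ↔ Nonempty (M.obj ≅ diagonal K A) :=
  mk_eq_mk_iff

variable [Module.Flat K A]

/-- The variant with the projective resolution on the left only. It is needed when the right factor
is A or a tensor product, whose terms need not be projective. -/
lemma derivedTensor_iso' (M N : Minus (BimCat K A A)) {P X : CochainComplex (BimCat K A A) ℤ}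
    (hP : IsBoundedProjective P) (hM : Nonempty (Q.obj P ≅ M.obj))
    (hX : Nonempty (Q.obj X ≅ N.obj)) :
    Nonempty (derivedTensor K M N ≅ Q.obj (P ⊗ X)) := by
  obtain ⟨e⟩ := derivedTensor_iso M N hM (isBoundedProjective_res N) (nonempty_iso_res N)
  obtain ⟨f⟩ := nonempty_iso_res N
  obtain ⟨g⟩ := hX
  obtain ⟨i⟩ := tensor_congr_right hP ⟨f ≪≫ g.symm⟩
  exact ⟨e ≪≫ i⟩

instance : Mul (MinusClass K A) where
  mul := Quotient.map₂ minusTensor fun M M' h N N' h' => by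
    obtain ⟨e⟩ := MinusClass.mk_eq_mk_iff.1 (Quotient.sound h)
    obtain ⟨e'⟩ := MinusClass.mk_eq_mk_iff.1 (Quotient.sound h')
    obtain ⟨f⟩ := nonempty_iso_res M
    obtain ⟨f'⟩ := nonempty_iso_res N
    obtain ⟨g⟩ := derivedTensor_iso M N ⟨f⟩ (isBoundedProjective_res N) ⟨f'⟩
    -- The resolutions of M and N also represent M' and N', so a single complex computes both
    -- products.
    obtain ⟨g'⟩ := derivedTensor_iso M' N' ⟨f ≪≫ e⟩ (isBoundedProjective_res N) ⟨f' ≪≫ e'⟩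
    exact Quotient.exact (MinusClass.mk_eq_mk_iff.2 ⟨g ≪≫ g'.symm⟩)

namespace MinusClass

lemma mk_mul_mk_eq_iff (M N L : Minus (BimCat K A A)) :
    mk M * mk N = mk L ↔ Nonempty (derivedTensor K M N ≅ L.obj) :=
  mk_eq_mk_iff

/-- The laws come from the associator and the unitors of complexes. In each derived product at least
one factor is a projective resolution, which suffices to represent the other by A or by a tensor
product of resolutions. -/
instance : Monoid (MinusClass K A) where
  mul_assoc x y z := by
    induction x using MinusClass.ind with | h M
    induction y using MinusClass.ind with | h N
    induction z using MinusClass.ind with | h L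
    obtain ⟨e⟩ := derivedTensor_iso M N (nonempty_iso_res M) (isBoundedProjective_res N)
      (nonempty_iso_res N)
    obtain ⟨f⟩ := derivedTensor_iso N L (nonempty_iso_res N) (isBoundedProjective_res L)
      (nonempty_iso_res L)
    obtain ⟨g⟩ := derivedTensor_iso (minusTensor M N) L ⟨e.symm⟩ (isBoundedProjective_res L)
      (nonempty_iso_res L)
    obtain ⟨h⟩ := derivedTensor_iso' M (minusTensor N L) (isBoundedProjective_res M)
      (nonempty_iso_res M) ⟨f.symm⟩
    exact mk_eq_mk_iff.2 ⟨g ≪≫ Q.mapIso (α_ _ _ _) ≪≫ h.symm⟩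
  one_mul x := by
    induction x using MinusClass.ind with | h M
    obtain ⟨e⟩ := derivedTensor_iso (minusUnit K A) M ⟨diagonalIso K A⟩ (isBoundedProjective_res M)
      (nonempty_iso_res M)
    obtain ⟨f⟩ := nonempty_iso_res M
    exact mk_eq_mk_iff.2 ⟨e ≪≫ Q.mapIso (λ_ _) ≪≫ f⟩
  mul_one x := by
    induction x using MinusClass.ind with | h M
    obtain ⟨e⟩ := derivedTensor_iso' M (minusUnit K A) (isBoundedProjective_res M)
      (nonempty_iso_res M) ⟨diagonalIso K A⟩
    obtain ⟨f⟩ := nonempty_iso_res M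
    exact mk_eq_mk_iff.2 ⟨e ≪≫ Q.mapIso (ρ_ _) ≪≫ f⟩

lemma exists_isGE {M N : Minus (BimCat K A A)} (h : mk M * mk N = 1) (h' : mk N * mk M = 1) :
    ∃ n, N.obj.IsGE n := by
  obtain ⟨e⟩ := (mk_mul_mk_eq_iff _ _ _).1 h
  obtain ⟨e'⟩ := (mk_mul_mk_eq_iff _ _ _).1 h'
  obtain ⟨f⟩ := derivedTensor_iso M N (nonempty_iso_res M) (isBoundedProjective_res N)
      (nonempty_iso_res N)
  obtain ⟨f'⟩ := derivedTensor_iso N M (nonempty_iso_res N) (isBoundedProjective_res M)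
      (nonempty_iso_res M)
  obtain ⟨n, hn⟩ := exists_isGE_of_tensor_iso (isBoundedProjective_res M)
    (isBoundedProjective_res N) ⟨f.symm ≪≫ e ≪≫ (diagonalIso K A).symm⟩
    ⟨f'.symm ≪≫ e' ≪≫ (diagonalIso K A).symm⟩
  exact ⟨n, TStructure.t.isGE_of_iso (nonempty_iso_res N).some n⟩

end MinusClass

/-- The content is that an inverse in D⁻ is automatically bounded below, so the boundedness of S
required of a tilting complex is no restriction. -/
lemma isTilting_iff {T : Bounded (BimCat K A A)} :
    IsTilting T ↔ IsUnit (MinusClass.mk (toMinus T)) := by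
  constructor
  · rintro ⟨S, h, h'⟩
    exact ⟨⟨.mk (toMinus T), .mk (toMinus S), (MinusClass.mk_mul_mk_eq_iff _ _ _).2 h',
      (MinusClass.mk_mul_mk_eq_iff _ _ _).2 h⟩, rfl⟩
  · rintro ⟨x, hx⟩
    obtain ⟨S, hS⟩ : ∃ S, MinusClass.mk S = (↑x⁻¹ : MinusClass K A) := MinusClass.exists_rep _
    have h : MinusClass.mk (toMinus T) * MinusClass.mk S = 1 := by rw [hS, ← hx, x.mul_inv]
    have h' : MinusClass.mk S * MinusClass.mk (toMinus T) = 1 := by rw [hS, ← hx, x.inv_mul]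
    exact ⟨⟨S.obj, MinusClass.exists_isGE h h', S.property⟩,
      (MinusClass.mk_mul_mk_eq_iff _ _ _).1 h', (MinusClass.mk_mul_mk_eq_iff _ _ _).1 h⟩

/-- The class of a tilting complex, as an invertible class. -/
def TiltingComplex.unit (T : TiltingComplex K A) : (MinusClass K A)ˣ :=
  (isTilting_iff.1 T.2).unit

lemma DPic.mk_eq_mk_iff {S T : TiltingComplex K A} : mk S = mk T ↔ S.unit = T.unit := by
  rw [Units.ext_iff]
  exact Quotient.eq.trans (Iff.trans ⟨fun ⟨e⟩ => ⟨Bounded.ι.mapIso e⟩,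
    fun ⟨e⟩ => ⟨TStructure.t.bounded.fullyFaithfulι.preimageIso e⟩⟩
      MinusClass.mk_eq_mk_iff.symm)

variable (K A) in
/-- The derived Picard group consists of the invertible classes. -/
def dpicEquiv : DPic K A ≃ (MinusClass K A)ˣ :=
  Equiv.ofBijective (Quotient.lift TiltingComplex.unit fun _ _ h =>
      DPic.mk_eq_mk_iff.1 (Quotient.sound h)) <| by
    constructor
    · intro x y h
      induction x using Quotient.ind with | _ S
      induction y using Quotient.ind with | _ T
      exact DPic.mk_eq_mk_iff.2 h
    · intro x
      obtain ⟨T, hT⟩ : ∃ T, MinusClass.mk T = (↑x : MinusClass K A) := MinusClass.exists_rep _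
      obtain ⟨S, hS⟩ : ∃ S, MinusClass.mk S = (↑x⁻¹ : MinusClass K A) := MinusClass.exists_rep _
      -- The same boundedness, now applied to the unit itself, places its representative in the
      -- bounded derived category.
      let T' : Bounded (BimCat K A A) := ⟨T.obj, MinusClass.exists_isGE (M := S)
        (by rw [hS, hT, x.inv_mul]) (by rw [hS, hT, x.mul_inv]), T.property⟩
      exact ⟨DPic.mk ⟨T', isTilting_iff.2 ⟨x, hT.symm⟩⟩, Units.ext hT⟩

lemma dpicEquiv_mk (T : TiltingComplex K A) : dpicEquiv K A (DPic.mk T) = T.unit := rfl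

variable (K A) in
/-- The group structure on the derived Picard group. -/
@[reducible]
def dpicGroup : Group (DPic K A) := (dpicEquiv K A).group

variable (K A) in
lemma isDPicGroup_dpicGroup : IsDPicGroup (dpicGroup K A) := by
  refine ⟨fun S T U => ?_, fun T => ?_⟩
  · change (dpicEquiv K A).symm (S.unit * T.unit) = DPic.mk U ↔ _
    rw [Equiv.symm_apply_eq, dpicEquiv_mk, Units.ext_iff]
    exact MinusClass.mk_mul_mk_eq_iff _ _ _
  · change DPic.mk T = (dpicEquiv K A).symm 1 ↔ _
    rw [Equiv.eq_symm_apply, dpicEquiv_mk, Units.ext_iff]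
    exact MinusClass.mk_eq_one_iff _

end Monoid

end DPicard

/-! ### Base change of bimodules: tensor products, the diagonal, projectives -/

namespace Bim

attribute [local instance] baseModule base_isScalarTower

section BaseChange

variable {K : Type u} [CommRing K] {A B C : Type u} [Ring A] [Algebra K A] [Ring B] [Algebra K B]
  [Ring C] [Algebra K C] {K' : Type u} [CommRing K'] [Algebra K K']

section

variable {M N : ModuleCat.{u} (A ⊗[K] Bᵐᵒᵖ)}

/-- The pure tensor `k ⊗ m` of `K' ⊗_K M`. -/
def bc (k : K') (m : M) : (baseChangeFunctor K A B K').obj M := BaseChange.tmul K A B K' k m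

lemma bc_add (k : K') (m m' : M) : bc k (m + m') = bc k m + bc k m' :=
  TensorProduct.tmul_add (R := K) k m m'

lemma add_bc (k k' : K') (m : M) : bc (k + k') m = bc k m + bc k' m :=
  TensorProduct.add_tmul (R := K) k k' m

lemma bc_smul (c : K) (k : K') (m : M) : bc (c • k) m = bc k (c • m) :=
  TensorProduct.smul_tmul (R := K) c k m

@[elab_as_elim]
lemma bc_induction {p : (baseChangeFunctor K A B K').obj M → Prop} (zero : p 0)
    (bc : ∀ (k : K') (m : M), p (bc k m)) (add : ∀ x y, p x → p y → p (x + y))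
    (x : (baseChangeFunctor K A B K').obj M) : p x :=
  TensorProduct.induction_on (R := K) (M := K') (N := M) (motive := p) x zero bc add

@[simp]
lemma lact_bc (k j : K') (a : A) (m : M) :
    lact (k ⊗ₜ[K] a : K' ⊗[K] A) (bc j m) = bc (k * j) (lact a m) := by
  refine (baseChange_smul_tmul K A B K' M k 1 j a 1 m).trans ?_
  rw [mul_one]
  rfl

@[simp]
lemma ract_bc (l j : K') (b : B) (m : M) :
    ract (l ⊗ₜ[K] b : K' ⊗[K] B) (bc j m) = bc (l * j) (ract b m) := by
  refine (baseChange_smul_tmul K A B K' M 1 l j 1 b m).trans ?_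
  rw [one_mul]
  rfl

variable (K' M) in
/-- `bc` as a biadditive map. -/
def bcHom : K' →+ M →+ (baseChangeFunctor K A B K').obj M :=
  AddMonoidHom.mk' (fun k => AddMonoidHom.mk' (bc k) (bc_add k))
    fun k k' => AddMonoidHom.ext fun m => add_bc k k' m

lemma bcHom_apply (k : K') (m : M) : bcHom K' M k m = bc k m := rfl

/-- The additive map on `K' ⊗_K M` induced by a `K`-balanced biadditive map. -/
def bcLift {X : Type*} [AddCommGroup X] (φ : K' →+ M →+ X)
    (h : ∀ (c : K) k m, φ (c • k) m = φ k (c • m)) :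
    (baseChangeFunctor K A B K').obj M →+ X :=
  TensorProduct.liftAddHom (R := K) φ h

lemma bc_addHom_ext {X : Type*} [AddCommGroup X]
    {f g : (baseChangeFunctor K A B K').obj M →+ X} (h : ∀ k m, f (bc k m) = g (bc k m)) : f = g :=
  BaseChange.hom_ext K A B K' M h

lemma bc_hom_ext {X : ModuleCat.{u} ((K' ⊗[K] A) ⊗[K'] (K' ⊗[K] B)ᵐᵒᵖ)}
    {f g : (baseChangeFunctor K A B K').obj M ⟶ X}
    (h : ∀ k m, f.hom (bc k m) = g.hom (bc k m)) : f = g :=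
  ModuleCat.hom_ext (LinearMap.toAddMonoidHom_injective (bc_addHom_ext h))

end

instance : (baseChangeFunctor K A B K').Additive where
  map_add {_ _ f g} := bc_hom_ext fun k m => bc_add k (f.hom m) (g.hom m)

open Limits in
instance (J : Type) : PreservesColimitsOfShape (Discrete J) (baseChangeFunctor K A B K') := by
  refine ModuleCat.preservesColimitsOfShape_discrete _ fun Y p hp x => ?_
  induction x using bc_induction with
  | zero => exact zero_mem p
  | add x y hx hy => exact add_mem hx hy
  | bc k m =>
    have := ModuleCat.coproduct_mem_iSup_range Y m
    induction this using Submodule.iSup_induction' with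
    | mem j y hy =>
      obtain ⟨y, rfl⟩ := hy
      exact hp j (bc k y)
    | zero =>
      have : bc k (0 : (∐ Y : ModuleCat.{u} (A ⊗[K] Bᵐᵒᵖ))) = 0 := map_zero (bcHom K' _ k)
      exact this ▸ zero_mem p
    | add m m' _ _ hm hm' => exact bc_add k m m' ▸ add_mem hm hm'

section

variable {N N' : ModuleCat.{u} ((K' ⊗[K] A) ⊗[K'] (K' ⊗[K] B)ᵐᵒᵖ)}

lemma zero_lact {A B : Type u} [Ring A] [Algebra K A] [Ring B] [Algebra K B]
    {N : ModuleCat.{u} (A ⊗[K] Bᵐᵒᵖ)} (n : N) : lact (0 : A) n = 0 := by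
  have := lact_add (0 : A) 0 n
  simpa using this

lemma zero_ract {A B : Type u} [Ring A] [Algebra K A] [Ring B] [Algebra K B]
    {N : ModuleCat.{u} (A ⊗[K] Bᵐᵒᵖ)} (n : N) : ract (0 : B) n = 0 := by
  have := ract_add (0 : B) 0 n
  simpa using this

/-- A morphism out of `K' ⊗_K M`, given by its values on pure tensors. -/
def bcHomMk {M : ModuleCat.{u} (A ⊗[K] Bᵐᵒᵖ)} (f : (baseChangeFunctor K A B K').obj M →+ N)
    (hl : ∀ (k j : K') (a : A) (m : M), f (bc (k * j) (lact a m)) = lact (k ⊗ₜ[K] a) (f (bc j m)))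
    (hr : ∀ (k j : K') (b : B) (m : M), f (bc (k * j) (ract b m)) = ract (k ⊗ₜ[K] b) (f (bc j m))) :
    (baseChangeFunctor K A B K').obj M ⟶ N :=
  homMk f
    (fun a x => by
      induction x using bc_induction with
      | zero => simp
      | add x y hx hy => simp only [map_add, hx, hy]
      | bc j m =>
        induction a using TensorProduct.induction_on with
        | zero => simp [zero_lact]
        | add a a' h h' => simp only [lact_add, map_add, h, h']
        | tmul k a => rw [lact_bc, hl])
    (fun b x => by
      induction x using bc_induction with
      | zero => simp
      | add x y hx hy => simp only [map_add, hx, hy]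
      | bc j m =>
        induction b using TensorProduct.induction_on with
        | zero => simp [zero_ract]
        | add b b' h h' => simp only [ract_add, map_add, h, h']
        | tmul k b => rw [ract_bc, hr])

end

section Tensor

variable (M : ModuleCat.{u} (A ⊗[K] Bᵐᵒᵖ)) (N : ModuleCat.{u} (B ⊗[K] Cᵐᵒᵖ))

/-- `m ⊗ n ↦ (k ⊗ m) ⊗ (1 ⊗ n)`. -/
def bcTensorPre (k : K') : tensorObj K A B C M N →+
    tensorObj K' (K' ⊗[K] A) (K' ⊗[K] B) (K' ⊗[K] C) ((baseChangeFunctor K A B K').obj M)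
      ((baseChangeFunctor K B C K').obj N) :=
  liftAdd (((AddMonoidHom.compHom.flip (bcHom K' N 1)).comp (mkHom _ _)).comp (bcHom K' M k))
    fun m b n => by
      change mk (bc k (ract b m)) (bc (1 : K') n) = mk (bc k m) (bc 1 (lact b n))
      have h1 : bc k (ract b m) = ract ((1 : K') ⊗ₜ[K] b) (bc k m) := by rw [ract_bc, one_mul]
      have h2 : bc (1 : K') (lact b n) = lact ((1 : K') ⊗ₜ[K] b) (bc 1 n) := by
        rw [lact_bc, one_mul]
      rw [h1, h2, ract_mk_eq]

@[simp]
lemma bcTensorPre_mk (k : K') (m : M) (n : N) :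
    bcTensorPre M N k (mk m n) = mk (bc k m) (bc 1 n) := rfl

/-- The map `K' ⊗ (M ⊗_B N) → (K' ⊗ M) ⊗_{B'} (K' ⊗ N)`. -/
def bcTensorHom : (baseChangeFunctor K A C K').obj (tensorObj K A B C M N) ⟶
    tensorObj K' (K' ⊗[K] A) (K' ⊗[K] B) (K' ⊗[K] C) ((baseChangeFunctor K A B K').obj M)
      ((baseChangeFunctor K B C K').obj N) :=
  bcHomMk
    (bcLift (AddMonoidHom.mk' (bcTensorPre M N) fun k k' => tensor_addHom_ext fun m n => by
        simp [add_bc, add_mk])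
      fun c k x => by
        change bcTensorPre M N (c • k) x = bcTensorPre M N k (c • x)
        induction x using tensor_induction with
        | zero => simp
        | add x y hx hy => rw [smul_add, map_add, map_add, hx, hy]
        | mk m n =>
          rw [base_smul_eq_lact, lact_mk, bcTensorPre_mk, bcTensorPre_mk, bc_smul]
          rfl)
    (fun k j a x => by
      change bcTensorPre M N _ _ = lact _ (bcTensorPre M N _ _)
      induction x using tensor_induction with
      | zero => simp
      | add x y hx hy => simp only [map_add, hx, hy]
      | mk m n => simp)
    (fun k j c x => by
      change bcTensorPre M N _ _ = ract _ (bcTensorPre M N _ _)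
      induction x using tensor_induction with
      | zero => simp
      | add x y hx hy => simp only [map_add, hx, hy]
      | mk m n =>
        simp only [ract_mk, bcTensorPre_mk, ract_bc, mul_one]
        -- The scalar k, which acts on the right-hand factor, is moved to the left-hand one through
        -- the middle action of k ⊗ 1 in K' ⊗ B.
        have h1 : bc (k * j) m = ract (k ⊗ₜ[K] (1 : B)) (bc j m) := by rw [ract_bc, ract_one]
        have h2 : bc k (ract c n) = lact (k ⊗ₜ[K] (1 : B)) (bc (1 : K') (ract c n)) := by
          rw [lact_bc, lact_one, mul_one]
        rw [h1, h2, ract_mk_eq])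

@[simp]
lemma bcTensorHom_bc (k : K') (m : M) (n : N) :
    (bcTensorHom M N).hom (bc k (mk m n)) = mk (bc k m) (bc 1 n) := rfl

/-- `l ⊗ n ↦ (k l) ⊗ (m ⊗ n)`. -/
def bcTensorInvPre (k : K') (m : M) : (baseChangeFunctor K B C K').obj N →+
    (baseChangeFunctor K A C K').obj (tensorObj K A B C M N) :=
  bcLift (((AddMonoidHom.compHom.flip (mkHom M N m)).comp
      (bcHom K' (tensorObj K A B C M N))).comp (AddMonoidHom.mulLeft k))
    fun c l n => by
      change bc (k * c • l) (mk m n) = bc (k * l) (mk m (c • n))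
      rw [mul_smul_comm, bc_smul, base_smul_eq_ract, base_smul_eq_ract, ract_mk]

@[simp]
lemma bcTensorInvPre_bc (k l : K') (m : M) (n : N) :
    bcTensorInvPre M N k m (bc l n) = bc (k * l) (mk m n) := rfl

/-- `(k ⊗ m) ⊗ (l ⊗ n) ↦ (k l) ⊗ (m ⊗ n)`. -/
def bcTensorInvAdd : (baseChangeFunctor K A B K').obj M →+ (baseChangeFunctor K B C K').obj N →+
    (baseChangeFunctor K A C K').obj (tensorObj K A B C M N) :=
  bcLift (AddMonoidHom.mk' (fun k => AddMonoidHom.mk' (bcTensorInvPre M N k)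
      fun m m' => bc_addHom_ext fun l n => by simp [add_mk, bc_add])
    fun k k' => AddMonoidHom.ext fun m => bc_addHom_ext fun l n => by simp [add_mul, add_bc])
    fun c k m => bc_addHom_ext fun l n => by
      change bc (c • k * l) (mk m n) = bc (k * l) (mk (c • m) n)
      rw [smul_mul_assoc, bc_smul, base_smul_eq_lact, base_smul_eq_lact, lact_mk]

@[simp]
lemma bcTensorInvAdd_bc (k l : K') (m : M) (n : N) :
    bcTensorInvAdd M N (bc k m) (bc l n) = bc (k * l) (mk m n) := rfl

/-- The map `(K' ⊗ M) ⊗_{B'} (K' ⊗ N) → K' ⊗ (M ⊗_B N)`. -/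
def bcTensorInv : tensorObj K' (K' ⊗[K] A) (K' ⊗[K] B) (K' ⊗[K] C)
      ((baseChangeFunctor K A B K').obj M) ((baseChangeFunctor K B C K').obj N) ⟶
    (baseChangeFunctor K A C K').obj (tensorObj K A B C M N) :=
  lift (bcTensorInvAdd M N)
    (fun x b y => by
      induction x using bc_induction with
      | zero => simp
      | add x x' h h' => simp only [map_add, h, h', AddMonoidHom.add_apply]
      | bc k m =>
        induction y using bc_induction with
        | zero => simp
        | add y y' h h' => simp only [map_add, h, h']
        | bc l n =>
          induction b using TensorProduct.induction_on with
          | zero => simp [zero_lact, zero_ract]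
          | add b b' h h' => simp only [lact_add, ract_add, map_add, h, h', AddMonoidHom.add_apply]
          | tmul j b => simp [ract_mk_eq, mul_assoc, mul_left_comm])
    (fun a x y => by
      induction x using bc_induction with
      | zero => simp
      | add x x' h h' => simp only [map_add, h, h', AddMonoidHom.add_apply]
      | bc k m =>
        induction y using bc_induction with
        | zero => simp
        | add y y' h h' => simp only [map_add, h, h']
        | bc l n =>
          induction a using TensorProduct.induction_on with
          | zero => simp [zero_lact]
          | add b b' h h' => simp only [lact_add, map_add, h, h', AddMonoidHom.add_apply]
          | tmul j b => simp [mul_assoc])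
    (fun c x y => by
      induction x using bc_induction with
      | zero => simp
      | add x x' h h' => simp only [map_add, h, h', AddMonoidHom.add_apply]
      | bc k m =>
        induction y using bc_induction with
        | zero => simp
        | add y y' h h' => simp only [map_add, h, h']
        | bc l n =>
          induction c using TensorProduct.induction_on with
          | zero => simp [zero_ract]
          | add b b' h h' => simp only [ract_add, map_add, h, h']
          | tmul j b => simp [mul_left_comm])

@[simp]
lemma bcTensorInv_mk (k l : K') (m : M) (n : N) :
    (bcTensorInv M N).hom (mk (bc k m) (bc l n)) = bc (k * l) (mk m n) := rfl

variable {M N} in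
/-- Morphisms out of `(K' ⊗ M) ⊗_{B'} (K' ⊗ N)` agree if they agree on pure tensors. -/
lemma bcTensor_hom_ext {X : ModuleCat.{u} ((K' ⊗[K] A) ⊗[K'] (K' ⊗[K] C)ᵐᵒᵖ)}
    {f g : tensorObj K' (K' ⊗[K] A) (K' ⊗[K] B) (K' ⊗[K] C)
      ((baseChangeFunctor K A B K').obj M) ((baseChangeFunctor K B C K').obj N) ⟶ X}
    (h : ∀ (k l : K') (m : M) (n : N),
      f.hom (mk (bc k m) (bc l n)) = g.hom (mk (bc k m) (bc l n))) : f = g := by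
  refine hom_ext_mk fun x y => ?_
  induction x using bc_induction with
  | zero => simp
  | add x x' h h' => simp only [add_mk, map_add, h, h']
  | bc k m =>
    induction y using bc_induction with
    | zero => simp
    | add y y' h h' => simp only [mk_add, map_add, h, h']
    | bc l n => exact h k l m n

variable (K') in
/-- `K' ⊗ (M ⊗_B N) ≅ (K' ⊗ M) ⊗_{B'} (K' ⊗ N)`. -/
def bcTensorIso : (baseChangeFunctor K A C K').obj (tensorObj K A B C M N) ≅
    tensorObj K' (K' ⊗[K] A) (K' ⊗[K] B) (K' ⊗[K] C) ((baseChangeFunctor K A B K').obj M)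
      ((baseChangeFunctor K B C K').obj N) where
  hom := bcTensorHom M N
  inv := bcTensorInv M N
  hom_inv_id := bc_hom_ext fun k x => by
    induction x using tensor_induction with
    | zero => rw [← bcHom_apply, map_zero, map_zero, map_zero]
    | add x y hx hy => rw [bc_add, map_add, map_add, hx, hy]
    | mk m n =>
      change (bcTensorInv M N).hom ((bcTensorHom M N).hom (bc k (mk m n))) = bc k (mk m n)
      rw [bcTensorHom_bc, bcTensorInv_mk, mul_one]
  inv_hom_id := bcTensor_hom_ext fun k l m n => by
    change (bcTensorHom M N).hom ((bcTensorInv M N).hom (mk (bc k m) (bc l n))) =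
      mk (bc k m) (bc l n)
    have h1 : bc (k * l) m = ract (l ⊗ₜ[K] (1 : B)) (bc k m) := by
      rw [ract_bc, ract_one, mul_comm]
    have h2 : bc l n = lact (l ⊗ₜ[K] (1 : B)) (bc (1 : K') n) := by
      rw [lact_bc, lact_one, mul_one]
    rw [bcTensorInv_mk, bcTensorHom_bc, h1, h2, ract_mk_eq]

variable {M N}

end Tensor

section Diagonal

open DPicard

variable (K A) in
/-- `toDiag` as a `K`-linear equivalence. -/
def toDiagLinear : A ≃ₗ[K] diagonalBimodule K A :=
  { toDiag with
    map_smul' := fun c a => by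
      change toDiag (c • a) = c • toDiag a
      rw [base_smul_eq_lact, lact_toDiag, Algebra.smul_def] }

variable (K A K') in
/-- `K' ⊗ A ≅ A'` as additive groups. -/
def bcDiagEquiv :
    (baseChangeFunctor K A A K').obj (diagonalBimodule K A) ≃+ diagonalBimodule K' (K' ⊗[K] A) :=
  ((TensorProduct.congr (LinearEquiv.refl K K') (toDiagLinear K A)).symm.toAddEquiv).trans
    (toDiag (K := K') (A := K' ⊗[K] A))

@[simp]
lemma bcDiagEquiv_bc (k : K') (a : A) :
    bcDiagEquiv K A K' (bc k (toDiag a)) = toDiag (k ⊗ₜ[K] a) := rfl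

variable (K A K') in
/-- The map `K' ⊗ A → A'` of bimodules. -/
def bcDiagHom : (baseChangeFunctor K A A K').obj (diagonalBimodule K A) ⟶
    diagonalBimodule K' (K' ⊗[K] A) :=
  bcHomMk (bcDiagEquiv K A K').toAddMonoidHom
    (fun k j a m => by
      induction m using diag_cases with
      | h m =>
        change bcDiagEquiv K A K' _ = lact _ (bcDiagEquiv K A K' _)
        rw [lact_toDiag, bcDiagEquiv_bc, bcDiagEquiv_bc, lact_toDiag,
          Algebra.TensorProduct.tmul_mul_tmul])
    (fun k j b m => by
      induction m using diag_cases with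
      | h m =>
        change bcDiagEquiv K A K' _ = ract _ (bcDiagEquiv K A K' _)
        rw [ract_toDiag, bcDiagEquiv_bc, bcDiagEquiv_bc, ract_toDiag,
          Algebra.TensorProduct.tmul_mul_tmul, mul_comm k j])

variable (K A K') in
/-- `K' ⊗ A ≅ A'` as bimodules. -/
def bcDiagIso : (baseChangeFunctor K A A K').obj (diagonalBimodule K A) ≅
    diagonalBimodule K' (K' ⊗[K] A) :=
  (LinearEquiv.ofBijective (bcDiagHom K A K').hom (bcDiagEquiv K A K').bijective).toModuleIso

end Diagonal

section Projective

variable (K A B K') in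
/-- The homomorphism `a ⊗ b ↦ (1 ⊗ a) ⊗ (1 ⊗ b)` of enveloping algebras. -/
def envMap : A ⊗[K] Bᵐᵒᵖ →ₐ[K] (K' ⊗[K] A) ⊗[K'] (K' ⊗[K] B)ᵐᵒᵖ :=
  Algebra.TensorProduct.lift
    (((Algebra.TensorProduct.includeLeft :
      K' ⊗[K] A →ₐ[K'] (K' ⊗[K] A) ⊗[K'] (K' ⊗[K] B)ᵐᵒᵖ).restrictScalars K).comp
        Algebra.TensorProduct.includeRight)
    (((Algebra.TensorProduct.includeRight :
      (K' ⊗[K] B)ᵐᵒᵖ →ₐ[K'] (K' ⊗[K] A) ⊗[K'] (K' ⊗[K] B)ᵐᵒᵖ).restrictScalars K).comp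
        (AlgHom.op (Algebra.TensorProduct.includeRight : B →ₐ[K] K' ⊗[K] B)))
    fun _ _ => (Commute.one_right _).tmul (Commute.one_left _)

lemma envMap_tmul (a : A) (b : B) :
    envMap K A B K' (a ⊗ₜ[K] op b) = (1 ⊗ₜ[K] a) ⊗ₜ[K'] op (1 ⊗ₜ[K] b) := by
  refine (Algebra.TensorProduct.lift_tmul _ _ _ _ _).trans ?_
  refine (Algebra.TensorProduct.tmul_mul_tmul (R := K') (1 ⊗ₜ[K] a : K' ⊗[K] A) 1 1
    (op (1 ⊗ₜ[K] b : K' ⊗[K] B))).trans ?_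
  rw [mul_one, one_mul]

variable {M : ModuleCat.{u} (A ⊗[K] Bᵐᵒᵖ)}
  {E E' : ModuleCat.{u} ((K' ⊗[K] A) ⊗[K'] (K' ⊗[K] B)ᵐᵒᵖ)}

variable (E) in
/-- The restriction of an `A'`-`B'`-bimodule to an `A`-`B`-bimodule. -/
def bcRes : ModuleCat.{u} (A ⊗[K] Bᵐᵒᵖ) :=
  (ModuleCat.restrictScalars (envMap K A B K').toRingHom).obj E

variable (E) in
/-- The identity map from an `A'`-`B'`-bimodule to its restriction. -/
def toRes : E ≃+ bcRes E := AddEquiv.refl E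

lemma smul_toRes (r : A ⊗[K] Bᵐᵒᵖ) (x : bcRes E) :
    (toRes E).symm (r • x) = envMap K A B K' r • (toRes E).symm x := rfl

lemma lact_toRes (a : A) (x : bcRes E) :
    (toRes E).symm (lact a x) = lact ((1 : K') ⊗ₜ[K] a) ((toRes E).symm x) := by
  have h := envMap_tmul (K := K) (K' := K') a (1 : B)
  exact (smul_toRes (a ⊗ₜ[K] op (1 : B)) x).trans (by rw [h]; rfl)

lemma ract_toRes (b : B) (x : bcRes E) :
    (toRes E).symm (ract b x) = ract ((1 : K') ⊗ₜ[K] b) ((toRes E).symm x) := by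
  have h := envMap_tmul (K := K) (K' := K') (1 : A) b
  exact (smul_toRes ((1 : A) ⊗ₜ[K] op b) x).trans (by rw [h]; rfl)

lemma lact_tmul (k : K') (a : A) (x : E) :
    lact (k ⊗ₜ[K] a : K' ⊗[K] A) x = k • lact ((1 : K') ⊗ₜ[K] a) x := by
  rw [base_smul_eq_lact, ← lact_mul, Algebra.TensorProduct.algebraMap_apply,
    Algebra.TensorProduct.tmul_mul_tmul, mul_one, one_mul]
  rfl

lemma ract_tmul (k : K') (b : B) (x : E) :
    ract (k ⊗ₜ[K] b : K' ⊗[K] B) x = k • ract ((1 : K') ⊗ₜ[K] b) x := by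
  rw [base_smul_eq_ract, ← ract_mul, Algebra.TensorProduct.algebraMap_apply,
    Algebra.TensorProduct.tmul_mul_tmul, mul_one, one_mul]
  rfl

/-- Extension of scalars of a morphism from an `A`-`B`-bimodule to the restriction of an
`A'`-`B'`-bimodule. -/
def bcExtend (g : M ⟶ bcRes E) : (baseChangeFunctor K A B K').obj M ⟶ E :=
  bcHomMk
    (bcLift (((smulAddHom K' E).flip.comp
        ((toRes E).symm.toAddMonoidHom.comp g.hom.toAddMonoidHom)).flip)
      fun c k m => by
        change (c • k) • (toRes E).symm (g.hom m) = k • (toRes E).symm (g.hom (c • m))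
        rw [base_smul_eq_lact c m, hom_lact, lact_toRes, ← lact_tmul, Algebra.algebraMap_eq_smul_one,
          ← TensorProduct.smul_tmul]
        rfl)
    (fun k j a m => by
      change (k * j) • (toRes E).symm (g.hom (lact a m)) = lact _ (j • (toRes E).symm (g.hom m))
      rw [lact_tmul, hom_lact, lact_toRes, mul_smul, base_smul_eq_ract j,
        base_smul_eq_ract j, ract_lact])
    (fun k j b m => by
      change (k * j) • (toRes E).symm (g.hom (ract b m)) = ract _ (j • (toRes E).symm (g.hom m))
      rw [ract_tmul, hom_ract, ract_toRes, mul_smul, base_smul_eq_lact j,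
        base_smul_eq_lact j, ract_lact])

lemma bcExtend_bc (g : M ⟶ bcRes E) (k : K') (m : M) :
    (bcExtend g).hom (bc k m) = k • (toRes E).symm (g.hom m) := rfl

/-- The unit `m ↦ 1 ⊗ m` followed by the restriction of a morphism. -/
def bcRestrict (f : (baseChangeFunctor K A B K').obj M ⟶ E) : M ⟶ bcRes E :=
  homMk ((toRes E).toAddMonoidHom.comp (f.hom.toAddMonoidHom.comp (bcHom K' M 1)))
    (fun a m => by
      apply (toRes E).symm.injective
      rw [lact_toRes]
      change f.hom (bc 1 (lact a m)) = lact _ (f.hom (bc 1 m))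
      rw [← hom_lact, lact_bc, one_mul])
    (fun b m => by
      apply (toRes E).symm.injective
      rw [ract_toRes]
      change f.hom (bc 1 (ract b m)) = ract _ (f.hom (bc 1 m))
      rw [← hom_ract, ract_bc, one_mul])

/-- Base change has the character of a left adjoint of restriction along `envMap`, with `bcExtend`
and `bcRestrict` as the two transposes. Restriction preserves epimorphisms, so a lifting problem is
transposed, solved over A ⊗ Bᵐᵒᵖ and transposed back. -/
instance projective_baseChange (M : ModuleCat.{u} (A ⊗[K] Bᵐᵒᵖ)) [Projective M] :
    Projective ((baseChangeFunctor K A B K').obj M) where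
  factors {E X} f e _ := by
    let e' : bcRes E ⟶ bcRes X := (ModuleCat.restrictScalars (envMap K A B K').toRingHom).map e
    have : Epi e' := (ModuleCat.epi_iff_surjective _).2 ((ModuleCat.epi_iff_surjective e).1 ‹_›)
    refine ⟨bcExtend (Projective.factorThru (bcRestrict f) e'), bc_hom_ext fun k m => ?_⟩
    have h : e'.hom ((Projective.factorThru (bcRestrict f) e').hom m) = (bcRestrict f).hom m :=
      congr($(Projective.factorThru_comp (bcRestrict f) e').hom m)
    change e.hom ((bcExtend _).hom (bc k m)) = _
    -- The restricted triangle gives agreement on the elements 1 ⊗ m only; K'-linearity gives the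
    -- rest.
    have h' : bc k m = k • bc (1 : K') m := by
      rw [base_smul_eq_lact, Algebra.TensorProduct.algebraMap_apply, lact_bc, lact_one, mul_one]
      rfl
    rw [bcExtend_bc, h', base_smul_eq_lact, base_smul_eq_lact, hom_lact, hom_lact]
    exact congrArg (fun y => lact _ ((toRes X).symm y)) h

end Projective

end BaseChange

end Bim

/-! ### Total complexes under functors preserving coproducts -/

namespace HomologicalComplex

open Limits

section MapBifunctor

variable {C₁ C₂ E₁ E₂ D D' : Type*} [Category* C₁] [Category* C₂] [Category* E₁] [Category* E₂]
  [Category* D] [Category* D'] [HasZeroMorphisms C₁] [HasZeroMorphisms C₂] [HasZeroMorphisms E₁]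
  [HasZeroMorphisms E₂] [Preadditive D] [Preadditive D']
  (F : C₁ ⥤ C₂ ⥤ D) [F.PreservesZeroMorphisms] [∀ X, (F.obj X).PreservesZeroMorphisms]
  (G : E₁ ⥤ E₂ ⥤ D') [G.PreservesZeroMorphisms] [∀ X, (G.obj X).PreservesZeroMorphisms]
  (H : D ⥤ D') (P : CochainComplex C₁ ℤ) (X : CochainComplex C₂ ℤ)
  (P' : CochainComplex E₁ ℤ) (X' : CochainComplex E₂ ℤ)
  (τ : ∀ i j, (G.obj (P'.X i)).obj (X'.X j) ≅ H.obj ((F.obj (P.X i)).obj (X.X j)))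
  [HasMapBifunctor P X F (ComplexShape.up ℤ)] [HasMapBifunctor P' X' G (ComplexShape.up ℤ)]

/-- The comparison morphism, in degree `n`, between the total complex of a bicomplex and the image
of such a total complex under a functor. -/
def mapBifunctorComparison (n : ℤ) : (mapBifunctor P' X' G (ComplexShape.up ℤ)).X n ⟶
    H.obj ((mapBifunctor P X F (ComplexShape.up ℤ)).X n) :=
  mapBifunctorDesc fun i j h =>
    (τ i j).hom ≫ H.map (ιMapBifunctor P X F (ComplexShape.up ℤ) i j n h)

lemma ι_mapBifunctorComparison (n i j : ℤ)
    (h : ComplexShape.π (ComplexShape.up ℤ) (ComplexShape.up ℤ) (ComplexShape.up ℤ) (i, j) = n) :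
    ιMapBifunctor P' X' G (ComplexShape.up ℤ) i j n h ≫
        mapBifunctorComparison F G H P X P' X' τ n =
      (τ i j).hom ≫ H.map (ιMapBifunctor P X F (ComplexShape.up ℤ) i j n h) :=
  ι_mapBifunctorDesc _ i j h

/-- Since H preserves coproducts, the target is a coproduct along the images of the inclusions, and
the inverses of the τ assemble to a map back. -/
lemma isIso_mapBifunctorComparison [∀ J : Type, PreservesColimitsOfShape (Discrete J) H] (n : ℤ) :
    IsIso (mapBifunctorComparison F G H P X P' X' τ n) := by
  let Z := ((F.mapBifunctorHomologicalComplex _ _).obj P).obj X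
  let hc := isColimitCofanMkObjOfIsColimit H _
    (fun j : (ComplexShape.π (ComplexShape.up ℤ) (ComplexShape.up ℤ) (ComplexShape.up ℤ)) ⁻¹' {n} =>
      ιMapBifunctor P X F (ComplexShape.up ℤ) j.1.1 j.1.2 n j.2)
    (Z.toGradedObject.isColimitCofanMapObj
      (ComplexShape.π (ComplexShape.up ℤ) (ComplexShape.up ℤ) (ComplexShape.up ℤ)) n)
  let inv : H.obj ((mapBifunctor P X F (ComplexShape.up ℤ)).X n) ⟶
      (mapBifunctor P' X' G (ComplexShape.up ℤ)).X n :=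
    Cofan.IsColimit.desc hc fun j => (τ j.1.1 j.1.2).inv ≫
      ιMapBifunctor P' X' G (ComplexShape.up ℤ) j.1.1 j.1.2 n j.2
  have h_inv (i j : ℤ) (h : ComplexShape.π (ComplexShape.up ℤ) (ComplexShape.up ℤ)
      (ComplexShape.up ℤ) (i, j) = n) :
      H.map (ιMapBifunctor P X F (ComplexShape.up ℤ) i j n h) ≫ inv =
        (τ i j).inv ≫ ιMapBifunctor P' X' G (ComplexShape.up ℤ) i j n h :=
    Cofan.IsColimit.fac hc _ ⟨⟨i, j⟩, h⟩
  refine ⟨inv, ?_, ?_⟩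
  · refine mapBifunctor.hom_ext fun i j h => ?_
    rw [reassoc_of% ι_mapBifunctorComparison F G H P X P' X' τ, h_inv, Iso.hom_inv_id_assoc,
      Category.comp_id]
  · refine Cofan.IsColimit.hom_ext hc _ _ fun ⟨⟨i, j⟩, h⟩ => ?_
    have h : ComplexShape.π (ComplexShape.up ℤ) (ComplexShape.up ℤ) (ComplexShape.up ℤ) (i, j) = n :=
      h
    change H.map (ιMapBifunctor P X F (ComplexShape.up ℤ) i j n h) ≫ inv ≫ _ =
      H.map (ιMapBifunctor P X F (ComplexShape.up ℤ) i j n h) ≫ 𝟙 _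
    rw [← Category.assoc, h_inv, Category.assoc, ι_mapBifunctorComparison, Iso.inv_hom_id_assoc,
      Category.comp_id]

variable [H.Additive]
  (h₁ : ∀ i i' j, (G.map (P'.d i i')).app (X'.X j) ≫ (τ i' j).hom =
    (τ i j).hom ≫ H.map ((F.map (P.d i i')).app (X.X j)))
  (h₂ : ∀ i j j', (G.obj (P'.X i)).map (X'.d j j') ≫ (τ i j').hom =
    (τ i j).hom ≫ H.map ((F.obj (P.X i)).map (X.d j j')))

include h₁ h₂ in
lemma mapBifunctorComparison_d (n : ℤ) :
    mapBifunctorComparison F G H P X P' X' τ n ≫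
        H.map ((mapBifunctor P X F (ComplexShape.up ℤ)).d n (n + 1)) =
      (mapBifunctor P' X' G (ComplexShape.up ℤ)).d n (n + 1) ≫
        mapBifunctorComparison F G H P X P' X' τ (n + 1) := by
  refine mapBifunctor.hom_ext fun i j h => ?_
  have h' : i + j = n := h
  rw [reassoc_of% ι_mapBifunctorComparison F G H P X P' X' τ, ← H.map_comp,
    mapBifunctor.d_eq, mapBifunctor.d_eq,
    Preadditive.add_comp, Preadditive.comp_add, Preadditive.comp_add, mapBifunctor.ι_D₁,
    mapBifunctor.ι_D₂, mapBifunctor.ι_D₁_assoc, mapBifunctor.ι_D₂_assoc,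
    mapBifunctor.d₁_eq _ _ _ _ (show (ComplexShape.up ℤ).Rel i (i + 1) from rfl) _ _
      (show i + 1 + j = n + 1 by lia),
    mapBifunctor.d₂_eq _ _ _ _ _ (show (ComplexShape.up ℤ).Rel j (j + 1) from rfl) _
      (show i + (j + 1) = n + 1 by lia),
    mapBifunctor.d₁_eq _ _ _ _ (show (ComplexShape.up ℤ).Rel i (i + 1) from rfl) _ _
      (show i + 1 + j = n + 1 by lia),
    mapBifunctor.d₂_eq _ _ _ _ _ (show (ComplexShape.up ℤ).Rel j (j + 1) from rfl) _
      (show i + (j + 1) = n + 1 by lia), H.map_add, Preadditive.comp_add]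
  congr 1
  · rw [Functor.map_units_smul, Linear.comp_units_smul, Linear.units_smul_comp, Category.assoc,
      ι_mapBifunctorComparison, H.map_comp, reassoc_of% h₁]
  · rw [Functor.map_units_smul, Linear.comp_units_smul, Linear.units_smul_comp, Category.assoc,
      ι_mapBifunctorComparison, H.map_comp, reassoc_of% h₂]

/-- The image of a total complex under a functor that preserves coproducts. -/
def mapBifunctorMapIso [∀ J : Type, PreservesColimitsOfShape (Discrete J) H] :
    mapBifunctor P' X' G (ComplexShape.up ℤ) ≅
      (H.mapHomologicalComplex _).obj (mapBifunctor P X F (ComplexShape.up ℤ)) :=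
  Hom.isoOfComponents
    (fun n => @asIso _ _ _ _ (mapBifunctorComparison F G H P X P' X' τ n)
      (isIso_mapBifunctorComparison F G H P X P' X' τ n))
    (by
      rintro n _ rfl
      exact mapBifunctorComparison_d F G H P X P' X' τ h₁ h₂ n)

end MapBifunctor

end HomologicalComplex

namespace Bim

variable {K : Type u} [CommRing K] {A B C : Type u} [Ring A] [Algebra K A] [Ring B] [Algebra K B]
  [Ring C] [Algebra K C] (K' : Type u) [CommRing K'] [Algebra K K']

/-- Base change of the total tensor product of complexes of bimodules. -/
def bcTensorComplexIso (P : CochainComplex (ModuleCat.{u} (A ⊗[K] Bᵐᵒᵖ)) ℤ)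
    (X : CochainComplex (ModuleCat.{u} (B ⊗[K] Cᵐᵒᵖ)) ℤ) :
    tensorComplex K' (K' ⊗[K] A) (K' ⊗[K] B) (K' ⊗[K] C)
        (((baseChangeFunctor K A B K').mapHomologicalComplex _).obj P)
        (((baseChangeFunctor K B C K').mapHomologicalComplex _).obj X) ≅
      ((baseChangeFunctor K A C K').mapHomologicalComplex _).obj (tensorComplex K A B C P X) :=
  HomologicalComplex.mapBifunctorMapIso (tensorFunctor K A B C) (tensorFunctor K' _ _ _)
    (baseChangeFunctor K A C K') P X
    (((baseChangeFunctor K A B K').mapHomologicalComplex _).obj P)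
    (((baseChangeFunctor K B C K').mapHomologicalComplex _).obj X)
    (fun i j => (bcTensorIso K' (P.X i) (X.X j)).symm)
    (fun _ _ _ => bcTensor_hom_ext fun _ _ _ _ => rfl)
    (fun _ _ _ => bcTensor_hom_ext fun _ _ _ _ => rfl)

end Bim

/-! ### Base change of quasi-isomorphisms between complexes of flat modules -/

namespace Bim

attribute [local instance] baseModule base_isScalarTower

section TensorFunctor

variable {K : Type u} [CommRing K] {R : Type u} [Ring R] [Algebra K R]

variable (K R) in
/-- The functor `V ⊗_K -` on the modules over a `K`-algebra. -/
def lTensorFunctor (V : Type u) [AddCommGroup V] [Module K V] :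
    ModuleCat.{u} R ⥤ ModuleCat.{u} K where
  obj M := ModuleCat.of K (V ⊗[K] M)
  map f := ModuleCat.ofHom ((baseMap K f).lTensor V)
  map_id M := ModuleCat.hom_ext (LinearMap.lTensor_id V M)
  map_comp f g := ModuleCat.hom_ext (LinearMap.lTensor_comp V (baseMap K g) (baseMap K f))

instance (V : Type u) [AddCommGroup V] [Module K V] : (lTensorFunctor K R V).Additive where
  map_add {_ _ f g} := ModuleCat.hom_ext (LinearMap.lTensor_add V (baseMap K f) (baseMap K g))

lemma preservesHomology_lTensorFunctor (V : Type u) [AddCommGroup V] [Module K V]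
    [Module.Flat K V] : (lTensorFunctor K R V).PreservesHomology :=
  ModuleCat.preservesHomology_of_exact _ fun f g h y hy =>
    ((Module.Flat.lTensor_exact V (f := baseMap K f) (g := baseMap K g) h) y).1 hy

variable {V W : Type u} [AddCommGroup V] [Module K V] [AddCommGroup W] [Module K W]

/-- The natural transformation `V ⊗_K - ⟶ W ⊗_K -`. -/
def rTensor (φ : V →ₗ[K] W) (M : ModuleCat.{u} R) :
    (lTensorFunctor K R V).obj M →ₗ[K] (lTensorFunctor K R W).obj M :=
  LinearMap.rTensor M φ

lemma rTensor_natural (φ : V →ₗ[K] W) {M N : ModuleCat.{u} R} (f : M ⟶ N)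
    (x : (lTensorFunctor K R V).obj M) :
    rTensor φ N (((lTensorFunctor K R V).map f).hom x) =
      ((lTensorFunctor K R W).map f).hom (rTensor φ M x) :=
  LinearMap.congr_fun ((LinearMap.rTensor_comp_lTensor (R := K) (f := φ) (g := baseMap K f)).trans
    (LinearMap.lTensor_comp_rTensor (R := K) (f := φ) (g := baseMap K f)).symm) x

lemma exact_rTensor {U : Type u} [AddCommGroup U] [Module K U] (φ : U →ₗ[K] V) (ψ : V →ₗ[K] W)
    (h : Function.Exact φ ψ) (hψ : Function.Surjective ψ) (M : ModuleCat.{u} R) :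
    Function.Exact (rTensor φ M) (rTensor ψ M) :=
  rTensor_exact M h hψ

variable (K V) in
lemma exists_flat_surjective : ∃ (F : Type u) (_ : AddCommGroup F) (_ : Module K F)
    (_ : Module.Flat K F) (π : F →ₗ[K] V), Function.Surjective π :=
  ⟨V →₀ K, inferInstance, inferInstance, inferInstance, Finsupp.linearCombination K id,
    Finsupp.linearCombination_id_surjective K V⟩

end TensorFunctor

section

variable {K : Type u} [CommRing K] {R : Type u} [Ring R] [Algebra K R]
  {P X : CochainComplex (ModuleCat.{u} R) ℤ} (f : P ⟶ X)

variable (K) in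
/-- The mapping cone of `V ⊗_K f` is exact in a given degree, in terms of elements. -/
def TensorConeExactAt (V : Type u) [AddCommGroup V] [Module K V] (n : ℤ) : Prop :=
  ∀ (m p q : ℤ), m + 1 = n → n + 1 = p → p + 1 = q →
    ∀ (x : (lTensorFunctor K R V).obj (P.X p)) (y : (lTensorFunctor K R V).obj (X.X n)),
      ((lTensorFunctor K R V).map (P.d p q)).hom x = 0 →
      ((lTensorFunctor K R V).map (f.f p)).hom x = ((lTensorFunctor K R V).map (X.d n p)).hom y →
      ∃ (x' : (lTensorFunctor K R V).obj (P.X n)) (y' : (lTensorFunctor K R V).obj (X.X m)),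
        x = ((lTensorFunctor K R V).map (P.d n p)).hom x' ∧
        y = ((lTensorFunctor K R V).map (f.f n)).hom x' + ((lTensorFunctor K R V).map (X.d m n)).hom y'

lemma tensorConeExactAt_of_flat [QuasiIso f] (V : Type u) [AddCommGroup V] [Module K V]
    [Module.Flat K V] (n : ℤ) : TensorConeExactAt K f V n := by
  have := preservesHomology_lTensorFunctor (K := K) (R := R) V
  have h := (CochainComplex.coneExact_iff_quasiIso
    (((lTensorFunctor K R V).mapHomologicalComplex (ComplexShape.up ℤ)).map f)).2 inferInstance
  exact fun m p q hm hp hq => h m n p q hm hp hq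

/-- A quasi-isomorphism between bounded above complexes of flat modules remains one after tensoring
with any module. -/
lemma tensorConeExactAt [QuasiIso f] (hP : ∀ i, Module.Flat K (P.X i))
    (hX : ∀ i, Module.Flat K (X.X i)) (N : ℤ) [P.IsStrictlyLE N] [X.IsStrictlyLE N] (k : ℕ) :
    ∀ (n : ℤ), N < n + k → ∀ (V : Type u) [AddCommGroup V] [Module K V],
      TensorConeExactAt K f V n := by
  -- Descending induction on the degree n. The module V varies in the induction hypothesis, which is
  -- used one degree higher for a kernel.
  induction k with
  | zero =>
    intro n hn V _ _ m p q hm hp hq x y hx hy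
    have hz (i : ℤ) (hi : N < i) (M : CochainComplex (ModuleCat.{u} R) ℤ) [M.IsStrictlyLE N] :
        Subsingleton ((lTensorFunctor K R V).obj (M.X i)) :=
      ModuleCat.subsingleton_of_isZero
        ((lTensorFunctor K R V).map_isZero (M.isZero_of_isStrictlyLE N i hi))
    have := hz p (by lia) P
    have := hz n (by lia) X
    exact ⟨0, 0, Subsingleton.elim _ _, Subsingleton.elim _ _⟩
  | succ k ih =>
    intro n hn V _ _ m p q hm hp hq x y hx hy
    subst hp
    -- Dimension shifting along 0 → ker π → F → V → 0, which stays exact after tensoring with the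
    -- flat terms of P and X.
    obtain ⟨F, _, _, _, π, hπ⟩ := exists_flat_surjective K V
    let ι : LinearMap.ker π →ₗ[K] F := (LinearMap.ker π).subtype
    have hι : Function.Exact ι π := LinearMap.exact_subtype_ker_map π
    have hπ' (M : ModuleCat.{u} R) : Function.Surjective (rTensor π M) :=
      LinearMap.rTensor_surjective M hπ
    have hex (M : ModuleCat.{u} R) : Function.Exact (rTensor ι M) (rTensor π M) :=
      exact_rTensor ι π hι hπ M
    have hinj (M : ModuleCat.{u} R) [Module.Flat K M] : Function.Injective (rTensor ι M) :=
      Module.Flat.rTensor_preserves_injective_linearMap ι (LinearMap.ker π).injective_subtype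
    obtain ⟨x₁, rfl⟩ := hπ' _ x
    obtain ⟨y₁, rfl⟩ := hπ' _ y
    have hd (U : Type u) [AddCommGroup U] [Module K U] (M : CochainComplex (ModuleCat.{u} R) ℤ)
        (i j l : ℤ) (z : (lTensorFunctor K R U).obj (M.X i)) :
        ((lTensorFunctor K R U).map (M.d j l)).hom (((lTensorFunctor K R U).map (M.d i j)).hom z) =
          0 := by
      rw [← ModuleCat.comp_apply, ← Functor.map_comp, M.d_comp_d, Functor.map_zero]
      rfl
    have hc (U : Type u) [AddCommGroup U] [Module K U] (i j : ℤ)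
        (z : (lTensorFunctor K R U).obj (P.X i)) :
        ((lTensorFunctor K R U).map (f.f j)).hom (((lTensorFunctor K R U).map (P.d i j)).hom z) =
          ((lTensorFunctor K R U).map (X.d i j)).hom
            (((lTensorFunctor K R U).map (f.f i)).hom z) := by
      rw [← ModuleCat.comp_apply, ← ModuleCat.comp_apply, ← Functor.map_comp, ← Functor.map_comp,
        f.comm]
    -- The lifts x₁, y₁ over F need not form a cone cocycle. Their defects d x₁ and f x₁ - d y₁ come
    -- from a and b over ker π, which form a cone cocycle one degree higher.
    obtain ⟨a, ha⟩ := (hex _ _).1 ((rTensor_natural π _ x₁).trans hx)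
    obtain ⟨b, hb⟩ := (hex _ (((lTensorFunctor K R F).map (f.f (n + 1))).hom x₁ -
        ((lTensorFunctor K R F).map (X.d n (n + 1))).hom y₁)).1 (by
      rw [map_sub, rTensor_natural, rTensor_natural, hy, sub_self])
    obtain ⟨a', b', ha', hb'⟩ := ih (n + 1) (by lia) (LinearMap.ker π) n q (q + 1) rfl hq rfl a b
      (hinj _ (by rw [rTensor_natural, ha, hd, map_zero]))
      (hinj _ (by rw [rTensor_natural, rTensor_natural, ha, hb, map_sub, hc, hd, sub_zero]))
    -- Correcting the lifts by -a' and +b' makes them a cone cocycle over the flat module F. It is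
    -- then a coboundary, and projecting to V removes the corrections.
    have h1 : ((lTensorFunctor K R F).map (P.d (n + 1) q)).hom
        (x₁ - rTensor ι _ a') = 0 := by
      rw [map_sub, ← rTensor_natural, ← ha', ha, sub_self]
    have h2 : ((lTensorFunctor K R F).map (f.f (n + 1))).hom (x₁ - rTensor ι _ a') =
        ((lTensorFunctor K R F).map (X.d n (n + 1))).hom (y₁ + rTensor ι _ b') := by
      rw [map_sub, map_add, ← rTensor_natural, ← rTensor_natural, sub_eq_iff_eq_add,
        add_assoc, add_comm (rTensor ι _ _) (rTensor ι _ _), ← map_add, ← hb', hb]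
      abel
    obtain ⟨x', y', hx', hy'⟩ := tensorConeExactAt_of_flat f F n m (n + 1) q hm rfl hq _ _
      h1 h2
    have hπι (M : ModuleCat.{u} R) (z : (lTensorFunctor K R (LinearMap.ker π)).obj M) :
        rTensor π M (rTensor ι M z) = 0 := (hex M _).2 ⟨z, rfl⟩
    refine ⟨rTensor π _ x', rTensor π _ y', ?_, ?_⟩
    · have := congrArg (rTensor π _) hx'
      rwa [map_sub, hπι, sub_zero, rTensor_natural] at this
    · have := congrArg (rTensor π _) hy'
      rwa [map_add, map_add, hπι, add_zero, rTensor_natural, rTensor_natural] at this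

end

variable {K : Type u} [CommRing K] {A B : Type u} [Ring A] [Algebra K A] [Ring B] [Algebra K B]
  {K' : Type u} [CommRing K'] [Algebra K K']

/-- Cone exactness depends only on underlying additive groups and maps, which are those of K' ⊗_K -;
the bimodule structure plays no role. -/
lemma quasiIso_baseChange {P X : CochainComplex (ModuleCat.{u} (A ⊗[K] Bᵐᵒᵖ)) ℤ} (f : P ⟶ X)
    [QuasiIso f] (hP : ∀ i, Module.Flat K (P.X i)) (hX : ∀ i, Module.Flat K (X.X i)) (N : ℤ)
    [P.IsStrictlyLE N] [X.IsStrictlyLE N] :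
    QuasiIso (((baseChangeFunctor K A B K').mapHomologicalComplex (ComplexShape.up ℤ)).map f) := by
  rw [← CochainComplex.coneExact_iff_quasiIso]
  intro m n p q hm hp hq x y hx hy
  exact tensorConeExactAt f hP hX N (N + 1 - n).toNat n (by lia) K' m p q hm hp hq x y hx hy

end Bim

/-! ### Derived base change as a homomorphism of monoids -/

namespace DPicard

open MonoidalCategory ProjRes DerivedCategory

attribute [local instance] Bim.monoidal Bim.complexMonoidal
attribute [local instance] Bim.baseModule Bim.base_isScalarTower

section

variable {K : Type u} [CommRing K] {A : Type u} [Ring A] [Algebra K A] [Module.Flat K A]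

lemma flat_envelopingAlgebra : Module.Flat K (A ⊗[K] Aᵐᵒᵖ) := by
  have : Module.Flat K Aᵐᵒᵖ := Module.Flat.of_linearEquiv (MulOpposite.opLinearEquiv K).symm
  infer_instance

lemma flat_of_isBoundedProjective {P : CochainComplex (BimCat K A A) ℤ}
    (hP : IsBoundedProjective P) (i : ℤ) : Module.Flat K (P.X i) := by
  have := flat_envelopingAlgebra (K := K) (A := A)
  have := hP.projective i
  exact Bim.flat_of_projective (P.X i)

/-- Allows the derived base change of a derived tensor product to be computed on P ⊗ X itself,
without resolving again. -/
lemma flat_tensor {P X : CochainComplex (BimCat K A A) ℤ} (hP : IsBoundedProjective P)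
    (hX : ∀ i, Module.Flat K (X.X i)) (n : ℤ) : Module.Flat K ((P ⊗ X).X n) := by
  have (j : ComplexShape.π (ComplexShape.up ℤ) (ComplexShape.up ℤ) (ComplexShape.up ℤ) ⁻¹' {n}) :
      Module.Flat K (Bim.tensorObj K A A A (P.X j.1.1) (X.X j.1.2)) := by
    have := hP.projective j.1.1
    have := hX j.1.2
    exact Bim.flat_tensorObj _ _
  exact Bim.flat_coproduct (K := K) fun j : ComplexShape.π (ComplexShape.up ℤ) (ComplexShape.up ℤ)
    (ComplexShape.up ℤ) ⁻¹' {n} => Bim.tensorObj K A A A (P.X j.1.1) (X.X j.1.2)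

/-- Allows the derived base change of A to be computed as K' ⊗ A. -/
lemma flat_single (n : ℤ) : Module.Flat K
    (((CochainComplex.singleFunctor (BimCat K A A) 0).obj (diagonalBimodule K A)).X n) := by
  by_cases h : n = 0
  · have : Module.Flat K (diagonalBimodule K A) :=
      Module.Flat.of_linearEquiv (Bim.toDiagLinear K A).symm
    exact Bim.flat_of_iso (HomologicalComplex.singleObjXIsoOfEq (ComplexShape.up ℤ) 0
      (diagonalBimodule K A) n h).symm
  · have := ModuleCat.subsingleton_of_isZero (HomologicalComplex.isZero_single_obj_X
      (ComplexShape.up ℤ) 0 (diagonalBimodule K A) n h)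
    exact inferInstanceAs (Module.Flat K
      (((HomologicalComplex.single (BimCat K A A) (ComplexShape.up ℤ) 0).obj
        (diagonalBimodule K A)).X n))

end

section

variable {K : Type u} [CommRing K] {A : Type u} [Ring A] [Algebra K A]
  (K' : Type u) [CommRing K'] [Algebra K K']

/-- Base change of complexes of bimodules. -/
abbrev complexBaseChange (P : CochainComplex (BimCat K A A) ℤ) :
    CochainComplex (BimCat K' (K' ⊗[K] A) (K' ⊗[K] A)) ℤ :=
  ((Bim.baseChangeFunctor K A A K').mapHomologicalComplex (ComplexShape.up ℤ)).obj P

lemma isStrictlyLE_complexBaseChange (P : CochainComplex (BimCat K A A) ℤ) (n : ℤ)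
    [P.IsStrictlyLE n] : (complexBaseChange K' P).IsStrictlyLE n :=
  (CochainComplex.isStrictlyLE_iff _ _).2 fun i hi =>
    (Bim.baseChangeFunctor K A A K').map_isZero (P.isZero_of_isStrictlyLE n i hi)

lemma isBoundedProjective_complexBaseChange {P : CochainComplex (BimCat K A A) ℤ}
    (hP : IsBoundedProjective P) : IsBoundedProjective (complexBaseChange K' P) := by
  obtain ⟨n, hn⟩ := hP.exists_isStrictlyLE
  refine ⟨⟨n, isStrictlyLE_complexBaseChange K' P n⟩, fun i => ?_⟩
  have := hP.projective i
  exact Bim.projective_baseChange (P.X i)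

variable [HasDerivedCategory.{w} (BimCat K A A)]
  [HasDerivedCategory.{w'} (BimCat K' (K' ⊗[K] A) (K' ⊗[K] A))]

/-- The derived base change as an object of `D⁻`. -/
def minusBaseChange (M : Minus (BimCat K A A)) : Minus (BimCat K' (K' ⊗[K] A) (K' ⊗[K] A)) :=
  ⟨derivedBaseChange K K' M, by
    obtain ⟨n, hn⟩ := (isBoundedProjective_res M).exists_isStrictlyLE
    have := isStrictlyLE_complexBaseChange K' (res M) n
    exact ⟨n, inferInstanceAs ((Q.obj (complexBaseChange K' (res M))).IsLE n)⟩⟩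

variable [Module.Flat K A]

/-- The derived base change can be computed with any bounded above complex of flat modules. -/
lemma derivedBaseChange_iso (M : Minus (BimCat K A A)) {P : CochainComplex (BimCat K A A) ℤ}
    (n : ℤ) [P.IsStrictlyLE n] (hP : ∀ i, Module.Flat K (P.X i)) (h : Nonempty (Q.obj P ≅ M.obj)) :
    Nonempty (derivedBaseChange K K' M ≅ Q.obj (complexBaseChange K' P)) := by
  obtain ⟨e⟩ := h
  obtain ⟨e'⟩ := nonempty_iso_res M
  obtain ⟨m, hm⟩ := (isBoundedProjective_res M).exists_isStrictlyLE
  -- P and the chosen resolution are joined by a roof all of whose complexes are bounded above by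
  -- max m n and flat over K, so both legs remain quasi-isomorphisms after base change.
  obtain ⟨R, s, t, hR, hR', hs, ht⟩ := exists_projective_roof n ⟨e ≪≫ e'.symm⟩
  have hRf := flat_of_isBoundedProjective (K := K) (A := A) ⟨⟨n, hR⟩, hR'⟩
  have := R.isStrictlyLE_of_le n (max m n) (le_max_right _ _)
  have := P.isStrictlyLE_of_le n (max m n) (le_max_right _ _)
  have := (res M).isStrictlyLE_of_le m (max m n) (le_max_left _ _)
  have hs' := Bim.quasiIso_baseChange (K' := K') s hRf hP (max m n)
  have ht' := Bim.quasiIso_baseChange (K' := K') t hRf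
    (flat_of_isBoundedProjective (isBoundedProjective_res M)) (max m n)
  exact ⟨(asIso (Q.map (((Bim.baseChangeFunctor K A A K').mapHomologicalComplex
    (ComplexShape.up ℤ)).map t))).symm ≪≫
    asIso (Q.map (((Bim.baseChangeFunctor K A A K').mapHomologicalComplex
      (ComplexShape.up ℤ)).map s))⟩

/-- On resolutions the two sides are K' ⊗ (P ⊗ X) and (K' ⊗ P) ⊗ (K' ⊗ X), which are isomorphic as
complexes. The first computes the left side because P ⊗ X is flat over K, the second the right side
because K' ⊗ X is again projective. -/
lemma derivedBaseChange_tensor (M N : Minus (BimCat K A A)) :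
    Nonempty (derivedBaseChange K K' (minusTensor M N) ≅
      derivedTensor K' (minusBaseChange K' M) (minusBaseChange K' N)) := by
  have hM := isBoundedProjective_res M
  have hN := isBoundedProjective_res N
  obtain ⟨m, hm⟩ := hM.exists_isStrictlyLE
  obtain ⟨n, hn⟩ := hN.exists_isStrictlyLE
  have := isStrictlyLE_tensor (res M) (res N) m n
  obtain ⟨e⟩ := derivedTensor_iso M N (nonempty_iso_res M) hN (nonempty_iso_res N)
  obtain ⟨f⟩ := derivedBaseChange_iso K' (minusTensor M N) (m + n)
    (flat_tensor hM (flat_of_isBoundedProjective hN)) ⟨e.symm⟩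
  obtain ⟨g⟩ := derivedTensor_iso (minusBaseChange K' M) (minusBaseChange K' N) ⟨Iso.refl _⟩
    (isBoundedProjective_complexBaseChange K' hN) ⟨Iso.refl _⟩
  exact ⟨f ≪≫ (Q.mapIso (Bim.bcTensorComplexIso K' (res M) (res N))).symm ≪≫ g.symm⟩

variable (K A) in
lemma derivedBaseChange_unit :
    Nonempty (derivedBaseChange K K' (minusUnit K A) ≅ diagonal K' (K' ⊗[K] A)) := by
  let D := (CochainComplex.singleFunctor (BimCat K A A) 0).obj (diagonalBimodule K A)
  obtain ⟨f⟩ := derivedBaseChange_iso K' (P := D) (minusUnit K A) 0 flat_single ⟨Iso.refl _⟩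
  exact ⟨f ≪≫ Q.mapIso ((HomologicalComplex.singleMapHomologicalComplex
    (Bim.baseChangeFunctor K A A K') (ComplexShape.up ℤ) 0).app (diagonalBimodule K A) ≪≫
      (HomologicalComplex.single _ (ComplexShape.up ℤ) 0).mapIso (Bim.bcDiagIso K A K'))⟩

variable (K A) in
/-- Derived base change of isomorphism classes. -/
def MinusClass.baseChange : MinusClass K A →* MinusClass K' (K' ⊗[K] A) where
  toFun := Quotient.map (minusBaseChange K') fun M N h => by
    obtain ⟨e⟩ := MinusClass.mk_eq_mk_iff.1 (Quotient.sound h)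
    obtain ⟨n, hn⟩ := (isBoundedProjective_res M).exists_isStrictlyLE
    obtain ⟨f⟩ := nonempty_iso_res M
    obtain ⟨g⟩ := derivedBaseChange_iso K' N n
      (flat_of_isBoundedProjective (isBoundedProjective_res M)) ⟨f ≪≫ e⟩
    exact Quotient.exact (MinusClass.mk_eq_mk_iff.2 ⟨g.symm⟩)
  map_one' := MinusClass.mk_eq_mk_iff.2 (derivedBaseChange_unit K A K')
  map_mul' x y := by
    induction x using MinusClass.ind with | h M
    induction y using MinusClass.ind with | h N
    exact MinusClass.mk_eq_mk_iff.2 (derivedBaseChange_tensor K' M N)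

end

end DPicard

end

/-! ### The homomorphism of derived Picard groups -/

theorem mainTheorem9 {K : Type u} [CommRing K] {A : Type u} [Ring A] [Algebra K A]
    [Module.Flat K A] {K' : Type u} [CommRing K'] [Algebra K K']
    [HasDerivedCategory.{w} (ModuleCat.{u} (A ⊗[K] Aᵐᵒᵖ))]
    [HasDerivedCategory.{w'} (ModuleCat.{u} ((K' ⊗[K] A) ⊗[K'] (K' ⊗[K] A)ᵐᵒᵖ))] :
    ∃ (G : Group (DPicard.DPic K A)) (G' : Group (DPicard.DPic K' (K' ⊗[K] A))),
      DPicard.IsDPicGroup G ∧ DPicard.IsDPicGroup G' ∧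
      ∃ φ : DPicard.DPic K A →* DPicard.DPic K' (K' ⊗[K] A),
        ∀ (T : DPicard.TiltingComplex K A) (T' : DPicard.TiltingComplex K' (K' ⊗[K] A)),
          φ (DPicard.DPic.mk T) = DPicard.DPic.mk T' ↔
            Nonempty (DPicard.derivedBaseChange K K' T.minus ≅ T'.obj) := by
  let G := DPicard.dpicGroup K A
  let G' := DPicard.dpicGroup K' (K' ⊗[K] A)
  refine ⟨G, G', DPicard.isDPicGroup_dpicGroup K A,
    DPicard.isDPicGroup_dpicGroup K' (K' ⊗[K] A),
    -- The monoid homomorphism restricted to units. As its values are classes of tilting complexes,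
    -- the final equivalence also shows that the base change of T is isomorphic to a tilting
    -- complex.
    (((DPicard.dpicEquiv K' (K' ⊗[K] A)).mulEquiv.symm.toMonoidHom).comp
      (Units.map (DPicard.MinusClass.baseChange K A K'))).comp
        (DPicard.dpicEquiv K A).mulEquiv.toMonoidHom, fun T T' => ?_⟩
  change (DPicard.dpicEquiv K' (K' ⊗[K] A)).symm
    (Units.map (DPicard.MinusClass.baseChange K A K') T.unit) = DPicard.DPic.mk T' ↔ _
  rw [Equiv.symm_apply_eq, DPicard.dpicEquiv_mk, Units.ext_iff]
  exact DPicard.MinusClass.mk_eq_mk_iff
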